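/- **Ball-Box Theorem.** Let $G$ be a connected real Lie group with Lie algebra $\mathfrak g$ and exponential map $\exp_G$, and let $D\subset\mathfrak g$ be a linear subspace which generates $\mathfrak g$: with $V^0=0$, $V^1=D$, $V^{i+1}=V^i+[D,V^i]$, one has $V^m=\mathfrak g$ for some $m$. Let $\mathfrak g=\bigoplus_{j=1}^m W_j$ be a direct sum decomposition with $V^i=\bigoplus_{j\le i}W_j$ for all $i$; write $x=\sum_j x_j$, $x_j\in W_j$ (and $x_j=0$ for $j>m$). Let $$[x,y]_n=\sum_{j,k}\,[x_j,y_k]_{j+k}=\lim_{\varepsilon\to0}\delta_\varepsilon^{-1}[\delta_\varepsilon x,\delta_\varepsilon y],\qquad \delta_\varepsilon x=\sum_j\varepsilon^jx_j ,$$ be the associated nilpotent Lie bracket on $\mathfrak g$, and let $N$ (the nilpotentisation) be the simply connected Lie group with Lie algebra $(\mathfrak g,[\cdot,\cdot]_n)$, identified with $\mathfrak g$ by its exponential map $\exp_N$; its product is given by the Baker-Campbell-Hausdorff formula, and $\exp_G$ is thus also a map $N\to G$. Let $X_1,\dots,X_p$ be a basis of $D$. Then there are a natural number $M$ and a surjective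 map $g:\{1,\dots,M\}\to\{1,\dots,p\}$ such that every $x$ in some neighbourhood of the identity of $G$ and every $y$ in some neighbourhood of the identity of $N$ can be written as $$x=\prod_{i=1}^M\exp_G(t_iX_{g(i)}),\qquad y=\prod_{i=1}^M\exp_N(\tau_iX_{g(i)})\qquad(t_i,\tau_i\in\mathbb R),$$ and such that the following holds. For $H\in\{G,N\}$ and $x\in H$ put $$\Delta^1_H(x)=\inf\Big\{\sum_{i=1}^M|t_i| : x=\prod_{i=1}^M\exp_H(t_iX_{g(i)})\Big\}\in[0,\infty],\qquad Box^1_H(\varepsilon)=\{x\in H:\Delta^1_H(x)<\varepsilon\}$$ (with $\inf\emptyset=\infty$). There are constants $C>1$ and $\varepsilon_0>0$ such that for all $0<\varepsilon<\varepsilon_0$ $$\exp_G\big(Box^1_N(\varepsilon)\big)\subset Box^1_G(C\varepsilon)\subset\exp_G\big(Box^1_N(C^2\varepsilon)\big).$$ -/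

import Mathlib

open scoped Manifold ContDiff ENNReal

instance minSmoothness_three_leInfty : ENat.LEInfty (minSmoothness ℝ 3) where
  out := by
    rw [minSmoothness_of_isRCLikeNormedField]
    exact ENat.LEInfty.out

noncomputable section

/-! ### The exponential map of a Lie group -/

/-- The exponential map of a real Lie group: `lieExp v` is the value at time `1` of the integral
curve, starting at the identity, of the left-invariant vector field with value `v` at the
identity. (Such a curve exists and is unique; the second branch is never taken.) -/
def lieExp {E : Type*} [NormedAddCommGroup E] [NormedSpace ℝ E]
    {G : Type*} [TopologicalSpace G] [ChartedSpace E G] [Group G]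
    (v : GroupLieAlgebra 𝓘(ℝ, E) G) : G :=
  open Classical in
  if h : ∃ γ : ℝ → G, γ 0 = 1 ∧
      IsMIntegralCurve (I := 𝓘(ℝ, E)) γ (mulInvariantVectorField (I := 𝓘(ℝ, E)) v)
  then h.choose 1 else 1

/-! ### Nilpotentisation of a Lie algebra with a generating subspace -/

section Nilpotentisation

variable {L : Type*} [LieRing L] [LieAlgebra ℝ L]

/-- The filtration `V⁰ = 0`, `V¹ = D`, `Vⁱ⁺¹ = Vⁱ + [D, Vⁱ]`. -/
def bracketFiltration (D : Submodule ℝ L) : ℕ → Submodule ℝ L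
  | 0 => ⊥
  | 1 => D
  | (i + 2) => bracketFiltration D (i + 1) ⊔
      Submodule.span ℝ {z | ∃ x ∈ D, ∃ y ∈ bracketFiltration D (i + 1), ⁅x, y⁆ = z}

/-- The projection `x ↦ xⱼ` onto the `j`-th summand of a direct sum decomposition `L = ⨁ Wⱼ`. -/
def gradedProj (W : ℕ → Submodule ℝ L) [DirectSum.Decomposition W] (j : ℕ) : L →ₗ[ℝ] L :=
  (W j).subtype ∘ₗ DirectSum.component ℝ ℕ (fun i => W i) j ∘ₗ
    (DirectSum.decomposeLinearEquiv W).toLinearMap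

/-- The adjoint operator `y ↦ [x, y]ₙ` of the nilpotent bracket
`[x, y]ₙ = ∑_{j, k ≤ m} [xⱼ, yₖ]_{j+k}`, where `L = W₁ ⊕ ⋯ ⊕ Wₘ`. -/
def nilAd (W : ℕ → Submodule ℝ L) [DirectSum.Decomposition W] (m : ℕ) (x : L) :
    Module.End ℝ L :=
  ∑ j ∈ Finset.range (m + 1), ∑ k ∈ Finset.range (m + 1),
    gradedProj W (j + k) ∘ₗ (LieAlgebra.ad ℝ L (gradedProj W j x)) ∘ₗ gradedProj W k

/-- The Baker-Campbell-Hausdorff product of the nilpotent bracket `[·, ·]ₙ`, of step at most `m`,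
in its integral form
`x · y = x + ∫₀¹ ψ(A(t)) y dt`, where `A(t) = exp(ad x) exp(t ad y)` and
`ψ(z) = z log z / (z - 1) = z ∑ₖ (-1)ᵏ / (k + 1) (z - 1)ᵏ`.
Here `ad` is nilpotent, so that all the series are finite; `A` and `Q = ψ(A)` are polynomials in
the variable `t` with coefficients in `End L`, and the last line integrates `Q(t) y`
over `[0, 1]` term by term. -/
def nilBCH (W : ℕ → Submodule ℝ L) [DirectSum.Decomposition W] (m : ℕ) (x y : L) : L :=
  let A : Polynomial (Module.End ℝ L) :=
    Polynomial.C (∑ j ∈ Finset.range (m + 1), (j.factorial : ℝ)⁻¹ • nilAd W m x ^ j) *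
      ∑ j ∈ Finset.range (m + 1),
        Polynomial.monomial j ((j.factorial : ℝ)⁻¹ • nilAd W m y ^ j)
  let Q : Polynomial (Module.End ℝ L) :=
    A * ∑ k ∈ Finset.range (m + 1), ((-1) ^ k / ((k : ℝ) + 1)) • (A - 1) ^ k
  x + Q.sum fun n a => ((n : ℝ) + 1)⁻¹ • a y

/-- The nilpotentisation `N`: the simply connected group with Lie algebra `(L, [·, ·]ₙ)`,
identified with `L` by its exponential map. Thus `Nilpotentisation.exp` is the exponential map
`exp_N`, `Nilpotentisation.log` its inverse, and the product is given by the
Baker-Campbell-Hausdorff formula. -/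
structure Nilpotentisation (W : ℕ → Submodule ℝ L) [DirectSum.Decomposition W] (m : ℕ) where
  /-- The exponential map of `N`. -/
  exp ::
  /-- The inverse of the exponential map of `N`. -/
  log : L

instance (W : ℕ → Submodule ℝ L) [DirectSum.Decomposition W] (m : ℕ) :
    Mul (Nilpotentisation W m) where
  mul x y := Nilpotentisation.exp (nilBCH W m x.log y.log)

instance (W : ℕ → Submodule ℝ L) [DirectSum.Decomposition W] (m : ℕ) :
    One (Nilpotentisation W m) where
  one := Nilpotentisation.exp 0

end Nilpotentisation

/-! ### Words, costs and boxes

In this section `H` is a group with Lie algebra (in exponential notation) `L` and exponential map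
`e : L → H`, and `Y 0, …, Y (M - 1)` is a finite sequence of vectors. -/

section Boxes

variable {L : Type*} [AddCommGroup L] [Module ℝ L] {H : Type*} [Mul H] [One H]

/-- The ordered product `e (t₁ Y₁) e (t₂ Y₂) ⋯ e (t_M Y_M)`. -/
def wordProd (e : L → H) {M : ℕ} (Y : Fin M → L) (t : Fin M → ℝ) : H :=
  (List.ofFn fun i => e (t i • Y i)).prod

/-- The minimal `ℓ¹` cost `Δ¹(x) = inf {∑ |tᵢ| : x = ∏ e (tᵢ Yᵢ)}`, equal to `∞` if `x` is not such
a product. -/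
def delta1 (e : L → H) {M : ℕ} (Y : Fin M → L) (x : H) : ℝ≥0∞ :=
  ⨅ (t : Fin M → ℝ) (_ : x = wordProd e Y t), ENNReal.ofReal (∑ i, |t i|)

/-- The box `Box¹(ε) = {x : Δ¹(x) < ε}`. -/
def box1 (e : L → H) {M : ℕ} (Y : Fin M → L) (ε : ℝ) : Set H :=
  {x | delta1 e Y x < ENNReal.ofReal ε}

end Boxes

end

/-! Conjugating the bracket of G by the dilations δ_ε gives a family of brackets on 𝔤 that is
polynomial in ε and extends to ε = 0, where it is the nilpotent bracket (`scaled`, `nil`). For small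
ε ≠ 0 and small t, the word in G with exponents ε t is therefore the exponential of δ_ε F(ε, t),
where F(ε, t) is the iterated Baker-Campbell-Hausdorff product of the t_i X_{g(i)} for the bracket
of parameter ε (`wordMap`, `eventually_wordProd_eq`). F(0, ·) is the word map of N, and F is C¹ near
(0, 0).

The theorem thus reduces to openness of F(ε, ·) over the origin, uniformly in ε (`exists_word`). At
t = 0 the derivative only reaches D, so another base point s₀ is needed: a word followed by its
inverse, hence trivial in N, along which the vectors exp(t₁ ad X₁) ⋯ exp(tᵢ₋₁ ad Xᵢ₋₁) Xᵢ span 𝔤.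
Such a word exists because D generates (`exists_orbitSpan_eq_top`), and by homogeneity it may be
taken small (`exists_closed_word`). At s₀ the map F(0, ·) is a submersion, so (ε, t) ↦ (ε, F(ε, t))
covers a neighbourhood of (0, 0) using words of bounded cost; by continuity, words of small cost
have small values. The comparison of boxes follows by scaling: a word of cost < ε in one group is
enlarged to fixed size, its value is rewritten as a word of bounded cost in the other group, and
shrinking back gives cost O(ε) (`exists_comparison`).

The analytic input is the Baker-Campbell-Hausdorff formula in integral form. The Maurer-Cartan
equation gives the differential of the exponential map (`hasFDerivAt_of_maurerCartan`), and
inverting it gives the equation of the curve t ↦ x · ty in exponential coordinates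
(`exists_bch_curve`). This applies to G (`exists_expModel_mul`) and to a faithful linear
representation of the nilpotent bracket (`exists_exp_mul_exp_eq`), in which products of words are
computed. -/

namespace BallBox

open Set Filter Topology NormedSpace
open scoped NNReal

set_option linter.unusedSectionVars false

noncomputable section


/-! ### Exponential and logarithmic series in a Banach algebra. -/

section BanachAlgebra

variable {A : Type*} [NormedRing A] [NormedAlgebra ℝ A] [CompleteSpace A]

/-- The series of `log (1 + a) / a`. -/
def logSeries (a : A) : A := ∑' k : ℕ, ((-1) ^ k / ((k : ℝ) + 1)) • a ^ k

/-- The function `ψ(a) = a log a / (a - 1)`. -/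
def bchPsi (a : A) : A := a * logSeries (a - 1)

/-- The function `(1 - exp (-u)) / u`, the left-trivialised differential of the exponential map. -/
def dexpFactor (u : A) : A := ∫ s in (0 : ℝ)..1, exp (-(s • u))

theorem hasDerivAt_exp_smul (u : A) (s : ℝ) :
    HasDerivAt (fun s : ℝ => exp (s • u)) (exp (s • u) * u) s :=
  hasDerivAt_exp_smul_const u s

theorem continuous_exp_smul (u : A) : Continuous fun s : ℝ => exp (s • u) :=
  continuous_iff_continuousAt.2 fun s => (hasDerivAt_exp_smul u s).continuousAt

theorem continuous_exp : Continuous (exp : A → A) :=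
  let _ : NormedAlgebra ℚ A := NormedAlgebra.restrictScalars ℚ ℝ A
  exp_continuous

theorem exp_add_eq_mul {u v : A} (h : Commute u v) : exp (u + v) = exp u * exp v :=
  let _ : NormedAlgebra ℚ A := NormedAlgebra.restrictScalars ℚ ℝ A
  exp_add_of_commute h

theorem exp_mul_exp_neg (u : A) : exp u * exp (-u) = 1 := by
  rw [← exp_add_eq_mul (Commute.neg_right (Commute.refl u)), add_neg_cancel, exp_zero]

theorem integral_mul_const {f : ℝ → A} (hf : Continuous f) (a b : ℝ) (c : A) :
    ∫ s in a..b, f s * c = (∫ s in a..b, f s) * c :=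
  ((ContinuousLinearMap.mul ℝ A).flip c).intervalIntegral_comp_comm (hf.intervalIntegrable _ _)

theorem integral_const_mul {f : ℝ → A} (hf : Continuous f) (a b : ℝ) (c : A) :
    ∫ s in a..b, c * f s = c * ∫ s in a..b, f s :=
  (ContinuousLinearMap.mul ℝ A c).intervalIntegral_comp_comm (hf.intervalIntegrable _ _)

theorem exp_neg_mul_exp (u : A) : exp (-u) * exp u = 1 := by
  have := exp_mul_exp_neg (-u)
  rwa [neg_neg] at this

/-- `∫₀ˢ exp (τ u) dτ`. -/
def expPrimitive (u : A) (s : ℝ) : A := ∫ τ in (0 : ℝ)..s, exp (τ • u)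

theorem hasDerivAt_expPrimitive (u : A) (s : ℝ) :
    HasDerivAt (expPrimitive u) (exp (s • u)) s :=
  intervalIntegral.integral_hasDerivAt_right ((continuous_exp_smul u).intervalIntegrable _ _)
    (continuous_exp_smul u).stronglyMeasurable.stronglyMeasurableAtFilter
    (continuous_exp_smul u).continuousAt

theorem expPrimitive_zero (u : A) : expPrimitive u 0 = 0 := by simp [expPrimitive]

theorem expPrimitive_mul (u : A) (s : ℝ) : expPrimitive u s * u = exp (s • u) - 1 := by
  have h1 : ∫ τ in (0 : ℝ)..s, exp (τ • u) * u = exp (s • u) - exp ((0 : ℝ) • u) :=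
    intervalIntegral.integral_eq_sub_of_hasDerivAt (fun x _ => hasDerivAt_exp_smul u x)
      (((continuous_exp_smul u).mul continuous_const).intervalIntegrable _ _)
  rw [zero_smul, exp_zero] at h1
  rw [← h1, expPrimitive, integral_mul_const (continuous_exp_smul u)]

theorem mul_expPrimitive (u : A) (s : ℝ) : u * expPrimitive u s = exp (s • u) - 1 := by
  rw [← expPrimitive_mul, expPrimitive, ← integral_mul_const (continuous_exp_smul u),
    ← integral_const_mul (continuous_exp_smul u)]
  refine intervalIntegral.integral_congr fun τ _ => ?_
  exact ((Commute.refl u).smul_right τ).exp_right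

theorem commute_expPrimitive (u : A) (s : ℝ) : Commute u (expPrimitive u s) := by
  rw [commute_iff_eq, mul_expPrimitive, expPrimitive_mul]

theorem commute_exp_expPrimitive (u : A) (s : ℝ) : Commute (exp (s • u)) (expPrimitive u s) :=
  ((commute_expPrimitive u s).smul_left s).exp_left

theorem hasDerivAt_pow_of_commute {f : ℝ → A} {f' : A} {s : ℝ} (hf : HasDerivAt f f' s)
    (hc : Commute (f s) f') (k : ℕ) :
    HasDerivAt (fun x => f x ^ (k + 1)) (((k : ℝ) + 1) • (f s ^ k * f')) s := by
  induction k with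
  | zero => simpa using hf
  | succ k ih =>
    have := ih.mul hf
    refine (this.congr_deriv ?_).congr_of_eventuallyEq ?_
    · rw [smul_mul_assoc, mul_assoc, ← hc.eq, ← mul_assoc, ← pow_succ]
      push_cast
      rw [add_smul (_ + 1 : ℝ), one_smul]
    · exact Eventually.of_forall fun x => pow_succ _ _

theorem norm_pow_mul_le {a b : A} {C : ℝ} (h : ‖a‖ ≤ 1 / 2) (hb : ‖b‖ ≤ C) (k : ℕ) :
    ‖a ^ k * b‖ ≤ C * (1 / 2) ^ k := by
  have hC : 0 ≤ C := (norm_nonneg _).trans hb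
  induction k with
  | zero => simpa using hb
  | succ k ih =>
    rw [pow_succ', mul_assoc]
    calc ‖a * (a ^ k * b)‖ ≤ ‖a‖ * ‖a ^ k * b‖ := norm_mul_le _ _
      _ ≤ 1 / 2 * (C * (1 / 2) ^ k) := by gcongr
      _ = _ := by ring

theorem abs_logSeries_coeff (k : ℕ) : |((-1) ^ k / ((k : ℝ) + 1))| ≤ 1 := by
  rw [abs_div, abs_pow, abs_neg, abs_one, one_pow]
  have : (1 : ℝ) ≤ |(k : ℝ) + 1| := by
    rw [abs_of_pos (by positivity)]
    linarith [k.cast_nonneg (α := ℝ)]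
  exact div_le_one_of_le₀ this (by positivity)

theorem summable_logSeries {a : A} (h : ‖a‖ ≤ 1 / 2) :
    Summable fun k : ℕ => ((-1) ^ k / ((k : ℝ) + 1)) • a ^ k := by
  refine Summable.of_norm_bounded (g := fun k => ‖(1 : A)‖ * (1 / 2) ^ k)
    ((summable_geometric_of_lt_one (by norm_num) (by norm_num)).mul_left _) fun k => ?_
  rw [norm_smul, Real.norm_eq_abs]
  calc _ ≤ 1 * ‖a ^ k‖ := by gcongr; exact abs_logSeries_coeff k
    _ ≤ _ := by rw [one_mul]; simpa using norm_pow_mul_le h (le_refl ‖(1 : A)‖) k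

/-- The `k`-th term of the expansion of `log (exp (s u)) / u`. -/
def logExpTerm (u : A) (k : ℕ) (s : ℝ) : A :=
  ((-1) ^ k / ((k : ℝ) + 1)) • (u ^ k * expPrimitive u s ^ (k + 1))

/-- Here `expPrimitive u s` stands for (exp(su) - 1)/u, so that no division by u occurs. The
coefficient 1/(k+1) cancels the exponent, which leaves the terms of a geometric series. -/
theorem hasDerivAt_logExpTerm (u : A) (k : ℕ) (s : ℝ) :
    HasDerivAt (logExpTerm u k) ((1 - exp (s • u)) ^ k * exp (s • u)) s := by
  have h1 := ((hasDerivAt_pow_of_commute (hasDerivAt_expPrimitive u s)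
    (commute_exp_expPrimitive u s).symm k).const_mul (u ^ k)).const_smul
    ((-1) ^ k / ((k : ℝ) + 1))
  refine h1.congr_deriv ?_
  have h2 : (1 - exp (s • u)) ^ k = (-1 : ℝ) ^ k • (u ^ k * expPrimitive u s ^ k) := by
    rw [← (commute_expPrimitive u s).mul_pow, mul_expPrimitive, ← smul_pow]
    congr 1
    simp
  rw [h2, mul_smul_comm, smul_smul, smul_mul_assoc, mul_assoc]
  congr 1
  have : (k : ℝ) + 1 ≠ 0 := by positivity
  field_simp

theorem logExpTerm_zero (u : A) (k : ℕ) : logExpTerm u k 0 = 0 := by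
  simp [logExpTerm, expPrimitive_zero]

/-- With a = exp(su), the differentiated series is ∑ (1 - a)ᵏ a = 1; the bound ‖a - 1‖ ≤ 1/2 permits
termwise differentiation. -/
theorem hasDerivAt_tsum_logExpTerm {u : A}
    (hu : ∀ s ∈ Ioo (-1 : ℝ) 2, ‖exp (s • u) - 1‖ ≤ 1 / 2) {s : ℝ} (hs : s ∈ Ioo (-1 : ℝ) 2) :
    HasDerivAt (fun s => ∑' k, logExpTerm u k s) 1 s := by
  have hC : ∀ s ∈ Ioo (-1 : ℝ) 2, ‖exp (s • u)‖ ≤ ‖(1 : A)‖ + 1 / 2 := fun s hs => by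
    calc ‖exp (s • u)‖ = ‖1 + (exp (s • u) - 1)‖ := by congr 1; abel
      _ ≤ _ := (norm_add_le _ _).trans (by gcongr; exact hu s hs)
  have h3 : ∀ s ∈ Ioo (-1 : ℝ) 2, ‖1 - exp (s • u)‖ ≤ 1 / 2 := fun s hs => by
    rw [norm_sub_rev]; exact hu s hs
  have hsum : Summable fun k : ℕ => (‖(1 : A)‖ + 1 / 2) * (1 / 2 : ℝ) ^ k :=
    (summable_geometric_of_lt_one (by norm_num) (by norm_num)).mul_left _
  have h5 := hasDerivAt_tsum_of_isPreconnected hsum isOpen_Ioo isPreconnected_Ioo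
    (fun k s _ => hasDerivAt_logExpTerm u k s)
    (fun k s hs => norm_pow_mul_le (h3 s hs) (hC s hs) k) (y₀ := 0) (by norm_num)
    (by simp [logExpTerm_zero]) hs
  refine h5.congr_deriv ?_
  have h4 : ‖1 - exp (s • u)‖ < 1 := (h3 s hs).trans_lt (by norm_num)
  have h6 := geom_series_mul_neg (1 - exp (s • u)) h4
  rw [sub_sub_cancel] at h6
  rw [(summable_geometric_of_norm_lt_one h4).tsum_mul_right, h6]

/-- This is log(exp u) = u with the factor u removed, which remains meaningful for non-invertible u:
the sum of the `logExpTerm` vanishes at 0 and has derivative 1. -/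
theorem logSeries_mul_expPrimitive {u : A} (hu : ∀ s ∈ Ioo (-1 : ℝ) 2, ‖exp (s • u) - 1‖ ≤ 1 / 2) :
    logSeries (exp u - 1) * expPrimitive u 1 = 1 := by
  have h7 : ∫ _ in (0 : ℝ)..1, (1 : A) =
      (∑' k, logExpTerm u k 1) - ∑' k, logExpTerm u k 0 :=
    intervalIntegral.integral_eq_sub_of_hasDerivAt
      (fun x hx => hasDerivAt_tsum_logExpTerm hu (by
        rw [uIcc_of_le zero_le_one] at hx; constructor <;> linarith [hx.1, hx.2]))
      (by simp)
  simp only [logExpTerm_zero, tsum_zero, sub_zero, intervalIntegral.integral_const,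
    one_smul] at h7
  have h1 := hu 1 (by norm_num)
  rw [one_smul] at h1
  refine Eq.trans ?_ h7.symm
  rw [logSeries, ← (summable_logSeries h1).tsum_mul_right]
  refine tsum_congr fun k => ?_
  have := mul_expPrimitive u 1
  rw [one_smul] at this
  rw [← this, (commute_expPrimitive u 1).mul_pow, smul_mul_assoc, mul_assoc, ← pow_succ,
    logExpTerm]

theorem expPrimitive_one (u : A) : expPrimitive u 1 = exp u * dexpFactor u := by
  rw [expPrimitive, dexpFactor,
    ← integral_const_mul (f := fun s : ℝ => exp (-(s • u))) (continuous_exp.comp (by fun_prop))]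
  have := intervalIntegral.integral_comp_sub_left (a := 0) (b := 1)
    (fun τ : ℝ => exp (τ • u)) 1
  simp only [sub_zero, sub_self] at this
  rw [← this]
  refine intervalIntegral.integral_congr fun τ _ => ?_
  have hc : Commute u (-(τ • u)) := ((Commute.refl u).smul_right τ).neg_right
  change exp ((1 - τ) • u) = exp u * exp (-(τ • u))
  rw [← exp_add_eq_mul hc, sub_smul, one_smul, sub_eq_add_neg]

theorem commute_exp_logSeries (a : A) (h : ‖a - 1‖ ≤ 1 / 2) : Commute a (logSeries (a - 1)) := by
  rw [commute_iff_eq, logSeries, ← (summable_logSeries h).tsum_mul_left,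
    ← (summable_logSeries h).tsum_mul_right]
  refine tsum_congr fun k => ?_
  have : Commute a ((a - 1) ^ k) := ((Commute.refl a).sub_right (Commute.one_right a)).pow_right k
  rw [mul_smul_comm, smul_mul_assoc, this.eq]

/-- ψ enters the Baker-Campbell-Hausdorff formula because ψ(exp(ad w)) inverts the trivialised
differential of the exponential map at w. -/
theorem bchPsi_exp_mul_dexpFactor {u : A}
    (hu : ∀ s ∈ Ioo (-1 : ℝ) 2, ‖exp (s • u) - 1‖ ≤ 1 / 2) :
    bchPsi (exp u) * dexpFactor u = 1 := by
  have h1 := hu 1 (by norm_num)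
  rw [one_smul] at h1
  rw [bchPsi, (commute_exp_logSeries _ h1).eq, mul_assoc, ← expPrimitive_one,
    logSeries_mul_expPrimitive hu]

theorem dexpFactor_eq_exp_neg_mul (u : A) : dexpFactor u = exp (-u) * expPrimitive u 1 := by
  rw [expPrimitive_one, ← mul_assoc, exp_neg_mul_exp, one_mul]

/-- `exp (s u)` is close to `1` uniformly for `s` in `(-1, 2)`, if `u` is small. -/
theorem exists_norm_exp_smul_sub_one_le (A : Type*) [NormedRing A] [NormedAlgebra ℝ A]
    [CompleteSpace A] :
    ∃ r > 0, ∀ u : A, ‖u‖ < r → ∀ s ∈ Ioo (-1 : ℝ) 2, ‖exp (s • u) - 1‖ ≤ 1 / 2 := by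
  have h := (continuous_exp (A := A)).continuousAt (x := 0)
  rw [Metric.continuousAt_iff] at h
  obtain ⟨δ, hδ, h⟩ := h (1 / 2) (by norm_num)
  refine ⟨δ / 2, by positivity, fun u hu s hs => ?_⟩
  have h2 : ‖s • u‖ < δ := by
    rw [norm_smul, Real.norm_eq_abs]
    have : |s| ≤ 2 := abs_le.2 ⟨by linarith [hs.1], hs.2.le⟩
    calc |s| * ‖u‖ ≤ 2 * ‖u‖ := by gcongr
      _ < δ := by linarith
  have := h (x := s • u) (by simpa using h2)
  rw [exp_zero, dist_eq_norm] at this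
  exact this.le

end BanachAlgebra


/-! ### Joint differentiability of the Baker-Campbell-Hausdorff product in the bracket and the two
factors. -/

section Smoothness

variable {A : Type*} [NormedRing A] [NormedAlgebra ℝ A] [CompleteSpace A]

theorem contDiff_exp : ContDiff ℝ 1 (exp : A → A) :=
  contDiff_iff_contDiffAt.2 fun x => by
    let _ : NormedAlgebra ℚ A := NormedAlgebra.restrictScalars ℚ ℝ A
    exact (exp_analytic (𝕂 := ℝ) x).contDiffAt

/-- The coefficients are bounded by 1, so the radius of convergence is at least 1. -/
theorem contDiffAt_logSeries : ContDiffAt ℝ 1 (logSeries : A → A) 0 := by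
  have hpos : 0 < (FormalMultilinearSeries.ofScalars A
      (fun k : ℕ => ((-1) ^ k / ((k : ℝ) + 1)))).radius := by
    refine lt_of_lt_of_le ?_ (FormalMultilinearSeries.le_radius_of_bound (r := 1) _
      (max 1 ‖(1 : A)‖) fun n => ?_)
    · simp
    · rw [FormalMultilinearSeries.ofScalars_norm_eq_mul]
      simp only [NNReal.coe_one, one_pow, mul_one]
      calc _ ≤ 1 * ‖ContinuousMultilinearMap.mkPiAlgebraFin ℝ n A‖ := by
            gcongr; exact abs_logSeries_coeff n
        _ ≤ _ := by rw [one_mul]; exact ContinuousMultilinearMap.norm_mkPiAlgebraFin_le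
  have h := (FormalMultilinearSeries.hasFPowerSeriesOnBall _ hpos).analyticAt.contDiffAt (n := 1)
  refine h.congr_of_eventuallyEq (Eventually.of_forall fun a => ?_)
  exact (FormalMultilinearSeries.ofScalars_sum_eq _ a).symm

theorem contDiffAt_bchPsi : ContDiffAt ℝ 1 (bchPsi : A → A) 1 := by
  have h : ContDiffAt ℝ 1 (fun a : A => logSeries (a - 1)) 1 := by
    have h0 : ContDiffAt ℝ 1 (logSeries : A → A) ((1 : A) - 1) := by
      rw [sub_self]; exact contDiffAt_logSeries
    exact h0.comp (f := fun a : A => a - 1) (1 : A) (contDiffAt_id.sub contDiffAt_const)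
  exact contDiffAt_id.mul h

/-- Constant paths. -/
def constPath : A →L[ℝ] C(unitInterval, A) :=
  LinearMap.mkContinuous
    { toFun := fun a => ContinuousMap.const _ a
      map_add' := fun _ _ => rfl
      map_smul' := fun _ _ => rfl } 1 fun a => by
    rw [one_mul, ContinuousMap.norm_le _ (norm_nonneg _)]
    exact fun _ => le_rfl

/-- The paths `t ↦ t a`. -/
def linearPath : A →L[ℝ] C(unitInterval, A) :=
  LinearMap.mkContinuous
    { toFun := fun a => ⟨fun t => (t : ℝ) • a, by fun_prop⟩
      map_add' := fun _ _ => by ext t; simp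
      map_smul' := fun c a => ContinuousMap.ext fun t => smul_comm (t : ℝ) c a } 1 fun a => by
    rw [one_mul, ContinuousMap.norm_le _ (norm_nonneg _)]
    intro t
    simp only [LinearMap.coe_mk, AddHom.coe_mk, ContinuousMap.coe_mk, norm_smul, Real.norm_eq_abs]
    exact mul_le_of_le_one_left (norm_nonneg _) (abs_le.2 ⟨by linarith [t.2.1], t.2.2⟩)

/-- Integration of paths over the unit interval. -/
def pathIntegral : C(unitInterval, A) →L[ℝ] A :=
  LinearMap.mkContinuous
    { toFun := fun f => ∫ t in (0 : ℝ)..1, IccExtend zero_le_one f t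
      map_add' := fun f g => by
        rw [← intervalIntegral.integral_add (f.continuous.Icc_extend'.intervalIntegrable _ _)
          (g.continuous.Icc_extend'.intervalIntegrable _ _)]
        rfl
      map_smul' := fun c f => by
        rw [RingHom.id_apply, ← intervalIntegral.integral_smul]
        rfl } 1 fun f => by
    have := intervalIntegral.norm_integral_le_of_norm_le_const (a := 0) (b := 1) (C := ‖f‖)
      (f := IccExtend zero_le_one f) fun t _ => f.norm_coe_le_norm _
    simpa using this

theorem pathIntegral_apply (f : C(unitInterval, A)) :
    pathIntegral f = ∫ t in (0 : ℝ)..1, IccExtend zero_le_one f t := rfl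

/-- Evaluation at t is a continuous ring homomorphism, and these commute with the exponential. -/
theorem exp_path_apply (f : C(unitInterval, A)) (t : unitInterval) : exp f t = exp (f t) := by
  let _ : NormedAlgebra ℚ A := NormedAlgebra.restrictScalars ℚ ℝ A
  let _ : NormedAlgebra ℚ C(unitInterval, A) := NormedAlgebra.restrictScalars ℚ ℝ _
  have h : Continuous (ContinuousMap.evalCLM ℝ t : C(unitInterval, A) → A) :=
    (ContinuousMap.evalCLM ℝ t : C(unitInterval, A) →L[ℝ] A).continuous
  exact map_exp ((Pi.evalRingHom (fun _ : unitInterval => A) t).comp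
    ContinuousMap.coeFnRingHom) h f

theorem logSeries_path_apply {f : C(unitInterval, A)} (hf : ‖f‖ ≤ 1 / 2) (t : unitInterval) :
    logSeries f t = logSeries (f t) := by
  have := (ContinuousMap.evalCLM ℝ t : C(unitInterval, A) →L[ℝ] A).map_tsum (summable_logSeries hf)
  simpa [logSeries] using this

theorem bchPsi_path_apply {f : C(unitInterval, A)} (hf : ‖f - 1‖ ≤ 1 / 2) (t : unitInterval) :
    bchPsi f t = bchPsi (f t) := by
  rw [bchPsi, bchPsi, ContinuousMap.mul_apply, logSeries_path_apply hf]
  rfl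

variable {E : Type*} [NormedAddCommGroup E] [NormedSpace ℝ E] [CompleteSpace E]

/-- The Baker-Campbell-Hausdorff product of a continuous bracket `B`, in integral form. -/
def bch (B : E →L[ℝ] E →L[ℝ] E) (x y : E) : E :=
  x + ∫ t in (0 : ℝ)..1, bchPsi (exp (B x) * exp (t • B y)) y

/-- The path `t ↦ exp (ad x) exp (t ad y)`. -/
def adPath (B : E →L[ℝ] E →L[ℝ] E) (x y : E) : C(unitInterval, E →L[ℝ] E) :=
  exp (constPath (B x)) * exp (linearPath (B y))

theorem adPath_apply (B : E →L[ℝ] E →L[ℝ] E) (x y : E) (t : unitInterval) :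
    adPath B x y t = exp (B x) * exp ((t : ℝ) • B y) := by
  rw [adPath, ContinuousMap.mul_apply, exp_path_apply, exp_path_apply]
  rfl

/-- The integrand is regarded as one element of the Banach algebra of paths in End E.
Differentiability in the parameters then follows from that of exp and ψ in this algebra, with no
differentiation under the integral sign. -/
theorem bch_eq_pathIntegral {B : E →L[ℝ] E →L[ℝ] E} {x y : E} (h : ‖adPath B x y - 1‖ ≤ 1 / 2) :
    bch B x y = x + pathIntegral (bchPsi (adPath B x y)) y := by
  rw [bch, pathIntegral_apply, ContinuousLinearMap.intervalIntegral_apply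
    ((bchPsi (adPath B x y)).continuous.Icc_extend'.intervalIntegrable _ _)]
  congr 1
  refine intervalIntegral.integral_congr fun t ht => ?_
  rw [uIcc_of_le zero_le_one] at ht
  simp only [IccExtend_of_mem zero_le_one _ ht, bchPsi_path_apply h, adPath_apply]

theorem contDiff_adPath : ContDiff ℝ 1
    fun p : (E →L[ℝ] E →L[ℝ] E) × E × E => adPath p.1 p.2.1 p.2.2 := by
  have h1 : ContDiff ℝ 1 fun p : (E →L[ℝ] E →L[ℝ] E) × E × E => p.1 p.2.1 :=
    contDiff_fst.clm_apply (contDiff_fst.comp contDiff_snd)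
  have h2 : ContDiff ℝ 1 fun p : (E →L[ℝ] E →L[ℝ] E) × E × E => p.1 p.2.2 :=
    contDiff_fst.clm_apply (contDiff_snd.comp contDiff_snd)
  exact (contDiff_exp.comp (constPath.contDiff.comp h1)).mul
    (contDiff_exp.comp (linearPath.contDiff.comp h2))

theorem adPath_zero (B : E →L[ℝ] E →L[ℝ] E) : adPath B 0 0 = 1 := by
  simp [adPath]

theorem eventually_norm_sub_one_le {T : Type*} [TopologicalSpace T] {f : T → A} {x : T}
    (hf : ContinuousAt f x) (hx : f x = 1) : ∀ᶠ p in 𝓝 x, ‖f p - 1‖ ≤ 1 / 2 := by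
  have h := (hf.sub (continuousAt_const (y := (1 : A)))).norm
  exact (h.eventually_lt (continuousAt_const (y := (1 / 2 : ℝ))) (by simp [hx])).mono fun _ => le_of_lt

theorem eventually_norm_adPath_sub_one_le (B : E →L[ℝ] E →L[ℝ] E) :
    ∀ᶠ p : (E →L[ℝ] E →L[ℝ] E) × E × E in 𝓝 (B, 0, 0),
      ‖adPath p.1 p.2.1 p.2.2 - 1‖ ≤ 1 / 2 := by
  exact eventually_norm_sub_one_le (f := fun p : (E →L[ℝ] E →L[ℝ] E) × E × E =>
    adPath p.1 p.2.1 p.2.2) (x := (B, 0, 0)) contDiff_adPath.continuous.continuousAt (adPath_zero B)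

theorem contDiffAt_bch (B : E →L[ℝ] E →L[ℝ] E) :
    ContDiffAt ℝ 1 (fun p : (E →L[ℝ] E →L[ℝ] E) × E × E => bch p.1 p.2.1 p.2.2) (B, 0, 0) := by
  have h1 : ContDiffAt ℝ 1 (fun p : (E →L[ℝ] E →L[ℝ] E) × E × E =>
      bchPsi (adPath p.1 p.2.1 p.2.2)) (B, 0, 0) := by
    refine ContDiffAt.comp (g := bchPsi) (f := fun p : (E →L[ℝ] E →L[ℝ] E) × E × E =>
      adPath p.1 p.2.1 p.2.2) (B, 0, 0) ?_ contDiff_adPath.contDiffAt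
    simp only [adPath_zero]
    exact contDiffAt_bchPsi
  have h3 : ContDiffAt ℝ 1 (fun p : (E →L[ℝ] E →L[ℝ] E) × E × E =>
      pathIntegral (bchPsi (adPath p.1 p.2.1 p.2.2))) (B, 0, 0) :=
    (pathIntegral (A := E →L[ℝ] E)).contDiff.contDiffAt.comp _ h1
  have h2 : ContDiffAt ℝ 1 (fun p : (E →L[ℝ] E →L[ℝ] E) × E × E =>
      p.2.1 + pathIntegral (bchPsi (adPath p.1 p.2.1 p.2.2)) p.2.2) (B, 0, 0) :=
    (contDiff_fst.comp contDiff_snd).contDiffAt.add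
      (h3.clm_apply (contDiff_snd.comp contDiff_snd).contDiffAt)
  exact h2.congr_of_eventuallyEq
    ((eventually_norm_adPath_sub_one_le B).mono fun p hp => bch_eq_pathIntegral hp)

theorem bch_zero_zero (B : E →L[ℝ] E →L[ℝ] E) : bch B 0 0 = 0 := by simp [bch]

end Smoothness


/-! ### The differential of an exponential map from the Maurer-Cartan equation. -/

section DifferentialOfExp

variable {E : Type*} [NormedAddCommGroup E] [NormedSpace ℝ E] [CompleteSpace E]
  {F : Type*} [NormedAddCommGroup F] [NormedSpace ℝ F]

theorem gronwallBound_zero_mul (K ε x : ℝ) :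
    gronwallBound 0 K ε x = gronwallBound 0 K 1 x * ε := by
  unfold gronwallBound
  split_ifs <;> ring

theorem norm_sub_sub_le_of_lipschitz {X Y : Type*} [NormedAddCommGroup X] [NormedSpace ℝ X]
    [NormedAddCommGroup Y] [NormedSpace ℝ Y] {f : X → Y} {f' : X → X →L[ℝ] Y} {U : Set X}
    (hU : Convex ℝ U) (hf : ∀ x ∈ U, HasFDerivAt f (f' x) x) {K : ℝ≥0}
    (hK : LipschitzOnWith K f' U) {x h : X} (hx : x ∈ U) (hxh : x + h ∈ U) :
    ‖f (x + h) - f x - f' x h‖ ≤ K * ‖h‖ * ‖h‖ := by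
  have hseg : segment ℝ x (x + h) ⊆ U := hU.segment_subset hx hxh
  have := (convex_segment x (x + h)).norm_image_sub_le_of_norm_hasFDerivWithin_le'
    (f := f) (f' := f') (φ := f' x) (C := K * ‖h‖)
    (fun y hy => (hf y (hseg hy)).hasFDerivWithinAt) (fun y hy => ?_)
    (left_mem_segment ℝ x (x + h)) (right_mem_segment ℝ x (x + h))
  · simpa using this
  · refine (hK.norm_sub_le (hseg hy) hx).trans ?_
    gcongr
    have h2 := norm_sub_le_of_mem_segment hy
    simpa using h2

/-- The differential of the time one map `e` of the vector fields `g ↦ L(g) v`: here `L` satisfies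
the Maurer-Cartan equation for the bracket `B`. -/
theorem hasFDerivAt_of_maurerCartan {B : E →L[ℝ] E →L[ℝ] E} {L : F → E →L[ℝ] F}
    {L' : F → F →L[ℝ] E →L[ℝ] F} {U : Set F} (hU : IsOpen U) (hUc : Convex ℝ U)
    (hL : ∀ g ∈ U, HasFDerivAt L (L' g) g) {K : ℝ≥0} (hLip : LipschitzOnWith K L' U)
    (hbd : ∀ g ∈ U, ‖L' g‖ ≤ K)
    (hMC : ∀ g ∈ U, ∀ v w, L' g (L g v) w - L' g (L g w) v = L g (B v w))
    {e : E → F} {V : Set E} (hV : IsOpen V)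
    (hode : ∀ v ∈ V, ∀ s ∈ Icc (0 : ℝ) 1,
      HasDerivAt (fun s : ℝ => e (s • v)) (L (e (s • v)) v) s)
    (hmem : ∀ v ∈ V, ∀ s ∈ Icc (0 : ℝ) 1, e (s • v) ∈ U) {v : E} (hv : v ∈ V) :
    HasFDerivAt e (L (e v) ∘L dexpFactor (B v)) v := by
  set g : ℝ → F := fun s => e (s • v) with hg
  set q : ℝ → E →L[ℝ] E := expPrimitive (-(B v)) with hq
  have hq1 : dexpFactor (B v) = q 1 := by
    simp only [hq, expPrimitive, dexpFactor, smul_neg]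
  have hgd : ∀ s ∈ Icc (0 : ℝ) 1, HasDerivAt g (L (g s) v) s := hode v hv
  have hgU : ∀ s ∈ Icc (0 : ℝ) 1, g s ∈ U := hmem v hv
  have hgc : ContinuousOn g (Icc 0 1) := fun s hs => (hgd s hs).continuousAt.continuousWithinAt
  have hLc : ContinuousOn L U := fun x hx => (hL x hx).continuousAt.continuousWithinAt
  have hLgc : ContinuousOn (fun s => L (g s)) (Icc 0 1) := hLc.comp hgc hgU
  have hqc : Continuous q := continuous_iff_continuousAt.2 fun s =>
    (hasDerivAt_expPrimitive (-(B v)) s).continuousAt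
  have hqd : ∀ s (w : E), HasDerivAt (fun s => q s w) (w - B v (q s w)) s := by
    intro s w
    have h1 := (hasDerivAt_expPrimitive (-(B v)) s).clm_apply (hasDerivAt_const s w)
    refine h1.congr_deriv ?_
    have h2 := congrArg (fun T : E →L[ℝ] E => T w) (mul_expPrimitive (-(B v)) s)
    simp only [mul_apply_eq_comp, neg_apply,
      sub_apply, one_apply_eq_self] at h2
    simp only [map_zero, add_zero, hq]
    rw [sub_eq_add_neg, h2]
    abel
  obtain ⟨C1, hC1⟩ := isCompact_Icc.exists_bound_of_continuousOn hLgc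
  obtain ⟨C2, hC2⟩ := (isCompact_Icc (a := (0 : ℝ)) (b := 1)).exists_bound_of_continuousOn
    hqc.continuousOn
  -- By compactness the trajectory has a δ-neighbourhood inside U, so it may be perturbed by any J
  -- with norm below δ.
  obtain ⟨δ, hδ, hδU⟩ := (isCompact_Icc.image_of_continuousOn hgc).exists_thickening_subset_open hU
    (by rintro _ ⟨s, hs, rfl⟩; exact hgU s hs)
  have hC1' : 0 ≤ C1 := (norm_nonneg _).trans (hC1 0 (by simp))
  have hC2' : 0 ≤ C2 := (norm_nonneg _).trans (hC2 0 (by simp))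
  set C := C1 * C2 with hC
  have hJ : ∀ s ∈ Icc (0 : ℝ) 1, ∀ w, ‖L (g s) (q s w)‖ ≤ C * ‖w‖ := by
    intro s hs w
    calc ‖L (g s) (q s w)‖ ≤ ‖L (g s)‖ * (‖q s‖ * ‖w‖) :=
          (ContinuousLinearMap.le_opNorm _ _).trans (by gcongr; exact ContinuousLinearMap.le_opNorm _ _)
      _ ≤ C1 * (C2 * ‖w‖) := by gcongr; exacts [hC1 s hs, hC2 s hs]
      _ = _ := by rw [hC]; ring
  set M : ℝ := K * C * C * (‖v‖ + 1) + K * C with hM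
  set K' : ℝ≥0 := K * (‖v‖₊ + 1) with hK'
  have key : ∀ᶠ w : E in 𝓝 0,
      ‖e (v + w) - e v - (L (e v) ∘L dexpFactor (B v)) w‖ ≤
        gronwallBound 0 K' 1 1 * M * ‖w‖ ^ 2 := by
    have e1 : ∀ᶠ w : E in 𝓝 0, v + w ∈ V := by
      have : Tendsto (fun w : E => v + w) (𝓝 0) (𝓝 v) := by
        simpa using (continuous_const.add continuous_id).tendsto (0 : E) (f := fun w : E => v + w)
      exact this (hV.mem_nhds hv)
    have e2 : ∀ᶠ w : E in 𝓝 0, C * ‖w‖ < δ := by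
      have : Tendsto (fun w : E => C * ‖w‖) (𝓝 0) (𝓝 0) := by
        simpa using (continuous_const.mul continuous_norm).tendsto (0 : E)
          (f := fun w : E => C * ‖w‖)
      exact this.eventually (gt_mem_nhds hδ)
    have e3 : ∀ᶠ w : E in 𝓝 0, ‖w‖ < 1 := by
      exact (continuous_norm.tendsto (0 : E)).eventually (gt_mem_nhds (by simp))
    filter_upwards [e1, e2, e3] with w hw1 hw2 hw3
    have hvw : ‖v + w‖ ≤ ‖v‖ + 1 := (norm_add_le _ _).trans (by gcongr)
    -- J is the expected first variation of the trajectory when v is replaced by v + w. Since (q w)'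
    -- = w - [v, q w], the Maurer-Cartan equation makes J a solution of the linearised equation J' =
    -- L(g) w + L'(g)(J) v.
    set J : ℝ → F := fun s => L (g s) (q s w) with hJdef
    have hJU : ∀ s ∈ Icc (0 : ℝ) 1, g s + J s ∈ U := by
      intro s hs
      refine hδU (Metric.mem_thickening_iff.2 ⟨g s, ⟨s, hs, rfl⟩, ?_⟩)
      simpa using (hJ s hs w).trans_lt hw2
    have hJd : ∀ s ∈ Icc (0 : ℝ) 1, HasDerivAt (fun s => g s + J s)
        (L (g s) v + (L (g s) w + L' (g s) (J s) v)) s := by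
      intro s hs
      have h1 : HasDerivAt (fun s => L (g s)) (L' (g s) (L (g s) v)) s :=
        (hL (g s) (hgU s hs)).comp_hasDerivAt s (hgd s hs)
      have h2 := (hgd s hs).add (h1.clm_apply (hqd s w))
      refine h2.congr_deriv ?_
      have h3 := hMC (g s) (hgU s hs) v (q s w)
      rw [map_sub, ← h3]
      simp only [hJdef]
      abel
    have hfd : ∀ s ∈ Icc (0 : ℝ) 1, HasDerivAt (fun s : ℝ => e (s • (v + w)))
        (L (e (s • (v + w))) (v + w)) s := hode _ hw1
    have hLipX : LipschitzOnWith K' (fun h => L h (v + w)) U := by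
      refine LipschitzOnWith.of_dist_le_mul fun x hx y hy => ?_
      have h4 : ‖L x - L y‖ ≤ K * ‖x - y‖ :=
        hUc.norm_image_sub_le_of_norm_hasFDerivWithin_le
          (fun z hz => (hL z hz).hasFDerivWithinAt) hbd hy hx
      rw [dist_eq_norm, dist_eq_norm, ← sub_apply]
      calc ‖(L x - L y) (v + w)‖ ≤ ‖L x - L y‖ * ‖v + w‖ := ContinuousLinearMap.le_opNorm _ _
        _ ≤ K * ‖x - y‖ * (‖v‖ + 1) := by gcongr
        _ = K' * ‖x - y‖ := by rw [hK']; push_cast; ring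
    have herr : ∀ s ∈ Icc (0 : ℝ) 1,
        dist (L (g s) v + (L (g s) w + L' (g s) (J s) v)) (L (g s + J s) (v + w)) ≤
          M * ‖w‖ ^ 2 := by
      intro s hs
      have h5 := norm_sub_sub_le_of_lipschitz hUc hL hLip (hgU s hs) (hJU s hs)
      have h6 : L (g s + J s) (v + w) - (L (g s) v + (L (g s) w + L' (g s) (J s) v)) =
          (L (g s + J s) - L (g s) - L' (g s) (J s)) (v + w) + L' (g s) (J s) w := by
        simp only [sub_apply, map_add]
        abel
      rw [dist_comm, dist_eq_norm, h6]
      have hJs := hJ s hs w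
      calc _ ≤ ‖L (g s + J s) - L (g s) - L' (g s) (J s)‖ * ‖v + w‖ + ‖L' (g s)‖ * ‖J s‖ * ‖w‖ :=
            (norm_add_le _ _).trans (add_le_add (ContinuousLinearMap.le_opNorm _ _)
              (ContinuousLinearMap.le_opNorm₂ _ _ _))
        _ ≤ K * (C * ‖w‖) * (C * ‖w‖) * (‖v‖ + 1) + K * (C * ‖w‖) * ‖w‖ := by
            gcongr
            · exact h5.trans (by gcongr)
            · exact hbd _ (hgU s hs)
        _ = M * ‖w‖ ^ 2 := by rw [hM]; ring
    -- g + J satisfies the equation for v + w up to an error M‖w‖² and has the same initial value,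
    -- so Grönwall bounds its distance to the true trajectory at time 1 by O(‖w‖²).
    have hG := dist_le_of_approx_trajectories_ODE_of_mem (a := 0) (b := 1)
      (v := fun _ h => L h (v + w)) (s := fun _ => U) (K := K') (εf := 0) (εg := M * ‖w‖ ^ 2)
      (δ := 0) (f := fun s : ℝ => e (s • (v + w))) (g := fun s => g s + J s)
      (fun _ _ => hLipX)
      (fun s hs => (hfd s hs).continuousAt.continuousWithinAt)
      (fun s hs => (hfd s (Ico_subset_Icc_self hs)).hasDerivWithinAt)
      (fun s hs => (dist_self _).le) (fun s hs => hmem _ hw1 s (Ico_subset_Icc_self hs))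
      (fun s hs => (hJd s hs).continuousAt.continuousWithinAt)
      (fun s hs => (hJd s (Ico_subset_Icc_self hs)).hasDerivWithinAt)
      (fun s hs => herr s (Ico_subset_Icc_self hs))
      (fun s hs => hJU s (Ico_subset_Icc_self hs))
      (by simp [hg, hJdef, hq, expPrimitive_zero]) 1 (by simp)
    rw [zero_add, gronwallBound_zero_mul, sub_zero, dist_eq_norm] at hG
    simp only [hg, hJdef, one_smul] at hG
    rw [sub_sub, hq1]
    exact hG.trans_eq (by ring)
  rw [hasFDerivAt_iff_isLittleO_nhds_zero]
  have hO : (fun w => e (v + w) - e v - (L (e v) ∘L dexpFactor (B v)) w) =O[𝓝 0]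
      fun w => ‖w‖ ^ 2 :=
    Asymptotics.IsBigO.of_bound _ (key.mono fun w hw => by rwa [norm_pow, norm_norm])
  exact hO.trans_isLittleO (Asymptotics.isLittleO_norm_pow_id one_lt_two)

end DifferentialOfExp


/-! ### Solutions of autonomous equations on a fixed time interval. -/

section Flow

variable {E : Type*} [NormedAddCommGroup E] [NormedSpace ℝ E] [CompleteSpace E]
  {P : Type*} [NormedAddCommGroup P] [NormedSpace ℝ P]

/-- The Picard-Lindelöf theorem, with a bound for the solution. -/
theorem exists_picard_mem_closedBall {f : ℝ → E → E} {tmin tmax : ℝ} {t₀ : Icc tmin tmax}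
    {x₀ x : E} {a r L K : ℝ≥0} (hf : IsPicardLindelof f t₀ x₀ a r L K)
    (hx : x ∈ Metric.closedBall x₀ r) :
    ∃ α : ℝ → E, α t₀ = x ∧ Continuous α ∧ (∀ t, α t ∈ Metric.closedBall x₀ a) ∧
      ∀ t ∈ Icc tmin tmax, HasDerivWithinAt α (f t (α t)) (Icc tmin tmax) t := by
  obtain ⟨α, hα⟩ := ODE.FunSpace.exists_isFixedPt_next hf hx
  refine ⟨α.compProj, by rw [ODE.FunSpace.compProj_val, ← hα, ODE.FunSpace.next_apply₀],
    α.continuous_compProj, fun _ => α.compProj_mem_closedBall hf.mul_max_le, fun t ht => ?_⟩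
  apply ODE.hasDerivWithinAt_picard_Icc t₀.2 hf.continuousOn_uncurry
    α.continuous_compProj.continuousOn (fun _ ht' => α.compProj_mem_closedBall hf.mul_max_le)
    x ht |>.congr_of_mem _ ht
  intro t' ht'
  nth_rw 1 [← hα]
  rw [ODE.FunSpace.compProj_of_mem ht', ODE.FunSpace.next_apply]

/-- Solutions of a small autonomous equation exist on `(-2, 2)` and stay in a given ball. -/
theorem exists_solution_mem_ball {T : E → P →L[ℝ] E} {x₀ : E} (hT : ContDiffAt ℝ 1 T x₀) {R : ℝ}
    (hR : 0 < R) :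
    ∃ r > 0, ∀ x ∈ Metric.ball x₀ r, ∀ p : P, ‖p‖ < r → ∃ α : ℝ → E, α 0 = x ∧
      ContinuousOn (fun t => T (α t) p) (Ioo (-2) 2) ∧
      ∀ t ∈ Ioo (-2 : ℝ) 2, α t ∈ Metric.ball x₀ R ∧ HasDerivAt α (T (α t) p) t := by
  obtain ⟨K, s, hs, hK⟩ := hT.exists_lipschitzOnWith
  have hb : ∀ᶠ x in 𝓝 x₀, ‖T x‖ < ‖T x₀‖ + 1 :=
    hT.continuousAt.norm.eventually_lt continuousAt_const (by simp)
  obtain ⟨ρ, hρ, hsub⟩ := Metric.nhds_basis_closedBall.mem_iff.1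
    (inter_mem (inter_mem hs hb) (Metric.ball_mem_nhds x₀ hR))
  set C := ‖T x₀‖ + 1 with hC
  have hCpos : 0 < C := by positivity
  -- The first bound keeps the initial point within ρ/2 of the centre; the second limits the speed
  -- to ρ/4, so that within time 2 the solution moves by at most ρ/2.
  set r := min (ρ / 2) (ρ / (4 * C)) with hr
  have hrpos : 0 < r := by positivity
  refine ⟨r, hrpos, fun x hx p hp => ?_⟩
  have hLip : LipschitzOnWith (K * ‖p‖₊) (fun y => T y p) (Metric.closedBall x₀ ρ) := by
    refine LipschitzOnWith.of_dist_le_mul fun y hy z hz => ?_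
    rw [dist_eq_norm, dist_eq_norm, ← sub_apply]
    calc ‖(T y - T z) p‖ ≤ ‖T y - T z‖ * ‖p‖ := ContinuousLinearMap.le_opNorm _ _
      _ ≤ K * ‖y - z‖ * ‖p‖ := by
          gcongr; exact hK.norm_sub_le (hsub hy).1.1 (hsub hz).1.1
      _ = _ := by push_cast; ring
  have hbound : ∀ y ∈ Metric.closedBall x₀ ρ, ‖T y p‖ ≤ C * r := fun y hy =>
    (ContinuousLinearMap.le_opNorm _ _).trans (by gcongr; exact (hsub hy).1.2.le)
  have h4 : C * r * 2 ≤ ρ - ρ / 2 := by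
    have : r ≤ ρ / (4 * C) := min_le_right _ _
    rw [le_div_iff₀ (by positivity)] at this
    linarith
  have hPL : IsPicardLindelof (fun _ y => T y p)
      (⟨0, by norm_num⟩ : Icc (-2 : ℝ) 2) x₀ ⟨ρ, hρ.le⟩ ⟨ρ / 2, by positivity⟩
      ⟨C * r, by positivity⟩ (K * ‖p‖₊) :=
    IsPicardLindelof.of_time_independent (f := fun y => T y p) hbound hLip (by
      change C * r * max (2 - 0) (0 - (-2)) ≤ ρ - ρ / 2
      norm_num
      linarith)
  have hx' : x ∈ Metric.closedBall x₀ ((⟨ρ / 2, by positivity⟩ : ℝ≥0) : ℝ) :=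
    Metric.ball_subset_closedBall.trans (Metric.closedBall_subset_closedBall (min_le_left _ _)) hx
  obtain ⟨α, hα0, hαc, hmem, hαd⟩ := exists_picard_mem_closedBall hPL hx'
  refine ⟨α, hα0, hLip.continuousOn.comp hαc.continuousOn fun t _ => hmem t,
    fun t ht => ⟨(hsub (hmem t)).2, ?_⟩⟩
  exact (hαd t (Ioo_subset_Icc_self ht)).hasDerivAt (Icc_mem_nhds ht.1 ht.2)

end Flow

/-! ### The Baker-Campbell-Hausdorff formula in Banach algebras. -/

section Representation

variable {E : Type*} [NormedAddCommGroup E] [NormedSpace ℝ E] [CompleteSpace E]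
  {A : Type*} [NormedRing A] [NormedAlgebra ℝ A] [CompleteSpace A]

/-- `ρ` maps the bracket `B` to the commutator. -/
def IsRep (B : E →L[ℝ] E →L[ℝ] E) (ρ : E →L[ℝ] A) : Prop :=
  ∀ x y, ρ (B x y) = ρ x * ρ y - ρ y * ρ x

/-- For the fields L(g) w = g ρ(w), the Maurer-Cartan equation is exactly the representation
identity. -/
theorem hasFDerivAt_exp_rep {B : E →L[ℝ] E →L[ℝ] E} {ρ : E →L[ℝ] A} (hρ : IsRep B ρ) (v : E) :
    HasFDerivAt (fun v => exp (ρ v))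
      (((ContinuousLinearMap.mul ℝ A) (exp (ρ v)) ∘L ρ) ∘L dexpFactor (B v)) v := by
  set L : A →L[ℝ] E →L[ℝ] A :=
    ((ContinuousLinearMap.compL ℝ E A A).flip ρ) ∘L ContinuousLinearMap.mul ℝ A with hL
  have hLa : ∀ g w, L g w = g * ρ w := fun g w => rfl
  have key := hasFDerivAt_of_maurerCartan (B := B) (L := L) (L' := fun _ => L) (U := univ)
    (K := ‖L‖₊) isOpen_univ convex_univ (fun g _ => L.hasFDerivAt)
    ((LipschitzWith.const L).weaken (zero_le)).lipschitzOnWith (fun _ _ => le_rfl)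
    (fun g _ v w => by simp only [hLa, hρ v w]; noncomm_ring)
    (e := fun v => exp (ρ v)) (V := univ) isOpen_univ
    (fun v _ s _ => by
      have := hasDerivAt_exp_smul (ρ v) s
      simpa only [map_smul, hLa] using this)
    (fun _ _ _ _ => mem_univ _) (mem_univ v)
  exact key

theorem eq_mul_exp_of_hasDerivAt {f : ℝ → A} {c : A}
    (hf : ∀ t ∈ Icc (0 : ℝ) 1, HasDerivAt f (f t * c) t) :
    ∀ t ∈ Icc (0 : ℝ) 1, f t = f 0 * exp (t • c) := by
  have hd : ∀ t ∈ Icc (0 : ℝ) 1, HasDerivAt (fun t => f t * exp (t • (-c))) 0 t := fun t ht => by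
    refine ((hf t ht).mul (hasDerivAt_exp_smul (-c) t)).congr_deriv ?_
    have : Commute (-c) (exp (t • (-c))) := ((Commute.refl (-c)).smul_right t).exp_right
    rw [← this.eq]
    noncomm_ring
  intro t ht
  have h := constant_of_has_deriv_right_zero
    (fun t ht => (hd t ht).continuousAt.continuousWithinAt)
    (fun t ht => (hd t (Ico_subset_Icc_self ht)).hasDerivWithinAt) t ht
  rw [zero_smul, exp_zero, mul_one, smul_neg] at h
  rw [← h, mul_assoc, exp_neg_mul_exp, mul_one]

theorem commute_logSeries_of_commute {a b : A} (h : ‖a‖ ≤ 1 / 2) (hc : Commute b a) :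
    Commute b (logSeries a) := by
  rw [commute_iff_eq, logSeries, ← (summable_logSeries h).tsum_mul_left,
    ← (summable_logSeries h).tsum_mul_right]
  refine tsum_congr fun k => ?_
  rw [mul_smul_comm, smul_mul_assoc, (hc.pow_right k).eq]

theorem dexpFactor_mul_bchPsi_exp {u : A}
    (hu : ∀ s ∈ Ioo (-1 : ℝ) 2, ‖exp (s • u) - 1‖ ≤ 1 / 2) :
    dexpFactor u * bchPsi (exp u) = 1 := by
  have h1 := hu 1 (by norm_num)
  rw [one_smul] at h1
  have hq : Commute (expPrimitive u 1) (exp u) := by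
    have := commute_exp_expPrimitive u 1
    rw [one_smul] at this
    exact this.symm
  have hd : Commute (dexpFactor u) (exp u) := by
    rw [dexpFactor_eq_exp_neg_mul]
    exact Commute.mul_left (((Commute.refl u).neg_left).exp) hq
  have h2 : Commute (dexpFactor u) (bchPsi (exp u)) :=
    hd.mul_right (commute_logSeries_of_commute h1 (hd.sub_right (Commute.one_right _)))
  rw [h2.eq, bchPsi_exp_mul_dexpFactor hu]

/-- The curve `w(t) = x · t y` in exponential coordinates. -/
theorem exists_bch_curve {B : E →L[ℝ] E →L[ℝ] E} (hB : IsRep B B) {R : ℝ} (hR : 0 < R) :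
    ∃ r > 0, ∀ x y, ‖x‖ < r → ‖y‖ < r → ∃ w : ℝ → E, w 0 = x ∧ w 1 = bch B x y ∧
      ∀ t ∈ Ioo (-2 : ℝ) 2, ‖w t‖ < R ∧
        ∃ w', HasDerivAt w w' t ∧ dexpFactor (B (w t)) w' = y := by
  obtain ⟨r₀, hr₀, hexp⟩ := exists_norm_exp_smul_sub_one_le (E →L[ℝ] E)
  set R' := min R (r₀ / (‖B‖ + 1)) with hR'
  have hR'pos : 0 < R' := by positivity
  have hBw : ∀ w, ‖w‖ < R' → ‖B w‖ < r₀ := fun w hw => by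
    have h1 : ‖w‖ < r₀ / (‖B‖ + 1) := hw.trans_le (min_le_right _ _)
    rw [lt_div_iff₀ (by positivity)] at h1
    calc ‖B w‖ ≤ ‖B‖ * ‖w‖ := B.le_opNorm w
      _ ≤ ‖w‖ * (‖B‖ + 1) := by nlinarith [norm_nonneg w, norm_nonneg B]
      _ < r₀ := h1
  have hT : ContDiffAt ℝ 1 (fun w => bchPsi (exp (B w))) (0 : E) := by
    have h2 : ContDiffAt ℝ 1 (bchPsi : (E →L[ℝ] E) → _) (exp (B 0)) := by
      rw [map_zero, exp_zero]; exact contDiffAt_bchPsi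
    exact h2.comp (f := fun w => exp (B w)) (0 : E)
      (contDiff_exp.contDiffAt.comp _ B.contDiff.contDiffAt)
  -- The curve is obtained by solving w' = ψ(exp(ad w)) y, which amounts to prescribing the
  -- trivialised velocity y of exp(w(t)).
  obtain ⟨r, hr, hsol⟩ := exists_solution_mem_ball hT hR'pos
  refine ⟨r, hr, fun x y hx hy => ?_⟩
  obtain ⟨w, hw0, hcont, hw⟩ := hsol x (by simpa using hx) y hy
  have hwn : ∀ t ∈ Ioo (-2 : ℝ) 2, ‖w t‖ < R' := fun t ht => by simpa using (hw t ht).1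
  have hdexp : ∀ t ∈ Ioo (-2 : ℝ) 2,
      dexpFactor (B (w t)) (bchPsi (exp (B (w t))) y) = y := fun t ht => by
    have := dexpFactor_mul_bchPsi_exp (hexp _ (hBw _ (hwn t ht)))
    exact congrArg (fun S : E →L[ℝ] E => S y) this
  have hsub : Icc (0 : ℝ) 1 ⊆ Ioo (-2) 2 := fun t ht => ⟨by linarith [ht.1], by linarith [ht.2]⟩
  -- The adjoint representation gives exp(ad w(t)) = exp(ad x) exp(t ad y). The right-hand side of
  -- the equation for w becomes explicit, and integrating it gives the formula for w(1).
  have had := eq_mul_exp_of_hasDerivAt (f := fun t => exp (B (w t))) (c := B y) fun t ht => by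
    have h3 := (hasFDerivAt_exp_rep hB (w t)).comp_hasDerivAt t (hw t (hsub ht)).2
    refine h3.congr_deriv ?_
    change exp (B (w t)) * B (dexpFactor (B (w t)) (bchPsi (exp (B (w t))) y)) = _
    rw [hdexp t (hsub ht)]
  refine ⟨w, hw0, ?_, fun t ht => ⟨(hwn t ht).trans_le (min_le_left _ _), _, (hw t ht).2,
    hdexp t ht⟩⟩
  have hint : ∫ t in (0 : ℝ)..1, bchPsi (exp (B (w t))) y = w 1 - w 0 := by
    rw [← uIcc_of_le zero_le_one] at hsub
    exact intervalIntegral.integral_eq_sub_of_hasDerivAt (fun t ht => (hw t (hsub ht)).2)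
      (hcont.mono hsub).intervalIntegrable
  rw [bch, ← sub_eq_iff_eq_add', ← hw0, ← hint]
  refine intervalIntegral.integral_congr fun t ht => ?_
  rw [uIcc_of_le zero_le_one] at ht
  have h5 := had t ht
  change bchPsi (exp (B (w t))) y = bchPsi (exp (B (w 0)) * exp (t • B y)) y
  rw [← h5]

/-- The Baker-Campbell-Hausdorff formula in a Banach algebra. -/
theorem exists_exp_mul_exp_eq {B : E →L[ℝ] E →L[ℝ] E} (hB : IsRep B B) {ρ : E →L[ℝ] A}
    (hρ : IsRep B ρ) :
    ∃ r > 0, ∀ x y, ‖x‖ < r → ‖y‖ < r → exp (ρ x) * exp (ρ y) = exp (ρ (bch B x y)) := by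
  obtain ⟨r, hr, h⟩ := exists_bch_curve hB one_pos
  refine ⟨r, hr, fun x y hx hy => ?_⟩
  obtain ⟨w, hw0, hw1, hw⟩ := h x y hx hy
  have had := eq_mul_exp_of_hasDerivAt (f := fun t => exp (ρ (w t))) (c := ρ y) fun t ht => by
    obtain ⟨-, w', hw', hy'⟩ := hw t ⟨by linarith [ht.1], by linarith [ht.2]⟩
    have h3 := (hasFDerivAt_exp_rep hρ (w t)).comp_hasDerivAt t hw'
    refine h3.congr_deriv ?_
    change exp (ρ (w t)) * ρ (dexpFactor (B (w t)) w') = _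
    rw [hy']
  have := had 1 (by simp)
  simp only [hw0, hw1, one_smul] at this
  exact this.symm

/-- `exp (ρ x)` acts on `ρ v` by conjugation as `exp (ad x)`. -/
theorem exp_rep_mul {B : E →L[ℝ] E →L[ℝ] E} {ρ : E →L[ℝ] A} (hρ : IsRep B ρ) (x v : E) :
    exp (ρ x) * ρ v = ρ (exp (B x) v) * exp (ρ x) := by
  have hd : ∀ s : ℝ, HasDerivAt
      (fun s : ℝ => exp (s • -(ρ x)) * (ρ (exp (s • B x) v) * exp (s • ρ x))) 0 s := fun s => by
    have h1 : HasDerivAt (fun s : ℝ => ρ (exp (s • B x) v)) (ρ (B x (exp (s • B x) v))) s := by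
      have h2 := (hasDerivAt_exp_smul (B x) s).clm_apply (hasDerivAt_const s v)
      refine (ρ.hasFDerivAt.comp_hasDerivAt s h2).congr_deriv ?_
      have hc : Commute (B x) (exp (s • B x)) := ((Commute.refl (B x)).smul_right s).exp_right
      rw [← hc.eq]
      simp
    refine ((hasDerivAt_exp_smul (-(ρ x)) s).mul
      (h1.mul (hasDerivAt_exp_smul (ρ x) s))).congr_deriv ?_
    have hc : Commute (ρ x) (exp (s • ρ x)) := ((Commute.refl (ρ x)).smul_right s).exp_right
    rw [hρ, ← hc.eq, Pi.mul_apply]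
    noncomm_ring
  have h := constant_of_has_deriv_right_zero (a := 0) (b := 1)
    (fun t ht => (hd t).continuousAt.continuousWithinAt)
    (fun t ht => (hd t).hasDerivWithinAt) 1 (by simp)
  simp only [zero_smul, exp_zero, one_smul, mul_one, one_mul, one_apply_eq_self] at h
  rw [← h, ← mul_assoc, exp_mul_exp_neg, one_mul]

end Representation


/-! ### Naturality under isomorphisms of brackets. -/

section Naturality

variable {E : Type*} [NormedAddCommGroup E] [NormedSpace ℝ E] [CompleteSpace E]

/-- An equivalence commutes with `tsum` whether or not the series converges, so no smallness is
needed. The same holds for the integral in `bch_map`, and naturality is global. -/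
theorem map_bchPsi {A A' : Type*} [NormedRing A] [NormedAlgebra ℝ A] [NormedRing A']
    [NormedAlgebra ℝ A'] (c : A ≃A[ℝ] A') (a : A) : c (bchPsi a) = bchPsi (c a) := by
  have h : ∀ b : A, c b = c.toContinuousLinearEquiv b := fun _ => rfl
  rw [bchPsi, bchPsi, map_mul, logSeries, logSeries, h (∑' k, _), ContinuousLinearEquiv.map_tsum]
  congr 1
  refine tsum_congr fun k => ?_
  rw [← h, map_smul, map_pow, map_sub, map_one]

/-- The Baker-Campbell-Hausdorff product is natural. -/
theorem bch_map {B B' : E →L[ℝ] E →L[ℝ] E} (Φ : E ≃L[ℝ] E)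
    (h : ∀ x y, Φ (B' x y) = B (Φ x) (Φ y)) (x y : E) :
    bch B (Φ x) (Φ y) = Φ (bch B' x y) := by
  have hconj : ∀ x, B (Φ x) = Φ.conjContinuousAlgEquiv (B' x) := fun x => by
    ext z
    rw [ContinuousLinearEquiv.conjContinuousAlgEquiv_apply_apply, h, Φ.apply_symm_apply]
  have hexp : ∀ u : E →L[ℝ] E, exp (Φ.conjContinuousAlgEquiv u) =
      Φ.conjContinuousAlgEquiv (exp u) := fun u => by
    let _ : NormedAlgebra ℚ (E →L[ℝ] E) := NormedAlgebra.restrictScalars ℚ ℝ _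
    exact (map_exp Φ.conjContinuousAlgEquiv Φ.conjContinuousAlgEquiv.continuous u).symm
  rw [bch, bch, map_add]
  congr 1
  rw [intervalIntegral.integral_of_le zero_le_one, intervalIntegral.integral_of_le zero_le_one,
    ← ContinuousLinearEquiv.integral_comp_comm]
  refine MeasureTheory.integral_congr_ae (Eventually.of_forall fun t => ?_)
  simp only [hconj]
  rw [← map_smul, hexp, hexp, ← map_mul, ← map_bchPsi,
    ContinuousLinearEquiv.conjContinuousAlgEquiv_apply_apply, Φ.symm_apply_apply]

end Naturality

/-! ### Graded brackets, dilations and the nilpotent limit. -/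

/-- A Lie bracket `B` on `E = W₁ ⊕ ⋯ ⊕ Wₘ`, compatible with the filtration by the sums
`W₁ ⊕ ⋯ ⊕ Wᵢ`; here `proj j` is the projection onto `Wⱼ`. -/
structure GradedBracket (E : Type*) [NormedAddCommGroup E] [NormedSpace ℝ E] where
  /-- The number of summands. -/
  step : ℕ
  /-- The projections onto the summands. -/
  proj : ℕ → E →L[ℝ] E
  /-- The bracket. -/
  bracket : E →L[ℝ] E →L[ℝ] E
  proj_proj_same : ∀ i x, proj i (proj i x) = proj i x
  proj_proj_of_ne : ∀ i j x, i ≠ j → proj i (proj j x) = 0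
  sum_proj : ∀ x, ∑ j ∈ Finset.range (step + 1), proj j x = x
  proj_zero : ∀ x, proj 0 x = 0
  bracket_skew : ∀ x y, bracket x y = -bracket y x
  isRep_bracket : IsRep bracket bracket
  proj_bracket : ∀ i j k x y, j + k < i → proj i (bracket (proj j x) (proj k y)) = 0

namespace GradedBracket

variable {E : Type*} [NormedAddCommGroup E] [NormedSpace ℝ E] (𝔤 : GradedBracket E)

theorem proj_eq_zero {j : ℕ} (hj : 𝔤.step < j) (x : E) : 𝔤.proj j x = 0 := by
  rw [← 𝔤.sum_proj x, map_sum]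
  refine Finset.sum_eq_zero fun i hi => 𝔤.proj_proj_of_ne _ _ _ ?_
  rw [Finset.mem_range] at hi
  omega

theorem ext_proj {x y : E} (h : ∀ i ≤ 𝔤.step, 𝔤.proj i x = 𝔤.proj i y) : x = y := by
  rw [← 𝔤.sum_proj x, ← 𝔤.sum_proj y]
  exact Finset.sum_congr rfl fun i hi => h i (by rw [Finset.mem_range] at hi; omega)

/-- The operator acting on the `j`-th summand as multiplication by `c j`. -/
def weighted (c : ℕ → ℝ) : E →L[ℝ] E := ∑ j ∈ Finset.range (𝔤.step + 1), c j • 𝔤.proj j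

theorem weighted_apply (c : ℕ → ℝ) (x : E) :
    𝔤.weighted c x = ∑ j ∈ Finset.range (𝔤.step + 1), c j • 𝔤.proj j x := by
  simp [weighted]

theorem proj_weighted (c : ℕ → ℝ) (i : ℕ) (x : E) :
    𝔤.proj i (𝔤.weighted c x) = c i • 𝔤.proj i x := by
  rw [weighted_apply, map_sum]
  by_cases hi : i ∈ Finset.range (𝔤.step + 1)
  · rw [Finset.sum_eq_single_of_mem i hi]
    · rw [map_smul, 𝔤.proj_proj_same]
    · intro j _ hj
      rw [map_smul, 𝔤.proj_proj_of_ne _ _ _ hj.symm, smul_zero]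
  · have hi' : 𝔤.step < i := by rw [Finset.mem_range] at hi; omega
    rw [𝔤.proj_eq_zero hi', smul_zero]
    exact Finset.sum_eq_zero fun j _ => 𝔤.proj_eq_zero hi' _

theorem weighted_proj (c : ℕ → ℝ) (i : ℕ) (x : E) :
    𝔤.weighted c (𝔤.proj i x) = c i • 𝔤.proj i x := by
  refine 𝔤.ext_proj fun j _ => ?_
  rw [proj_weighted, map_smul]
  by_cases h : j = i
  · rw [h]
  · rw [𝔤.proj_proj_of_ne _ _ _ h, smul_zero, smul_zero]

/-- The dilations `δ_ε`. -/
def dilation (ε : ℝ) : E →L[ℝ] E := 𝔤.weighted fun j => ε ^ j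

theorem dilation_dilation (a b : ℝ) (x : E) :
    𝔤.dilation a (𝔤.dilation b x) = 𝔤.dilation (a * b) x :=
  𝔤.ext_proj fun i _ => by simp only [dilation, proj_weighted, smul_smul, mul_pow]

theorem dilation_one (x : E) : 𝔤.dilation 1 x = x :=
  𝔤.ext_proj fun i _ => by simp only [dilation, proj_weighted, one_pow, one_smul]

/-- The dilations as linear automorphisms. -/
def dilationEquiv {ε : ℝ} (hε : ε ≠ 0) : E ≃L[ℝ] E :=
  ContinuousLinearEquiv.equivOfInverse (𝔤.dilation ε) (𝔤.dilation ε⁻¹)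
    (fun x => by rw [dilation_dilation, inv_mul_cancel₀ hε, dilation_one])
    (fun x => by rw [dilation_dilation, mul_inv_cancel₀ hε, dilation_one])

theorem dilationEquiv_apply {ε : ℝ} (hε : ε ≠ 0) (x : E) :
    𝔤.dilationEquiv hε x = 𝔤.dilation ε x := rfl

theorem contDiff_dilation : ContDiff ℝ 1 𝔤.dilation := by
  unfold dilation weighted
  exact ContDiff.sum fun j _ => (contDiff_id.pow j).smul contDiff_const

/-- The component of degree `(i, j, k)` of the bracket. -/
def component (i j k : ℕ) : E →L[ℝ] E →L[ℝ] E :=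
  ContinuousLinearMap.compL ℝ E E E (𝔤.proj i) ∘L 𝔤.bracket.bilinearComp (𝔤.proj j) (𝔤.proj k)

theorem component_apply (i j k : ℕ) (x y : E) :
    𝔤.component i j k x y = 𝔤.proj i (𝔤.bracket (𝔤.proj j x) (𝔤.proj k y)) := rfl

/-- The rescaled bracket `δ_ε⁻¹ [δ_ε x, δ_ε y]`, extended to `ε = 0`. -/
def scaled (ε : ℝ) : E →L[ℝ] E →L[ℝ] E :=
  ∑ j ∈ Finset.range (𝔤.step + 1), ∑ k ∈ Finset.range (𝔤.step + 1),
    ∑ i ∈ Finset.range (𝔤.step + 1), ε ^ (j + k - i) • 𝔤.component i j k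

theorem scaled_apply (ε : ℝ) (x y : E) :
    𝔤.scaled ε x y = ∑ j ∈ Finset.range (𝔤.step + 1), ∑ k ∈ Finset.range (𝔤.step + 1),
      ∑ i ∈ Finset.range (𝔤.step + 1),
        ε ^ (j + k - i) • 𝔤.proj i (𝔤.bracket (𝔤.proj j x) (𝔤.proj k y)) := by
  simp only [scaled, sum_apply, smul_apply, component_apply]

theorem contDiff_scaled : ContDiff ℝ 1 𝔤.scaled := by
  unfold scaled
  refine ContDiff.sum fun j _ => ContDiff.sum fun k _ => ContDiff.sum fun i _ => ?_
  have h : ContDiff ℝ 1 ((ContinuousLinearMap.id ℝ ℝ).smulRight (𝔤.component i j k)) :=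
    ContinuousLinearMap.contDiff _
  have h2 : ContDiff ℝ 1 fun ε : ℝ => ε ^ (j + k - i) := contDiff_id.pow _
  exact h.comp h2

theorem bracket_eq_sum (x y : E) : 𝔤.bracket x y =
    ∑ j ∈ Finset.range (𝔤.step + 1), ∑ k ∈ Finset.range (𝔤.step + 1),
      𝔤.bracket (𝔤.proj j x) (𝔤.proj k y) := by
  conv_lhs => rw [← 𝔤.sum_proj x, ← 𝔤.sum_proj y]
  simp only [map_sum, sum_apply]
  exact Finset.sum_comm

/-- The exponent j + k - i in `scaled` is a truncated subtraction; this is harmless because the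
component of degree i > j + k vanishes by compatibility with the filtration. -/
theorem dilation_scaled (ε : ℝ) (x y : E) :
    𝔤.dilation ε (𝔤.scaled ε x y) = 𝔤.bracket (𝔤.dilation ε x) (𝔤.dilation ε y) := by
  rw [scaled_apply, bracket_eq_sum, map_sum]
  refine Finset.sum_congr rfl fun j _ => ?_
  rw [map_sum]
  refine Finset.sum_congr rfl fun k _ => ?_
  have h1 : 𝔤.bracket (𝔤.proj j (𝔤.dilation ε x)) (𝔤.proj k (𝔤.dilation ε y)) =
      ε ^ (j + k) • 𝔤.bracket (𝔤.proj j x) (𝔤.proj k y) := by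
    simp only [dilation, proj_weighted, map_smul, smul_apply, smul_smul, pow_add]
    rw [mul_comm]
  rw [h1, map_sum]
  conv_rhs => rw [← 𝔤.sum_proj (𝔤.bracket (𝔤.proj j x) (𝔤.proj k y)), Finset.smul_sum]
  refine Finset.sum_congr rfl fun i _ => ?_
  rw [map_smul, dilation, weighted_proj]
  by_cases h : j + k < i
  · rw [𝔤.proj_bracket _ _ _ _ _ h]; simp
  · rw [smul_smul, ← pow_add, Nat.sub_add_cancel (not_lt.1 h)]

/-- The nilpotent bracket. -/
def nil : E →L[ℝ] E →L[ℝ] E := 𝔤.scaled 0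

theorem nil_apply (x y : E) : 𝔤.nil x y =
    ∑ j ∈ Finset.range (𝔤.step + 1), ∑ k ∈ Finset.range (𝔤.step + 1),
      𝔤.proj (j + k) (𝔤.bracket (𝔤.proj j x) (𝔤.proj k y)) := by
  rw [nil, scaled_apply]
  refine Finset.sum_congr rfl fun j _ => Finset.sum_congr rfl fun k _ => ?_
  by_cases h : j + k ∈ Finset.range (𝔤.step + 1)
  · rw [Finset.sum_eq_single_of_mem _ h, Nat.sub_self, pow_zero, one_smul]
    intro i _ hi
    rcases lt_or_gt_of_ne hi with h1 | h1
    · rw [zero_pow (by omega), zero_smul]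
    · rw [𝔤.proj_bracket _ _ _ _ _ h1, smul_zero]
  · rw [Finset.mem_range] at h
    rw [𝔤.proj_eq_zero (j := j + k) (by omega)]
    refine Finset.sum_eq_zero fun i hi => ?_
    rw [Finset.mem_range] at hi
    rw [zero_pow (by omega), zero_smul]

theorem nil_skew (x y : E) : 𝔤.nil x y = -𝔤.nil y x := by
  rw [nil_apply, nil_apply, Finset.sum_comm, ← Finset.sum_neg_distrib]
  refine Finset.sum_congr rfl fun j _ => ?_
  rw [← Finset.sum_neg_distrib]
  refine Finset.sum_congr rfl fun k _ => ?_
  rw [𝔤.bracket_skew, map_neg, add_comm]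

theorem isRep_scaled {ε : ℝ} (hε : ε ≠ 0) : IsRep (𝔤.scaled ε) (𝔤.scaled ε) := by
  intro x y
  ext z
  apply (𝔤.dilationEquiv hε).injective
  have h := congrArg (fun T : E →L[ℝ] E => T (𝔤.dilation ε z))
    (𝔤.isRep_bracket (𝔤.dilation ε x) (𝔤.dilation ε y))
  simp only [sub_apply, mul_apply_eq_comp] at h
  simp only [dilationEquiv_apply, sub_apply, mul_apply_eq_comp, map_sub, dilation_scaled]
  exact h

/-- The Jacobi identity holds for the rescaled brackets with ε ≠ 0 and passes to ε = 0 by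
continuity. -/
theorem isRep_nil : IsRep 𝔤.nil 𝔤.nil := by
  intro x y
  have hc := 𝔤.contDiff_scaled.continuous
  have h : (fun ε => 𝔤.scaled ε (𝔤.scaled ε x y)) = fun ε =>
      𝔤.scaled ε x * 𝔤.scaled ε y - 𝔤.scaled ε y * 𝔤.scaled ε x := by
    refine Continuous.ext_on (dense_compl_singleton (0 : ℝ)) (by fun_prop) (by fun_prop) ?_
    intro ε hε
    exact 𝔤.isRep_scaled hε x y
  exact congrFun h 0

theorem dilation_nil (ε : ℝ) (x y : E) :
    𝔤.dilation ε (𝔤.nil x y) = 𝔤.nil (𝔤.dilation ε x) (𝔤.dilation ε y) := by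
  simp only [nil_apply, map_sum]
  refine Finset.sum_congr rfl fun j _ => Finset.sum_congr rfl fun k _ => ?_
  simp only [dilation, weighted_proj, proj_weighted, map_smul, smul_apply, smul_smul, pow_add]
  rw [mul_comm]

/-- The derivation acting as multiplication by `j` on the `j`-th summand. -/
def grading : E →L[ℝ] E := 𝔤.weighted fun j => j

theorem grading_nil (x y : E) :
    𝔤.grading (𝔤.nil x y) = 𝔤.nil (𝔤.grading x) y + 𝔤.nil x (𝔤.grading y) := by
  simp only [nil_apply, map_sum, ← Finset.sum_add_distrib]
  refine Finset.sum_congr rfl fun j _ => Finset.sum_congr rfl fun k _ => ?_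
  simp only [grading, weighted_proj, proj_weighted, map_smul, smul_apply, ← add_smul]
  push_cast
  rfl

theorem grading_injective : Function.Injective 𝔤.grading := by
  refine (injective_iff_map_eq_zero _).2 fun x hx => 𝔤.ext_proj fun i _ => ?_
  rw [map_zero]
  rcases Nat.eq_zero_or_pos i with rfl | hi
  · exact 𝔤.proj_zero x
  · have h := 𝔤.proj_weighted (fun j => (j : ℝ)) i x
    rw [show 𝔤.weighted (fun j => (j : ℝ)) x = 0 from hx, map_zero] at h
    exact (smul_eq_zero.1 h.symm).resolve_left (by positivity)

/-- This identity moves the scale from the arguments into the bracket, where the limit ε → 0 is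
regular. -/
theorem bch_dilation {ε : ℝ} (hε : ε ≠ 0) [CompleteSpace E] (x y : E) :
    bch 𝔤.bracket (𝔤.dilation ε x) (𝔤.dilation ε y) =
      𝔤.dilation ε (bch (𝔤.scaled ε) x y) :=
  bch_map (𝔤.dilationEquiv hε) (fun x y => 𝔤.dilation_scaled ε x y) x y

theorem bch_nil_dilation {ε : ℝ} (hε : ε ≠ 0) [CompleteSpace E] (x y : E) :
    bch 𝔤.nil (𝔤.dilation ε x) (𝔤.dilation ε y) = 𝔤.dilation ε (bch 𝔤.nil x y) :=
  bch_map (𝔤.dilationEquiv hε) (fun x y => 𝔤.dilation_nil ε x y) x y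

/-- The operator `(y, c) ↦ ([x, y]ₙ - c d(x), 0)` of `E × ℝ`: the restriction to `E` of the adjoint
representation of the extension of `(E, [·, ·]ₙ)` by the derivation `d`. -/
def extendedAd (x : E) : E × ℝ →L[ℝ] E × ℝ :=
  ContinuousLinearMap.inl ℝ E ℝ ∘L (𝔤.nil x ∘L ContinuousLinearMap.fst ℝ E ℝ -
    (ContinuousLinearMap.snd ℝ E ℝ).smulRight (𝔤.grading x))

theorem extendedAd_apply (x : E) (z : E × ℝ) :
    𝔤.extendedAd x z = (𝔤.nil x z.1 - z.2 • 𝔤.grading x, 0) := rfl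

/-- A faithful representation of the nilpotent bracket. -/
def rep [FiniteDimensional ℝ E] : E →L[ℝ] (E × ℝ →L[ℝ] E × ℝ) :=
  LinearMap.toContinuousLinearMap
    { toFun := 𝔤.extendedAd
      map_add' := fun x y => ContinuousLinearMap.ext fun z => by
        simp only [extendedAd_apply, add_apply, map_add, smul_add, Prod.mk_add_mk, add_zero]
        congr 1
        abel
      map_smul' := fun c x => ContinuousLinearMap.ext fun z => by
        simp only [extendedAd_apply, smul_apply, map_smul, Prod.smul_mk, smul_zero,
          RingHom.id_apply, smul_sub]
        rw [smul_comm] }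

theorem rep_apply [FiniteDimensional ℝ E] (x : E) (z : E × ℝ) :
    𝔤.rep x z = (𝔤.nil x z.1 - z.2 • 𝔤.grading x, 0) := rfl

/-- The first component is the Jacobi identity; the terms containing the scalar coordinate match
because the grading is a derivation. -/
theorem isRep_rep [FiniteDimensional ℝ E] : IsRep 𝔤.nil 𝔤.rep := by
  intro x y
  refine ContinuousLinearMap.ext fun z => ?_
  have h := congrArg (fun T : E →L[ℝ] E => T z.1) (𝔤.isRep_nil x y)
  simp only [sub_apply, mul_apply_eq_comp] at h
  have hsk : 𝔤.nil (𝔤.grading x) y = - 𝔤.nil y (𝔤.grading x) := by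
    rw [𝔤.nil_skew]
  simp only [rep_apply, sub_apply, mul_apply_eq_comp, map_sub, map_smul, zero_smul, sub_zero,
    grading_nil, h, Prod.mk_sub_mk, hsk, smul_add, smul_neg]
  congr 1
  abel

/-- The adjoint representation alone would kill the centre. The added direction detects x through
its image -d(x) of (0, 1), and d is injective because all weights are positive. -/
theorem rep_injective [FiniteDimensional ℝ E] : Function.Injective 𝔤.rep := by
  refine (injective_iff_map_eq_zero _).2 fun x hx => ?_
  have h : 𝔤.rep x (0, 1) = 0 := by rw [hx]; rfl
  rw [rep_apply] at h
  simp only [map_zero, one_smul, zero_sub, Prod.mk_eq_zero, neg_eq_zero, and_true] at h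
  exact 𝔤.grading_injective (by rw [h, map_zero])

end GradedBracket


/-! ### Words whose orbit vectors span the Lie algebra. -/

section OrbitSpan

variable {E : Type*} [NormedAddCommGroup E] [NormedSpace ℝ E] [CompleteSpace E]
  [FiniteDimensional ℝ E] (B : E →L[ℝ] E →L[ℝ] E) {ι : Type*} (X : ι → E)

/-- The product of the operators `exp (tᵢ ad Xᵢ)` along a word of pairs `(i, tᵢ)`. -/
def adProd (l : List (ι × ℝ)) : E →L[ℝ] E := (l.map fun a => exp (a.2 • B (X a.1))).prod

/-- The span of the vectors `exp (t₁ ad X₁) ⋯ exp (tᵢ₋₁ ad Xᵢ₋₁) Xᵢ` along a word. -/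
def orbitSpan : List (ι × ℝ) → Submodule ℝ E
  | [] => ⊥
  | a :: l => Submodule.span ℝ {X a.1} ⊔
      (orbitSpan l).map (exp (a.2 • B (X a.1)) : E →L[ℝ] E).toLinearMap

theorem adProd_cons (a : ι × ℝ) (l : List (ι × ℝ)) :
    adProd B X (a :: l) = exp (a.2 • B (X a.1)) * adProd B X l := by
  simp [adProd]

theorem adProd_append (l₁ l₂ : List (ι × ℝ)) :
    adProd B X (l₁ ++ l₂) = adProd B X l₁ * adProd B X l₂ := by
  simp [adProd]

theorem isUnit_exp (u : E →L[ℝ] E) : IsUnit (exp u) :=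
  ⟨⟨exp u, exp (-u), exp_mul_exp_neg u, exp_neg_mul_exp u⟩, rfl⟩

theorem isUnit_adProd (l : List (ι × ℝ)) : IsUnit (adProd B X l) := by
  induction l with
  | nil => simp [adProd]
  | cons a l ih => rw [adProd_cons]; exact (isUnit_exp _).mul ih

theorem surjective_of_isUnit {u : E →L[ℝ] E} (h : IsUnit u) : Function.Surjective u := by
  obtain ⟨v, rfl⟩ := h
  intro y
  exact ⟨(↑v⁻¹ : E →L[ℝ] E) y, congrArg (fun T : E →L[ℝ] E => T y) v.mul_inv⟩

theorem orbitSpan_append (l₁ l₂ : List (ι × ℝ)) :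
    orbitSpan B X (l₁ ++ l₂) = orbitSpan B X l₁ ⊔
      (orbitSpan B X l₂).map (adProd B X l₁).toLinearMap := by
  induction l₁ with
  | nil => simp [orbitSpan, adProd, ContinuousLinearMap.one_def]
  | cons a l ih =>
    rw [List.cons_append, orbitSpan, orbitSpan, ih, Submodule.map_sup, ← Submodule.map_comp,
      ← sup_assoc, adProd_cons]
    rfl

theorem deriv_mem_submodule {f : ℝ → E} {f' : E} {s : ℝ} (hf : HasDerivAt f f' s)
    (T : Submodule ℝ E) (h : ∀ s, f s ∈ T) : f' ∈ T := by
  rw [hasDerivAt_iff_tendsto_slope] at hf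
  refine T.closed_of_finiteDimensional.mem_of_tendsto hf (Eventually.of_forall fun t => ?_)
  exact T.smul_mem _ (T.sub_mem (h t) (h s))

/-- If the `Xᵢ` generate, then there is a word along which the orbit vectors span. -/
theorem exists_orbitSpan_eq_top
    (hgen : ∀ T : Submodule ℝ E, (∀ i, X i ∈ T) → (∀ i, ∀ y ∈ T, B (X i) y ∈ T) → T = ⊤) :
    ∃ l, orbitSpan B X l = ⊤ := by
  -- By finite dimension some word has a maximal orbit span. Extending it by any l' adds nothing, so
  -- the orbit span of every l' lies in T.
  obtain ⟨S, ⟨l, rfl⟩, hmax⟩ := (wellFounded_gt (α := Submodule ℝ E)).has_min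
    (range (orbitSpan B X)) ⟨_, [], rfl⟩
  refine ⟨l, ?_⟩
  set T := (orbitSpan B X l).comap (adProd B X l).toLinearMap with hT
  have hle : ∀ l', orbitSpan B X l' ≤ T := fun l' => by
    have h1 := hmax _ ⟨l ++ l', rfl⟩
    rw [orbitSpan_append] at h1
    have h2 := eq_of_le_of_not_lt (le_sup_left (a := orbitSpan B X l)
      (b := (orbitSpan B X l').map (adProd B X l).toLinearMap)) h1
    rw [hT, ← Submodule.map_le_iff_le_comap, h2]
    exact le_sup_right
  -- T' is the set of vectors all of whose translates by the operators `adProd` stay in T. It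
  -- contains the generators and is stable under their adjoint action, hence is everything.
  set T' : Submodule ℝ E := ⨅ l' : List (ι × ℝ), T.comap (adProd B X l').toLinearMap with hT'
  have hmem : ∀ v, v ∈ T' ↔ ∀ l', adProd B X l' v ∈ T := fun v => by
    simp [hT', Submodule.mem_iInf]
  have htop : T' = ⊤ := by
    refine hgen T' (fun i => (hmem _).2 fun l' => ?_) fun j v hv => (hmem _).2 fun l' => ?_
    -- The last exponent of a word does not affect its orbit span, so 0 is an arbitrary choice.
    · apply hle (l' ++ [(i, 0)])
      rw [orbitSpan_append]
      refine Submodule.mem_sup_right (Submodule.mem_map_of_mem (f := (adProd B X l').toLinearMap) ?_)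
      exact Submodule.mem_sup_left (Submodule.mem_span_singleton_self _)
    · have h3 : ∀ s : ℝ, adProd B X l' (exp (s • B (X j)) v) ∈ T := fun s => by
        have h4 := (hmem v).1 hv (l' ++ [(j, s)])
        rw [adProd_append] at h4
        simpa [adProd] using h4
      -- Differentiating exp(s ad X_j) v at s = 0 turns invariance under the group into invariance
      -- under ad X_j, as subspaces are closed.
      have h5 := (hasDerivAt_exp_smul (B (X j)) 0).clm_apply (hasDerivAt_const (0 : ℝ) v)
      have h6 := (adProd B X l').hasFDerivAt.comp_hasDerivAt (0 : ℝ) h5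
      have h7 := deriv_mem_submodule h6 T h3
      simpa using h7
  have hT1 : ∀ v, v ∈ T := fun v => by
    have h8 := (hmem v).1 (by rw [htop]; trivial) []
    simpa [adProd] using h8
  refine eq_top_iff.2 fun y _ => ?_
  obtain ⟨x, rfl⟩ := surjective_of_isUnit (isUnit_adProd B X l) y
  exact hT1 x

end OrbitSpan

/-! ### Closed words and their rescalings. -/

section InverseWord

variable {E : Type*} [NormedAddCommGroup E] [NormedSpace ℝ E] [CompleteSpace E]
  [FiniteDimensional ℝ E] {A : Type*} [NormedRing A] [NormedAlgebra ℝ A] [CompleteSpace A]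
  {ι : Type*}

/-- The inverse word. -/
def invWord (l : List (ι × ℝ)) : List (ι × ℝ) := (l.map fun a => (a.1, -a.2)).reverse

/-- Rescale the exponents of a word. -/
def scaleWord (c : ℝ) (l : List (ι × ℝ)) : List (ι × ℝ) := l.map fun a => (a.1, c * a.2)

/-- The product of the exponentials along a word. -/
def expWord (Y : ι → A) (l : List (ι × ℝ)) : A := (l.map fun a => exp (a.2 • Y a.1)).prod

theorem expWord_append (Y : ι → A) (l₁ l₂ : List (ι × ℝ)) :
    expWord Y (l₁ ++ l₂) = expWord Y l₁ * expWord Y l₂ := by simp [expWord]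

theorem expWord_mul_invWord (Y : ι → A) (l : List (ι × ℝ)) :
    expWord Y l * expWord Y (invWord l) = 1 := by
  induction l with
  | nil => simp [expWord, invWord]
  | cons a l ih =>
    have h1 : expWord Y (a :: l) = exp (a.2 • Y a.1) * expWord Y l := by simp [expWord]
    have h2 : expWord Y (invWord (a :: l)) = expWord Y (invWord l) * exp (-(a.2 • Y a.1)) := by
      simp [expWord, invWord]
    rw [h1, h2, mul_assoc, ← mul_assoc (expWord Y l), ih, one_mul, exp_mul_exp_neg]

theorem expWord_map_zero (Y : ι → A) (l : List ι) : expWord Y (l.map fun i => (i, (0 : ℝ))) = 1 := by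
  induction l with
  | nil => simp [expWord]
  | cons a l ih =>
    simp only [expWord, List.map_cons, List.prod_cons, zero_smul, exp_zero, one_mul]
    exact ih

theorem scaleWord_invWord (c : ℝ) (l : List (ι × ℝ)) :
    scaleWord c (invWord l) = invWord (scaleWord c l) := by
  simp [scaleWord, invWord, List.map_reverse]

theorem scaleWord_append (c : ℝ) (l₁ l₂ : List (ι × ℝ)) :
    scaleWord c (l₁ ++ l₂) = scaleWord c l₁ ++ scaleWord c l₂ := by simp [scaleWord]

theorem scaleWord_map_zero (c : ℝ) (l : List ι) :
    scaleWord c (l.map fun i => (i, (0 : ℝ))) = l.map fun i => (i, (0 : ℝ)) := by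
  simp [scaleWord]

namespace GradedBracket

variable (𝔤 : GradedBracket E) {p : ℕ} {X : Fin p → E}

theorem dilation_eq_smul {v : E} (hv : 𝔤.proj 1 v = v) (ε : ℝ) : 𝔤.dilation ε v = ε • v := by
  rw [← hv, dilation, weighted_proj, pow_one]

/-- The dilation δ_c multiplies each letter by c and is an automorphism of the nilpotent bracket, so
it intertwines exp(t ad X) with exp(ct ad X). Consequently a spanning word can be made arbitrarily
small. -/
theorem orbitSpan_scaleWord (hX : ∀ i, 𝔤.proj 1 (X i) = X i) {c : ℝ} (hc : c ≠ 0)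
    (l : List (Fin p × ℝ)) :
    orbitSpan 𝔤.nil X (scaleWord c l) =
      (orbitSpan 𝔤.nil X l).map (𝔤.dilation c).toLinearMap := by
  induction l with
  | nil => simp [scaleWord, orbitSpan]
  | cons a l ih =>
    have h0 : scaleWord c (a :: l) = (a.1, c * a.2) :: scaleWord c l := rfl
    have h1 : 𝔤.dilation c * exp (a.2 • 𝔤.nil (X a.1)) =
        exp ((c * a.2) • 𝔤.nil (X a.1)) * 𝔤.dilation c := by
      have : SemiconjBy (𝔤.dilation c) (a.2 • 𝔤.nil (X a.1)) ((c * a.2) • 𝔤.nil (X a.1)) := by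
        refine ContinuousLinearMap.ext fun z => ?_
        simp only [mul_apply_eq_comp, smul_apply, map_smul, dilation_nil,
          𝔤.dilation_eq_smul (hX _), smul_smul]
        rw [mul_comm]
      let _ : NormedAlgebra ℚ (E →L[ℝ] E) := NormedAlgebra.restrictScalars ℚ ℝ _
      exact this.exp_right
    rw [h0, orbitSpan, orbitSpan, ih, Submodule.map_sup, ← Submodule.map_comp,
      ← Submodule.map_comp, Submodule.map_span, image_singleton]
    congr 1
    · have h2 : (𝔤.dilation c).toLinearMap (X a.1) = c • X a.1 := 𝔤.dilation_eq_smul (hX _) c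
      rw [h2]
      exact (Submodule.span_singleton_smul_eq (IsUnit.mk0 c hc) _).symm
    · congr 1
      exact congrArg (fun T : E →L[ℝ] E => T.toLinearMap) h1.symm

/-- There is a word, containing all letters, whose product is the identity in all rescalings,
and along which the orbit vectors span. -/
theorem exists_closed_word (hX : ∀ i, 𝔤.proj 1 (X i) = X i)
    (hgen : ∀ T : Submodule ℝ E, (∀ i, X i ∈ T) → (∀ i, ∀ y ∈ T, 𝔤.nil (X i) y ∈ T) → T = ⊤)
    (Y : Fin p → A) :
    ∃ l : List (Fin p × ℝ), (∀ i, i ∈ l.map Prod.fst) ∧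
      (∀ c : ℝ, expWord Y (scaleWord c l) = 1) ∧
      ∀ c : ℝ, c ≠ 0 → orbitSpan 𝔤.nil X (scaleWord c l) = ⊤ := by
  obtain ⟨l, hl⟩ := exists_orbitSpan_eq_top 𝔤.nil X hgen
  -- The initial letters with exponent 0 only ensure that every generator occurs; l followed by its
  -- inverse makes the product trivial, and l alone already spans.
  refine ⟨(List.finRange p).map (fun i => (i, (0 : ℝ))) ++ (l ++ invWord l), ?_, ?_, ?_⟩
  · intro i
    simp
  · intro c
    rw [scaleWord_append, scaleWord_append, expWord_append, expWord_append, scaleWord_map_zero,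
      expWord_map_zero, one_mul, scaleWord_invWord, expWord_mul_invWord]
  · intro c hc
    rw [𝔤.orbitSpan_scaleWord hX hc, orbitSpan_append, orbitSpan_append, hl, top_sup_eq]
    have hsurj : ∀ T : E →L[ℝ] E, Function.Surjective T →
        (⊤ : Submodule ℝ E).map T.toLinearMap = ⊤ := fun T hT => by
      rw [Submodule.map_top]; exact LinearMap.range_eq_top.2 hT
    rw [hsurj _ (surjective_of_isUnit (isUnit_adProd _ _ _)), sup_top_eq,
      hsurj _ (𝔤.dilationEquiv hc).surjective]

end GradedBracket

end InverseWord


/-! ### Word maps in exponential coordinates. -/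

section Words

theorem wordProd_succ {L : Type*} [AddCommGroup L] [Module ℝ L] {H : Type*} [Mul H] [One H]
    (e : L → H) {M : ℕ} (Y : Fin (M + 1) → L) (t : Fin (M + 1) → ℝ) :
    wordProd e Y t =
      e (t 0 • Y 0) * wordProd e (fun i => Y i.succ) (fun i => t i.succ) := by
  simp [wordProd, List.ofFn_succ]

variable {E : Type*} [NormedAddCommGroup E] [NormedSpace ℝ E] [CompleteSpace E]
  [FiniteDimensional ℝ E]

/-- The iterated product `t₁ Y₁ · (t₂ Y₂ · (⋯))` for a binary operation. -/
def wordFold (op : E → E → E) {M : ℕ} (Y : Fin M → E) (t : Fin M → ℝ) : E :=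
  (List.ofFn fun i => t i • Y i).foldr op 0

theorem wordFold_succ (op : E → E → E) {M : ℕ} (Y : Fin (M + 1) → E) (t : Fin (M + 1) → ℝ) :
    wordFold op Y t =
      op (t 0 • Y 0) (wordFold op (fun i => Y i.succ) (fun i => t i.succ)) := by
  simp [wordFold, List.ofFn_succ]

theorem wordFold_zero {op : E → E → E} (h : op 0 0 = 0) {M : ℕ} (Y : Fin M → E) :
    wordFold op Y 0 = 0 := by
  induction M with
  | zero => simp [wordFold]
  | succ M ih =>
    have := ih (fun i => Y i.succ)
    rw [wordFold_succ, Pi.zero_apply, zero_smul]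
    change op 0 (wordFold op (fun i => Y i.succ) 0) = 0
    rw [this, h]

theorem wordProd_expRep {A : Type*} [NormedRing A] [NormedAlgebra ℝ A] (ρ : E →L[ℝ] A)
    {ι : Type*} (X : ι → E) {M : ℕ} (g : Fin M → ι) (t : Fin M → ℝ) :
    wordProd (fun v => exp (ρ v)) (fun i => X (g i)) t =
      expWord (fun i => ρ (X i)) (List.ofFn fun i => (g i, t i)) := by
  simp [wordProd, expWord, List.map_ofFn, Function.comp_def]

/-- Every orbit vector is the right-trivialised derivative of the word map in some direction. -/
theorem exists_hasDerivAt_wordProd {A : Type*} [NormedRing A] [NormedAlgebra ℝ A]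
    [CompleteSpace A] {B : E →L[ℝ] E →L[ℝ] E} {ρ : E →L[ℝ] A} (hρ : IsRep B ρ) {ι : Type*}
    (X : ι → E) {M : ℕ} (g : Fin M → ι) (t : Fin M → ℝ) {v : E}
    (hv : v ∈ orbitSpan B X (List.ofFn fun i => (g i, t i))) :
    ∃ c : Fin M → ℝ, HasDerivAt
      (fun s : ℝ => wordProd (fun v => exp (ρ v)) (fun i => X (g i)) (t + s • c))
      (ρ v * wordProd (fun v => exp (ρ v)) (fun i => X (g i)) t) 0 := by
  induction M generalizing v with
  | zero =>
    have hv0 : v = 0 := by simpa [orbitSpan] using hv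
    refine ⟨0, ?_⟩
    rw [hv0]
    refine ((hasDerivAt_const (0 : ℝ)
      (wordProd (fun v => exp (ρ v)) (fun i => X (g i)) t)).congr_of_eventuallyEq
        (Eventually.of_forall fun s => ?_)).congr_deriv (by rw [map_zero, zero_mul])
    rw [smul_zero, add_zero]
  | succ M ih =>
    rw [List.ofFn_succ, orbitSpan, Submodule.mem_sup] at hv
    obtain ⟨y, hy, z, hz, rfl⟩ := hv
    obtain ⟨a, rfl⟩ := Submodule.mem_span_singleton.1 hy
    obtain ⟨v', hv', rfl⟩ := Submodule.mem_map.1 hz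
    obtain ⟨c, hc⟩ := ih (fun i => g i.succ) (fun i => t i.succ) hv'
    -- The first letter contributes a X₁ directly. The derivative from the tail is moved to the left
    -- of exp(t₁ X₁) by conjugation, which acts as exp(t₁ ad X₁).
    refine ⟨Fin.cons a c, ?_⟩
    have h1 : HasDerivAt (fun s : ℝ => exp ((t 0 + s * a) • ρ (X (g 0))))
        (a • (exp (t 0 • ρ (X (g 0))) * ρ (X (g 0)))) 0 := by
      have h2 : HasDerivAt (fun s : ℝ => t 0 + s * a) a 0 := by
        simpa using ((hasDerivAt_id (0 : ℝ)).mul_const a).const_add (t 0)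
      have h3 := HasDerivAt.scomp (0 : ℝ) (g₁ := fun s : ℝ => exp (s • ρ (X (g 0))))
        (hasDerivAt_exp_smul (ρ (X (g 0))) (t 0 + 0 * a)) h2
      exact h3.congr_deriv (by simp)
    have h4 := h1.mul hc
    refine (h4.congr_of_eventuallyEq (Eventually.of_forall fun s => ?_)).congr_deriv ?_
    · rw [wordProd_succ, Pi.mul_apply]
      simp only [map_smul, Pi.add_apply, Pi.smul_apply, Fin.cons_zero, smul_eq_mul]
      rfl
    · rw [wordProd_succ]
      have h5 := exp_rep_mul hρ (t 0 • X (g 0)) v'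
      simp only [map_smul] at h5
      have h6 : Commute (ρ (X (g 0))) (exp (t 0 • ρ (X (g 0)))) :=
        ((Commute.refl _).smul_right _).exp_right
      have h0 : (fun i : Fin M => (t + (0 : ℝ) • (Fin.cons a c : Fin (M + 1) → ℝ)) i.succ) =
          fun i => t i.succ := by ext i; simp
      simp only [zero_mul, add_zero, zero_smul, map_add, map_smul, add_mul, smul_mul_assoc]
      congr 1
      · rw [← h6.eq]; simp only [mul_assoc]
      · rw [← mul_assoc, h5, mul_assoc]; rfl

namespace GradedBracket

variable (𝔤 : GradedBracket E) {M : ℕ} (Y : Fin M → E)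

/-- The word map in exponential coordinates, for the rescaled brackets. -/
def wordMap (q : ℝ × (Fin M → ℝ)) : E := wordFold (bch (𝔤.scaled q.1)) Y q.2

theorem wordMap_zero (ε : ℝ) : 𝔤.wordMap Y (ε, 0) = 0 := wordFold_zero (bch_zero_zero _) Y

/-- Drop the first letter. -/
def tailMap (M : ℕ) (q : ℝ × (Fin (M + 1) → ℝ)) : ℝ × (Fin M → ℝ) := (q.1, fun i => q.2 i.succ)

theorem contDiff_tailMap : ContDiff ℝ 1 (tailMap M) :=
  contDiff_fst.prodMk (contDiff_pi.2 fun i => (contDiff_apply ℝ ℝ i.succ).comp contDiff_snd)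

theorem wordMap_succ (Y : Fin (M + 1) → E) (q : ℝ × (Fin (M + 1) → ℝ)) :
    𝔤.wordMap Y q = bch (𝔤.scaled q.1) (q.2 0 • Y 0)
      (𝔤.wordMap (fun i => Y i.succ) (tailMap M q)) := wordFold_succ _ _ _

theorem contDiffAt_wordMap : ContDiffAt ℝ 1 (𝔤.wordMap Y) (0, 0) := by
  induction M with
  | zero =>
    have : 𝔤.wordMap Y = fun _ => 0 := by ext q; simp [wordMap, wordFold]
    rw [this]
    exact contDiffAt_const
  | succ M ih =>
    have h1 : ContDiffAt ℝ 1 (fun q : ℝ × (Fin (M + 1) → ℝ) =>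
        𝔤.wordMap (fun i => Y i.succ) (tailMap M q)) (0, 0) :=
      (ih fun i => Y i.succ).comp (f := tailMap M) (0, 0) contDiff_tailMap.contDiffAt
    have h2 : ContDiffAt ℝ 1 (fun q : ℝ × (Fin (M + 1) → ℝ) => q.2 0 • Y 0) (0, 0) :=
      (((contDiff_apply ℝ ℝ (0 : Fin (M + 1))).comp contDiff_snd).smul contDiff_const).contDiffAt
    have h3 : ContDiffAt ℝ 1 (fun q : ℝ × (Fin (M + 1) → ℝ) => 𝔤.scaled q.1) (0, 0) :=
      (𝔤.contDiff_scaled.comp contDiff_fst).contDiffAt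
    have h4 := h3.prodMk (h2.prodMk h1)
    have h5 : ContDiffAt ℝ 1
        (fun p : (E →L[ℝ] E →L[ℝ] E) × E × E => bch p.1 p.2.1 p.2.2)
        (𝔤.scaled 0, (0 : Fin (M + 1) → ℝ) 0 • Y 0,
          𝔤.wordMap (fun i => Y i.succ) (tailMap M (0, 0))) := by
      have : tailMap M (0, 0) = (0, 0) := rfl
      rw [this, wordMap_zero, Pi.zero_apply, zero_smul]
      exact contDiffAt_bch _
    exact (h5.comp (f := fun q : ℝ × (Fin (M + 1) → ℝ) => (𝔤.scaled q.1, q.2 0 • Y 0,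
      𝔤.wordMap (fun i => Y i.succ) (tailMap M q))) (0, 0) h4).congr_of_eventuallyEq
        (Eventually.of_forall fun q => 𝔤.wordMap_succ Y q)

theorem tendsto_tailMap : Tendsto (tailMap M) (𝓝 (0, 0)) (𝓝 (0, 0)) :=
  (contDiff_tailMap (M := M)).continuous.tendsto (0, 0)

/-- A local homomorphism in exponential coordinates maps words to words. -/
theorem eventually_wordProd_eq {H : Type*} [Mul H] [One H] {e : E → H} (he : e 0 = 1) {r : ℝ}
    (hr : 0 < r)
    (hlaw : ∀ x y, ‖x‖ < r → ‖y‖ < r → e x * e y = e (bch 𝔤.bracket x y))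
    (hY : ∀ i, 𝔤.proj 1 (Y i) = Y i) :
    ∀ᶠ q : ℝ × (Fin M → ℝ) in 𝓝 (0, 0), q.1 ≠ 0 →
      wordProd e Y (q.1 • q.2) = e (𝔤.dilation q.1 (𝔤.wordMap Y q)) := by
  induction M with
  | zero => simp [wordProd, wordMap, wordFold, he]
  | succ M ih =>
    have h1 := tendsto_tailMap.eventually (ih (fun i => Y i.succ) fun i => hY _)
    have hsmall : ∀ f : ℝ × (Fin (M + 1) → ℝ) → E, ContinuousAt f (0, 0) → f (0, 0) = 0 →
        ∀ᶠ q : ℝ × (Fin (M + 1) → ℝ) in 𝓝 (0, 0), ‖𝔤.dilation q.1 (f q)‖ < r := by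
      intro f hf hf0
      have h2 : ContinuousAt (fun q : ℝ × (Fin (M + 1) → ℝ) => ‖𝔤.dilation q.1 (f q)‖) (0, 0) :=
        (((𝔤.contDiff_dilation.continuous.comp continuous_fst).continuousAt).clm_apply hf).norm
      refine h2.eventually_lt continuousAt_const ?_
      rw [hf0, map_zero, norm_zero]
      exact hr
    have h2 := hsmall (fun q => q.2 0 • Y 0) (by fun_prop) (by simp)
    have h3 := hsmall (fun q => 𝔤.wordMap (fun i => Y i.succ) (tailMap M q))
      (((𝔤.contDiffAt_wordMap (fun i => Y i.succ)).continuousAt).comp (f := tailMap M)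
        (x := (0, 0)) contDiff_tailMap.continuous.continuousAt) (𝔤.wordMap_zero _ 0)
    filter_upwards [h1, h2, h3] with q hq1 hq2 hq3 hq
    have h4 : (q.1 • q.2) 0 • Y 0 = 𝔤.dilation q.1 (q.2 0 • Y 0) := by
      rw [map_smul, 𝔤.dilation_eq_smul (hY 0), Pi.smul_apply, smul_eq_mul, smul_smul, mul_comm]
    have h5 : wordProd e (fun i => Y i.succ) (fun i => (q.1 • q.2) i.succ) =
        e (𝔤.dilation q.1 (𝔤.wordMap (fun i => Y i.succ) (tailMap M q))) := hq1 hq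
    rw [wordProd_succ, h4, h5, hlaw _ _ hq2 hq3, 𝔤.bch_dilation hq, wordMap_succ]

/-- Although `bch` is not known to be associative here, this identifies the nested product with a
product of matrices, where words and inverses are easy to handle. -/
theorem eventually_wordProd_rep :
    ∀ᶠ t : Fin M → ℝ in 𝓝 0,
      wordProd (fun v => exp (𝔤.rep v)) Y t = exp (𝔤.rep (𝔤.wordMap Y (0, t))) := by
  obtain ⟨r, hr, hlaw⟩ := exists_exp_mul_exp_eq 𝔤.isRep_nil 𝔤.isRep_rep
  induction M with
  | zero => simp [wordProd, wordMap, wordFold]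
  | succ M ih =>
    have htail : Continuous fun t : Fin (M + 1) → ℝ => fun i : Fin M => t i.succ := by fun_prop
    have h1 := (htail.tendsto 0).eventually (ih fun i => Y i.succ)
    have h2 : ∀ᶠ t : Fin (M + 1) → ℝ in 𝓝 0, ‖t 0 • Y 0‖ < r := by
      have : ContinuousAt (fun t : Fin (M + 1) → ℝ => ‖t 0 • Y 0‖) 0 :=
        ((continuous_apply 0).smul continuous_const).norm.continuousAt
      exact this.eventually_lt continuousAt_const (by simpa using hr)
    have h3 : ∀ᶠ t : Fin (M + 1) → ℝ in 𝓝 0,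
        ‖𝔤.wordMap (fun i => Y i.succ) (0, fun i => t i.succ)‖ < r := by
      have hc : ContinuousAt (fun t : Fin (M + 1) → ℝ =>
          𝔤.wordMap (fun i => Y i.succ) (0, fun i => t i.succ)) 0 :=
        ((𝔤.contDiffAt_wordMap (fun i => Y i.succ)).continuousAt).comp
          (f := fun t : Fin (M + 1) → ℝ => ((0 : ℝ), fun i : Fin M => t i.succ)) (x := 0)
          (continuous_const.prodMk htail).continuousAt
      refine hc.norm.eventually_lt continuousAt_const ?_
      have := 𝔤.wordMap_zero (fun i => Y i.succ) 0
      change ‖𝔤.wordMap (fun i => Y i.succ) (0, 0)‖ < r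
      rw [this, norm_zero]
      exact hr
    filter_upwards [h1, h2, h3] with t ht1 ht2 ht3
    rw [wordProd_succ, ht1, hlaw _ _ ht2 ht3, wordMap_succ]
    rfl

/-- The exponential is injective near 0 and the representation is faithful, so a small word with
trivial matrix product has trivial exponential coordinates. -/
theorem eventually_wordMap_eq_zero :
    ∀ᶠ t : Fin M → ℝ in 𝓝 0, exp (𝔤.rep (𝔤.wordMap Y (0, t))) = 1 → 𝔤.wordMap Y (0, t) = 0 := by
  have hinj : ∀ᶠ u : E × ℝ →L[ℝ] E × ℝ in 𝓝 0, exp u = 1 → u = 0 := by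
    have h1 : HasStrictFDerivAt (exp : (E × ℝ →L[ℝ] E × ℝ) → _)
        ((ContinuousLinearEquiv.refl ℝ (E × ℝ →L[ℝ] E × ℝ) : _ →L[ℝ] _)) 0 :=
      hasStrictFDerivAt_exp_zero (𝕂 := ℝ)
    filter_upwards [h1.eventually_left_inverse] with u hu hu1
    have h0 := h1.localInverse_apply_image
    rw [exp_zero] at h0
    rw [hu1] at hu
    exact hu.symm.trans h0
  have hc : ContinuousAt (fun t : Fin M → ℝ => 𝔤.rep (𝔤.wordMap Y (0, t))) 0 :=
    𝔤.rep.continuous.continuousAt.comp ((𝔤.contDiffAt_wordMap Y).continuousAt.comp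
      (f := fun t : Fin M → ℝ => ((0 : ℝ), t)) (x := 0) (by fun_prop))
  have h0 : 𝔤.rep (𝔤.wordMap Y (0, 0)) = 0 := by rw [wordMap_zero, map_zero]
  rw [ContinuousAt, h0] at hc
  filter_upwards [hc.eventually hinj] with t ht h
  exact 𝔤.rep_injective (by rw [ht h, map_zero])

end GradedBracket

end Words


/-! ### Uniform openness of the word maps and comparison of costs. -/

namespace GradedBracket

variable {E : Type*} [NormedAddCommGroup E] [NormedSpace ℝ E] [CompleteSpace E]
  [FiniteDimensional ℝ E] (𝔤 : GradedBracket E)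

theorem wordFold_nil_smul {M : ℕ} (Y : Fin M → E) (hY : ∀ i, 𝔤.proj 1 (Y i) = Y i) {c : ℝ}
    (hc : c ≠ 0) (t : Fin M → ℝ) :
    wordFold (bch 𝔤.nil) Y (c • t) = 𝔤.dilation c (wordFold (bch 𝔤.nil) Y t) := by
  induction M with
  | zero => simp [wordFold]
  | succ M ih =>
    have h1 := ih (fun i => Y i.succ) (fun i => hY _) fun i => t i.succ
    have h2 : (c • t) 0 • Y 0 = 𝔤.dilation c (t 0 • Y 0) := by
      rw [map_smul, 𝔤.dilation_eq_smul (hY 0), Pi.smul_apply, smul_eq_mul, smul_smul, mul_comm]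
    rw [wordFold_succ, wordFold_succ, h2]
    change bch 𝔤.nil _ (wordFold (bch 𝔤.nil) (fun i => Y i.succ) (c • fun i => t i.succ)) = _
    rw [h1, 𝔤.bch_nil_dilation hc]

/-- At a parameter where the word in the nilpotent group is trivial and the orbit vectors span,
the word map is a submersion in the word variables. -/
theorem surjective_fderiv_wordMap {M p : ℕ} (X : Fin p → E) (g : Fin M → Fin p) (t : Fin M → ℝ)
    (hspan : orbitSpan 𝔤.nil X (List.ofFn fun i => (g i, t i)) = ⊤)
    (hrep : ∀ᶠ s : Fin M → ℝ in 𝓝 t, wordProd (fun v => exp (𝔤.rep v)) (fun i => X (g i)) s =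
      exp (𝔤.rep (𝔤.wordMap (fun i => X (g i)) (0, s))))
    (h0 : 𝔤.wordMap (fun i => X (g i)) (0, t) = 0)
    {F' : ℝ × (Fin M → ℝ) →L[ℝ] E}
    (hF : HasFDerivAt (𝔤.wordMap fun i => X (g i)) F' (0, t)) (v : E) : ∃ c, F' (0, c) = v := by
  obtain ⟨c, hc⟩ := exists_hasDerivAt_wordProd 𝔤.isRep_rep X g t
    (v := v) (by rw [hspan]; trivial)
  refine ⟨c, 𝔤.rep_injective ?_⟩
  have hone : wordProd (fun v => exp (𝔤.rep v)) (fun i => X (g i)) t = 1 := by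
    rw [hrep.self_of_nhds, h0, map_zero, exp_zero]
  rw [hone, mul_one] at hc
  have hline : HasDerivAt (fun s : ℝ => ((0 : ℝ), t + s • c)) ((0 : ℝ), c) 0 := by
    refine (hasDerivAt_const (0 : ℝ) (0 : ℝ)).prodMk ?_
    simpa using ((hasDerivAt_id (0 : ℝ)).smul_const c).const_add t
  have hline0 : ((0 : ℝ), t + (0 : ℝ) • c) = (0, t) := by simp
  have h1 : HasDerivAt (fun s : ℝ => 𝔤.wordMap (fun i => X (g i)) (0, t + s • c)) (F' (0, c)) 0 :=
    HasFDerivAt.comp_hasDerivAt (l := 𝔤.wordMap fun i => X (g i)) (l' := F') (0 : ℝ)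
      (by rw [hline0]; exact hF) hline
  have h2 : HasDerivAt (fun s : ℝ => 𝔤.rep (𝔤.wordMap (fun i => X (g i)) (0, t + s • c)))
      (𝔤.rep (F' (0, c))) 0 := 𝔤.rep.hasFDerivAt.comp_hasDerivAt (0 : ℝ) h1
  -- The base word is trivial and exp has derivative the identity at 0, so the derivative of the
  -- word in exponential coordinates can be read off the matrix product.
  have h3 : HasDerivAt (fun s : ℝ => exp (𝔤.rep (𝔤.wordMap (fun i => X (g i)) (0, t + s • c))))
      (𝔤.rep (F' (0, c))) 0 := by
    have hexp : HasFDerivAt (exp : (E × ℝ →L[ℝ] E × ℝ) → _) (ContinuousLinearMap.id ℝ _)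
        (𝔤.rep (𝔤.wordMap (fun i => X (g i)) (0, t + (0 : ℝ) • c))) := by
      rw [hline0, h0, map_zero]
      exact hasFDerivAt_exp_zero (𝕂 := ℝ)
    exact hexp.comp_hasDerivAt (0 : ℝ) h2
  have hcont : Tendsto (fun s : ℝ => t + s • c) (𝓝 0) (𝓝 t) := by
    have : Continuous fun s : ℝ => t + s • c := by fun_prop
    simpa using this.tendsto 0
  exact h3.unique (hc.congr_of_eventuallyEq ((hcont.eventually hrep).mono fun s hs => hs.symm))

theorem norm_le_sum_abs {M : ℕ} (t : Fin M → ℝ) : ‖t‖ ≤ ∑ i, |t i| :=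
  (pi_norm_le_iff_of_nonneg (Finset.sum_nonneg fun _ _ => abs_nonneg _)).2 fun i =>
    Finset.single_le_sum (f := fun i => |t i|) (fun _ _ => abs_nonneg _) (Finset.mem_univ i)

/-- Uniform openness of the rescaled word maps. -/
theorem exists_word {p : ℕ} (X : Fin p → E) (hX : ∀ i, 𝔤.proj 1 (X i) = X i)
    (hgen : ∀ T : Submodule ℝ E, (∀ i, X i ∈ T) → (∀ i, ∀ y ∈ T, 𝔤.nil (X i) y ∈ T) → T = ⊤)
    {H : Type*} [Mul H] [One H] {e : E → H} (he : e 0 = 1) {r : ℝ} (hr : 0 < r)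
    (hlaw : ∀ x y, ‖x‖ < r → ‖y‖ < r → e x * e y = e (bch 𝔤.bracket x y)) :
    ∃ (M : ℕ) (g : Fin M → Fin p), Function.Surjective g ∧
      ∃ ρ > 0, ∃ σ > 0, ∃ η > 0, ∃ C > 0,
        (∀ ε y, |ε| < η → ‖y‖ < ρ → ∃ s : Fin M → ℝ, ∑ i, |s i| < C ∧
          𝔤.wordMap (fun i => X (g i)) (ε, s) = y ∧
          (ε ≠ 0 → wordProd e (fun i => X (g i)) (ε • s) = e (𝔤.dilation ε y))) ∧
        ∀ (ε : ℝ) (t : Fin M → ℝ), |ε| < η → ∑ i, |t i| < σ →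
          ‖𝔤.wordMap (fun i => X (g i)) (ε, t)‖ < ρ ∧
          (ε ≠ 0 → wordProd e (fun i => X (g i)) (ε • t) =
            e (𝔤.dilation ε (𝔤.wordMap (fun i => X (g i)) (ε, t)))) := by
  obtain ⟨l, hl, hone, hspan⟩ := 𝔤.exists_closed_word hX hgen fun i => 𝔤.rep (X i)
  set g : Fin l.length → Fin p := fun i => (l.get i).1 with hg
  set s₁ : Fin l.length → ℝ := fun i => (l.get i).2 with hs₁
  have hword : ∀ c : ℝ, List.ofFn (fun i => (g i, (c • s₁) i)) = scaleWord c l := by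
    intro c
    conv_rhs => rw [scaleWord, ← List.ofFn_get l, List.map_ofFn]
    rfl
  set Y : Fin l.length → E := fun i => X (g i) with hY
  have hY1 : ∀ i, 𝔤.proj 1 (Y i) = Y i := fun i => hX _
  have hlaw' := 𝔤.eventually_wordProd_eq Y he hr hlaw hY1
  have hlim : Tendsto (fun c : ℝ => c • s₁) (𝓝[≠] 0) (𝓝 0) := by
    have : Continuous fun c : ℝ => c • s₁ := by fun_prop
    simpa using (this.tendsto 0).mono_left nhdsWithin_le_nhds
  have hlim' : Tendsto (fun c : ℝ => ((0 : ℝ), c • s₁)) (𝓝[≠] 0) (𝓝 (0, 0)) :=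
    tendsto_const_nhds.prodMk_nhds hlim
  -- The closed word is shrunk by some c ≠ 0 until all the local statements near the zero word, on
  -- regularity, group law and injectivity, apply at it.
  have hev := (hlim'.eventually ((𝔤.contDiffAt_wordMap Y).eventually (by simp))).and
    ((hlim'.eventually hlaw'.eventually_nhds).and
    ((hlim.eventually (𝔤.eventually_wordProd_rep Y).eventually_nhds).and
    ((hlim.eventually (𝔤.eventually_wordMap_eq_zero Y)).and self_mem_nhdsWithin)))
  obtain ⟨c, hc1, hc2, hc3, hc4, hc0⟩ := hev.exists
  set s₀ := c • s₁ with hs₀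
  have hzero : 𝔤.wordMap Y (0, s₀) = 0 := by
    refine hc4 ?_
    rw [← hc3.self_of_nhds, hY, wordProd_expRep, hword, hone]
  have hstrict := hc1.hasStrictFDerivAt one_ne_zero
  set F' := fderiv ℝ (𝔤.wordMap Y) (0, s₀)
  have hsurj := 𝔤.surjective_fderiv_wordMap X g s₀ (by rw [hword]; exact hspan c hc0) hc3 hzero
    hstrict.hasFDerivAt
  have hΨ : HasStrictFDerivAt (fun q : ℝ × (Fin l.length → ℝ) => (q.1, 𝔤.wordMap Y q))
      ((ContinuousLinearMap.fst ℝ ℝ (Fin l.length → ℝ)).prod F') (0, s₀) :=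
    hasStrictFDerivAt_fst.prodMk hstrict
  -- Keeping ε as a coordinate of the target makes the resulting openness uniform in ε. To hit (a,
  -- v), the contribution F'(a, 0) is corrected in the word variables.
  have hmap := hΨ.map_nhds_eq_of_surj (by
    refine LinearMap.range_eq_top.2 fun ⟨a, v⟩ => ?_
    obtain ⟨d, hd⟩ := hsurj (v - F' (a, 0))
    refine ⟨(a, d), ?_⟩
    have : F' (a, d) = F' (a, 0) + F' (0, d) := by rw [← map_add]; simp
    simp [this, hd])
  -- Any bound strictly above the cost of s₀ holds for all words near s₀.
  set C : ℝ := ∑ i, |s₀ i| + 1 with hC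
  have hCpos : 0 < C := by positivity
  have hcost : ∀ᶠ q : ℝ × (Fin l.length → ℝ) in 𝓝 (0, s₀), ∑ i, |q.2 i| < C := by
    have : Continuous fun q : ℝ × (Fin l.length → ℝ) => ∑ i, |q.2 i| := by fun_prop
    exact this.continuousAt.eventually_lt continuousAt_const (by simp [hC])
  have himg := image_mem_map (m := fun q : ℝ × (Fin l.length → ℝ) => (q.1, 𝔤.wordMap Y q))
    (hcost.and hc2)
  rw [hmap, hzero, Metric.mem_nhds_iff] at himg
  obtain ⟨ρ, hρ, hball⟩ := himg
  have hsmall : ∀ᶠ q : ℝ × (Fin l.length → ℝ) in 𝓝 (0, 0), ‖𝔤.wordMap Y q‖ < ρ :=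
    (𝔤.contDiffAt_wordMap Y).continuousAt.norm.eventually_lt continuousAt_const
      (by rw [wordMap_zero, norm_zero]; exact hρ)
  obtain ⟨σ, hσ, hσ'⟩ := Metric.eventually_nhds_iff.1 (hsmall.and hlaw')
  refine ⟨l.length, g, fun i => ?_, ρ, hρ, σ, hσ, min ρ σ, lt_min hρ hσ, C, hCpos, ?_, ?_⟩
  · obtain ⟨a, ha, rfl⟩ := List.mem_map.1 (hl i)
    obtain ⟨n, hn⟩ := List.mem_iff_get.1 ha
    exact ⟨n, by rw [hg, ← hn]⟩
  · intro ε y hε hy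
    have : (ε, y) ∈ Metric.ball ((0 : ℝ), (0 : E)) ρ := by
      rw [mem_ball_iff_norm, Prod.mk_sub_mk, sub_zero, sub_zero, Prod.norm_mk]
      exact max_lt (hε.trans_le (min_le_left _ _)) hy
    obtain ⟨⟨ε', s⟩, ⟨h1, h2⟩, h3⟩ := hball this
    obtain ⟨rfl, rfl⟩ := Prod.mk.inj h3
    exact ⟨s, h1, rfl, h2⟩
  · intro ε t hε ht
    refine hσ' ?_
    rw [dist_eq_norm, Prod.mk_sub_mk, sub_zero, sub_zero, Prod.norm_mk]
    exact max_lt (hε.trans_le (min_le_right _ _)) ((norm_le_sum_abs t).trans_lt ht)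

theorem sum_abs_smul {M : ℕ} (c : ℝ) (t : Fin M → ℝ) :
    ∑ i, |(c • t) i| = |c| * ∑ i, |t i| := by
  rw [Finset.mul_sum]
  exact Finset.sum_congr rfl fun i _ => by rw [Pi.smul_apply, smul_eq_mul, abs_mul]

/-- The comparison of boxes in exponential coordinates. -/
theorem exists_comparison {p : ℕ} (X : Fin p → E) (hX : ∀ i, 𝔤.proj 1 (X i) = X i)
    (hgen : ∀ T : Submodule ℝ E, (∀ i, X i ∈ T) → (∀ i, ∀ y ∈ T, 𝔤.nil (X i) y ∈ T) → T = ⊤)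
    {H : Type*} [Mul H] [One H] {e : E → H} (he : e 0 = 1) {r : ℝ} (hr : 0 < r)
    (hlaw : ∀ x y, ‖x‖ < r → ‖y‖ < r → e x * e y = e (bch 𝔤.bracket x y)) :
    ∃ (M : ℕ) (g : Fin M → Fin p), Function.Surjective g ∧
      (∀ᶠ x in 𝓝 (0 : E), ∃ t, e x = wordProd e (fun i => X (g i)) t) ∧
      (∀ᶠ y in 𝓝 (0 : E), ∃ t, y = wordFold (bch 𝔤.nil) (fun i => X (g i)) t) ∧
      ∃ C : ℝ, 1 < C ∧ ∃ ε₀ : ℝ, 0 < ε₀ ∧ ∀ ε : ℝ, 0 < ε → ε < ε₀ →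
        (∀ t : Fin M → ℝ, ∑ i, |t i| < ε → ∃ s : Fin M → ℝ, ∑ i, |s i| < C * ε ∧
          e (wordFold (bch 𝔤.nil) (fun i => X (g i)) t) = wordProd e (fun i => X (g i)) s) ∧
        ∀ t : Fin M → ℝ, ∑ i, |t i| < C * ε → ∃ s : Fin M → ℝ, ∑ i, |s i| < C ^ 2 * ε ∧
          wordProd e (fun i => X (g i)) t = e (wordFold (bch 𝔤.nil) (fun i => X (g i)) s) := by
  obtain ⟨M, g, hg, ρ, hρ, σ, hσ, η, hη, C, hC, hopen, hcont⟩ := 𝔤.exists_word X hX hgen he hr hlaw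
  set Y : Fin M → E := fun i => X (g i)
  have hY : ∀ i, 𝔤.proj 1 (Y i) = Y i := fun i => hX _
  have hnil : ∀ t, 𝔤.wordMap Y (0, t) = wordFold (bch 𝔤.nil) Y t := fun t => rfl
  have hη0 : |(0 : ℝ)| < η := by rwa [abs_zero]
  have hK : 1 < C / σ + 2 := by have : 0 < C / σ := by positivity
                                linarith
  -- Enlarging a word of cost < δ to cost < σ and shrinking its replacement of cost < C back gives
  -- cost below (C/σ) δ. The summand 2 ensures K > 1.
  set K := C / σ + 2 with hKdef
  have hcost : ∀ (δ : ℝ) (s : Fin M → ℝ), 0 < δ → ∑ i, |s i| < C →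
      ∑ i, |((δ / σ) • s) i| < K * δ := by
    intro δ s hδ hs
    rw [sum_abs_smul, abs_of_pos (by positivity)]
    calc δ / σ * ∑ i, |s i| < δ / σ * C := by gcongr
      _ = C / σ * δ := by ring
      _ ≤ K * δ := by rw [hKdef]; nlinarith
  have hscale : ∀ (δ : ℝ) (t : Fin M → ℝ), 0 < δ → ∑ i, |t i| < δ →
      ∑ i, |((δ / σ)⁻¹ • t) i| < σ := by
    intro δ t hδ ht
    rw [sum_abs_smul, abs_of_pos (by positivity), inv_mul_lt_iff₀ (by positivity),
      div_mul_cancel₀ _ hσ.ne']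
    exact ht
  -- This ε₀ puts both scales used below, ε/σ and Kε/σ, under η.
  refine ⟨M, g, hg, ?_, ?_, K, hK, σ * η / K, by positivity, fun ε hε hε₀ => ?_⟩
  · have hδ : η / 2 ≠ 0 := by positivity
    have h1 : Tendsto (𝔤.dilation (η / 2)⁻¹) (𝓝 0) (𝓝 0) := by
      simpa using (𝔤.dilation (η / 2)⁻¹).continuous.tendsto 0
    filter_upwards [h1.eventually (Metric.ball_mem_nhds _ hρ)] with x hx
    obtain ⟨s, -, -, hs⟩ := hopen (η / 2) _ (by rw [abs_of_pos (by positivity)]; linarith)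
      (mem_ball_zero_iff.1 hx)
    refine ⟨_, (?_ : _ = _).trans (hs hδ).symm⟩
    rw [𝔤.dilation_dilation, mul_inv_cancel₀ hδ, 𝔤.dilation_one]
  · filter_upwards [Metric.ball_mem_nhds _ hρ] with y hy
    obtain ⟨s, -, hs, -⟩ := hopen 0 y hη0 (mem_ball_zero_iff.1 hy)
    exact ⟨s, hs.symm⟩
  · have hε1 : K * ε < σ * η := by
      rw [lt_div_iff₀ (by positivity)] at hε₀
      linarith
    have hε2 : ε < σ * η := by nlinarith
    have hKε : 0 < K * ε := by positivity
    have hη1 : ∀ δ, 0 < δ → δ < σ * η → |δ / σ| < η := by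
      intro δ hδ h
      rw [abs_of_pos (by positivity), div_lt_iff₀ hσ]
      linarith
    constructor
    · intro t ht
      have hne : ε / σ ≠ 0 := by positivity
      obtain ⟨h1, -⟩ := hcont 0 _ hη0 (hscale ε t hε ht)
      -- The enlarged word is evaluated in N, at parameter 0, and its value is reached again at
      -- parameter ε/σ, which corresponds to G.
      obtain ⟨s, h2, -, h4⟩ := hopen (ε / σ) _ (hη1 _ hε hε2) h1
      refine ⟨_, hcost ε s hε h2, ?_⟩
      rw [h4 hne, hnil, ← 𝔤.wordFold_nil_smul Y hY hne, smul_inv_smul₀ hne]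
    · intro t ht
      have hne : K * ε / σ ≠ 0 := by positivity
      obtain ⟨h1, h2⟩ := hcont (K * ε / σ) _ (hη1 _ hKε hε1) (hscale _ t hKε ht)
      -- Here the roles are exchanged: the value is computed at the parameter of G and reached again
      -- at parameter 0. Starting from cost Kε yields K · Kε.
      obtain ⟨s, h3, h4, -⟩ := hopen 0 _ hη0 h1
      refine ⟨_, (hcost _ s hKε h3).trans_eq (by ring), ?_⟩
      rw [𝔤.wordFold_nil_smul Y hY hne, ← hnil, h4, ← h2 hne, smul_inv_smul₀ hne]

end GradedBracket


/-! ### Left-invariant vector fields and the exponential map of a Lie group. -/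

section LieGroup

variable {E : Type*} [NormedAddCommGroup E] [NormedSpace ℝ E] [FiniteDimensional ℝ E]
  [CompleteSpace E]
  {G : Type*} [TopologicalSpace G] [ChartedSpace E G] [Group G] [LieGroup 𝓘(ℝ, E) ∞ G]

theorem contMDiff_mulInvariantVectorField_two (v : GroupLieAlgebra 𝓘(ℝ, E) G) :
    ContMDiff 𝓘(ℝ, E) (𝓘(ℝ, E).prod 𝓘(ℝ, E)) 2
      (fun g : G => (⟨g, mulInvariantVectorField v g⟩ : TangentBundle 𝓘(ℝ, E) G)) := 
  (contMDiff_mulInvariantVectorField (I := 𝓘(ℝ, E)) v).of_le le_minSmoothness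

theorem contMDiff_mulInvariantVectorField_one (v : GroupLieAlgebra 𝓘(ℝ, E) G) :
    ContMDiff 𝓘(ℝ, E) (𝓘(ℝ, E).prod 𝓘(ℝ, E)) 1
      (fun g : G => (⟨g, mulInvariantVectorField v g⟩ : TangentBundle 𝓘(ℝ, E) G)) :=
  (contMDiff_mulInvariantVectorField_two v).of_le (by norm_num)

theorem mdifferentiableAt_mul_left (a b : G) :
    MDifferentiableAt 𝓘(ℝ, E) 𝓘(ℝ, E) (fun x : G => a * x) b :=
  (contMDiff_mul_left (I := 𝓘(ℝ, E)) (n := ∞)).contMDiffAt.mdifferentiableAt (by simp)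

theorem mfderiv_mul_left_mulInvariantVectorField (v : GroupLieAlgebra 𝓘(ℝ, E) G) (a b : G) :
    mfderiv 𝓘(ℝ, E) 𝓘(ℝ, E) (fun x : G => a * x) b (mulInvariantVectorField v b) =
      mulInvariantVectorField (I := 𝓘(ℝ, E)) v (a * b) := by
  have h1 : (fun x : G => a * b * x) = (fun x => a * x) ∘ fun x => b * x := by
    ext x; simp [mul_assoc]
  have h2 := mfderiv_comp (I' := 𝓘(ℝ, E)) (1 : G) (f := fun x : G => b * x)
    (g := fun x : G => a * x) (mdifferentiableAt_mul_left a (b * 1))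
    (mdifferentiableAt_mul_left b 1)
  have key : ∀ c : G, c = b * 1 →
      (mfderiv 𝓘(ℝ, E) 𝓘(ℝ, E) (fun x : G => a * x) c : E →L[ℝ] E)
        ((mfderiv 𝓘(ℝ, E) 𝓘(ℝ, E) (fun x : G => b * x) 1 : E →L[ℝ] E) v) =
      (mfderiv 𝓘(ℝ, E) 𝓘(ℝ, E) (fun x : G => a * b * x) 1 : E →L[ℝ] E) v := by
    rintro c rfl
    rw [h1]
    exact (congrArg (fun f : E →L[ℝ] E => f v) h2).symm
  exact key b (mul_one b).symm

theorem mulInvariantVectorField_one (v : GroupLieAlgebra 𝓘(ℝ, E) G) :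
    mulInvariantVectorField (I := 𝓘(ℝ, E)) v (1 : G) = v := by
  have h1 : (fun x : G => 1 * x) = id := by ext x; simp
  rw [mulInvariantVectorField, h1, mfderiv_id]
  rfl

theorem isMIntegralCurveOn_mul_left {v : GroupLieAlgebra 𝓘(ℝ, E) G} {γ : ℝ → G} {s : Set ℝ}
    (hγ : IsMIntegralCurveOn (I := 𝓘(ℝ, E)) γ (mulInvariantVectorField v) s) (a : G) :
    IsMIntegralCurveOn (I := 𝓘(ℝ, E)) (fun t => a * γ t) (mulInvariantVectorField v) s := by
  intro t ht
  refine ((mdifferentiableAt_mul_left a (γ t)).hasMFDerivAt.comp_hasMFDerivWithinAt t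
    (hγ t ht)).congr_mfderiv ?_
  have h := mfderiv_mul_left_mulInvariantVectorField v a (γ t)
  refine ContinuousLinearMap.ext fun (r : ℝ) => ?_
  change (mfderiv 𝓘(ℝ, E) 𝓘(ℝ, E) (fun x : G => a * x) (γ t))
    (r • mulInvariantVectorField v (γ t)) = r • mulInvariantVectorField v (a * γ t)
  rw [map_smul, h]

variable [T2Space G]

/-- Left translates of a local integral curve at the identity give integral curves through every
point with the same existence time, which forces completeness. -/
theorem exists_isMIntegralCurve (v : GroupLieAlgebra 𝓘(ℝ, E) G) :
    ∃ γ : ℝ → G, γ 0 = 1 ∧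
      IsMIntegralCurve (I := 𝓘(ℝ, E)) γ (mulInvariantVectorField (I := 𝓘(ℝ, E)) v) := by
  obtain ⟨γ, h0, hγ⟩ := exists_isMIntegralCurveAt_of_contMDiffAt_boundaryless (t₀ := 0)
    (contMDiff_mulInvariantVectorField_one v).contMDiffAt (x₀ := (1 : G))
  obtain ⟨ε, hε, hγ⟩ := isMIntegralCurveAt_iff'.1 hγ
  refine exists_isMIntegralCurve_of_isMIntegralCurveOn (contMDiff_mulInvariantVectorField_one v)
    hε (fun x => ⟨fun t => x * γ t, by simp [h0], ?_⟩) 1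
  rw [Real.ball_eq_Ioo, zero_sub, zero_add] at hγ
  exact isMIntegralCurveOn_mul_left hγ x

theorem lieExp_eq_of_isMIntegralCurve {v : GroupLieAlgebra 𝓘(ℝ, E) G} {γ : ℝ → G} (h0 : γ 0 = 1)
    (hγ : IsMIntegralCurve (I := 𝓘(ℝ, E)) γ (mulInvariantVectorField v)) :
    lieExp v = γ 1 := by
  have h : ∃ γ : ℝ → G, γ 0 = 1 ∧
      IsMIntegralCurve (I := 𝓘(ℝ, E)) γ (mulInvariantVectorField (I := 𝓘(ℝ, E)) v) := ⟨γ, h0, hγ⟩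
  rw [lieExp, dif_pos h]
  have := isMIntegralCurve_Ioo_eq_of_contMDiff_boundaryless (t₀ := 0)
    (contMDiff_mulInvariantVectorField_one v) h.choose_spec.2 hγ (h.choose_spec.1.trans h0.symm)
  exact congrFun this 1

/-- If γ is the curve for v, then t ↦ γ(st) is the curve for sv, so the exponential of sv is γ(s).
-/
theorem isMIntegralCurve_lieExp (v : GroupLieAlgebra 𝓘(ℝ, E) G) :
    IsMIntegralCurve (I := 𝓘(ℝ, E)) (fun s : ℝ => (lieExp (s • v) : G))
      (mulInvariantVectorField v) := by
  obtain ⟨γ, h0, hγ⟩ := exists_isMIntegralCurve v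
  have : (fun s : ℝ => (lieExp (s • v) : G)) = γ := by
    ext s
    have h1 := hγ.comp_mul s
    rw [← mulInvariantVectorField_smul] at h1
    rw [lieExp_eq_of_isMIntegralCurve (by simp [h0]) h1]
    simp
  rwa [this]

theorem lieExp_zero : (lieExp (0 : GroupLieAlgebra 𝓘(ℝ, E) G) : G) = 1 := by
  obtain ⟨γ, h0, hγ⟩ := exists_isMIntegralCurve (0 : GroupLieAlgebra 𝓘(ℝ, E) G)
  have h1 := hγ.comp_mul 0
  rw [← mulInvariantVectorField_smul, smul_zero] at h1
  rw [lieExp_eq_of_isMIntegralCurve (by simp [h0]) h1]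
  simp [h0]

/-- Two integral curves of a left-invariant field on `(-2, 2)` agree if they agree at `0`. -/
theorem eqOn_of_isMIntegralCurveOn {v : GroupLieAlgebra 𝓘(ℝ, E) G} {γ γ' : ℝ → G}
    (hγ : IsMIntegralCurveOn (I := 𝓘(ℝ, E)) γ (mulInvariantVectorField v) (Ioo (-2) 2))
    (hγ' : IsMIntegralCurveOn (I := 𝓘(ℝ, E)) γ' (mulInvariantVectorField v) (Ioo (-2) 2))
    (h : γ 0 = γ' 0) : EqOn γ γ' (Ioo (-2) 2) := by
  exact isMIntegralCurveOn_Ioo_eqOn_of_contMDiff_boundaryless (by norm_num)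
    (contMDiff_mulInvariantVectorField_one v) hγ hγ' h

end LieGroup


/-! ### The left-invariant frame in the chart at the identity. -/

section Chart

variable {E : Type*} [NormedAddCommGroup E] [NormedSpace ℝ E] [FiniteDimensional ℝ E]
  [CompleteSpace E]
  (G : Type*) [TopologicalSpace G] [ChartedSpace E G] [Group G] [LieGroup 𝓘(ℝ, E) ∞ G]

/-- The left-invariant frame in the chart at the identity: `leftFrame G x v` is the left-invariant
vector field with value `v` at the identity, evaluated at the point with coordinates `x`. -/
def leftFrame (x : E) : E →L[ℝ] E :=
  (tangentCoordChange 𝓘(ℝ, E) ((extChartAt 𝓘(ℝ, E) (1 : G)).symm x) 1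
    ((extChartAt 𝓘(ℝ, E) (1 : G)).symm x)) ∘L
    (mfderiv 𝓘(ℝ, E) 𝓘(ℝ, E)
      (fun h : G => (extChartAt 𝓘(ℝ, E) (1 : G)).symm x * h) 1 : E →L[ℝ] E)

theorem leftFrame_apply (x v : E) :
    leftFrame G x v = tangentCoordChange 𝓘(ℝ, E) ((extChartAt 𝓘(ℝ, E) (1 : G)).symm x) 1
      ((extChartAt 𝓘(ℝ, E) (1 : G)).symm x)
      (mulInvariantVectorField (I := 𝓘(ℝ, E)) (G := G) v
        ((extChartAt 𝓘(ℝ, E) (1 : G)).symm x)) := rfl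

theorem leftFrame_chart_one (v : E) : leftFrame G (extChartAt 𝓘(ℝ, E) (1 : G) 1) v = v := by
  have h1 : (extChartAt 𝓘(ℝ, E) (1 : G)).symm (extChartAt 𝓘(ℝ, E) (1 : G) 1) = 1 := by simp
  rw [leftFrame_apply, h1]
  exact (tangentCoordChange_self (I := 𝓘(ℝ, E)) (mem_extChartAt_source (1 : G))).trans
    (mulInvariantVectorField_one (G := G) v)

theorem contDiffAt_clm_of_apply {F F' : Type*} [NormedAddCommGroup F] [NormedSpace ℝ F]
    [NormedAddCommGroup F'] [NormedSpace ℝ F'] {f : F → E →L[ℝ] F'} {x : F} {n : ℕ∞ω}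
    (h : ∀ v, ContDiffAt ℝ n (fun y => f y v) x) : ContDiffAt ℝ n f x := by
  let b := Module.finBasis ℝ E
  let c : Fin (Module.finrank ℝ E) → E →L[ℝ] ℝ := fun i => (b.coord i).toContinuousLinearMap
  have h1 : f = fun y => ∑ i, ContinuousLinearMap.smulRightL ℝ E F' (c i) (f y (b i)) := by
    ext y v
    simp only [sum_apply]
    conv_lhs => rw [← b.sum_repr v, map_sum]
    simp [c]
  rw [h1]
  exact ContDiffAt.sum fun i _ =>
    (ContinuousLinearMap.smulRightL ℝ E F' (c i)).contDiff.contDiffAt.comp x (h (b i))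

/-- Two derivatives are needed because `hasFDerivAt_of_maurerCartan` asks for a locally Lipschitz
derivative of the frame. In finite dimension it suffices to test the frame on fixed vectors. -/
theorem contDiffAt_leftFrame : ContDiffAt ℝ 2 (leftFrame G) (extChartAt 𝓘(ℝ, E) (1 : G) 1) := by
  refine contDiffAt_clm_of_apply fun v => ?_
  have hv := (contMDiff_mulInvariantVectorField_two (G := G) v).contMDiffAt (x := 1)
  rw [contMDiffAt_iff] at hv
  exact (hv.2.contDiffAt (by simp)).snd

variable {G}

/-- A solution of the left-invariant equation in the chart is an integral curve. -/
theorem isMIntegralCurveOn_of_hasDerivAt {v : E} {α : ℝ → E} {s : Set ℝ}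
    (hα : ∀ t ∈ s, α t ∈ (extChartAt 𝓘(ℝ, E) (1 : G)).target ∧
      HasDerivAt α (leftFrame G (α t) v) t) :
    IsMIntegralCurveOn (I := 𝓘(ℝ, E)) (fun t => (extChartAt 𝓘(ℝ, E) (1 : G)).symm (α t))
      (mulInvariantVectorField (I := 𝓘(ℝ, E)) (G := G) v) s := by
  intro t ht
  obtain ⟨hmem, hder⟩ := hα t ht
  rw [leftFrame_apply] at hder
  set φ := extChartAt 𝓘(ℝ, E) (1 : G) with hφ
  set g : G := φ.symm (α t) with hg
  have hg1 : g ∈ φ.source := φ.map_target hmem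
  have hg2 : g ∈ (extChartAt 𝓘(ℝ, E) g).source := mem_extChartAt_source g
  have hw : ∀ w : E, tangentCoordChange 𝓘(ℝ, E) 1 g g (tangentCoordChange 𝓘(ℝ, E) g 1 g w) = w :=
    fun w => (tangentCoordChange_comp (x := (1 : G)) ⟨⟨hg2, hg1⟩, hg2⟩).trans
      (tangentCoordChange_self hg2)
  have hD : HasFDerivAt (extChartAt 𝓘(ℝ, E) g ∘ φ.symm) (tangentCoordChange 𝓘(ℝ, E) 1 g g)
      (α t) := by
    have := hasFDerivWithinAt_tangentCoordChange (I := 𝓘(ℝ, E)) (x := (1 : G)) (y := g) (z := g)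
      ⟨hg1, hg2⟩
    rw [← hφ, hg, φ.right_inv hmem] at this
    simpa using this
  have key : HasDerivAt ((extChartAt 𝓘(ℝ, E) g ∘ φ.symm) ∘ α)
      (mulInvariantVectorField (I := 𝓘(ℝ, E)) (G := G) v g : E) t :=
    (hD.comp_hasDerivAt t hder).congr_deriv (hw _)
  have key' : HasFDerivWithinAt ((extChartAt 𝓘(ℝ, E) g ∘ φ.symm) ∘ α)
      ((1 : ℝ →L[ℝ] ℝ).smulRight (mulInvariantVectorField (I := 𝓘(ℝ, E)) (G := G) v g : E))
      univ t := by
    refine key.hasFDerivAt.hasFDerivWithinAt.congr_fderiv ?_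
    exact ContinuousLinearMap.ext fun r => rfl
  apply HasMFDerivAt.hasMFDerivWithinAt
  refine ⟨(continuousAt_extChartAt_symm'' hmem).comp hder.continuousAt, ?_⟩
  have hr : range 𝓘(ℝ, ℝ) = univ := by simp
  rw [hr]
  exact key'

end Chart


/-! ### Maurer-Cartan equation and Baker-Campbell-Hausdorff formula on the Lie group. -/

section MaurerCartan

variable {E : Type*} [NormedAddCommGroup E] [NormedSpace ℝ E] [FiniteDimensional ℝ E]
  [CompleteSpace E]
  (G : Type*) [TopologicalSpace G] [ChartedSpace E G] [Group G] [LieGroup 𝓘(ℝ, E) ∞ G]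

variable (E) in
/-- The Lie algebra of a Lie group is, as a vector space, the model space. -/
def lieEquiv : GroupLieAlgebra 𝓘(ℝ, E) G ≃L[ℝ] E where
  toFun v := v
  invFun v := v
  map_add' _ _ := rfl
  map_smul' _ _ := rfl
  left_inv _ := rfl
  right_inv _ := rfl
  continuous_toFun := continuous_id (X := E)
  continuous_invFun := continuous_id (X := E)

theorem leftFrame_eq_mpullback {x : E} (hx : x ∈ (extChartAt 𝓘(ℝ, E) (1 : G)).target) (v : E) :
    leftFrame G x v = VectorField.mpullback 𝓘(ℝ, E) 𝓘(ℝ, E) (extChartAt 𝓘(ℝ, E) (1 : G)).symm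
      (mulInvariantVectorField (I := 𝓘(ℝ, E)) (G := G) v) x := by
  have h1 := mfderiv_extChartAt_comp_mfderivWithin_extChartAt_symm (I := 𝓘(ℝ, E)) hx
  have h2 := mfderivWithin_extChartAt_symm_comp_mfderiv_extChartAt (I := 𝓘(ℝ, E)) hx
  have hr : range 𝓘(ℝ, E) = univ := by simp
  rw [hr, mfderivWithin_univ] at h1 h2
  have hsrc : (extChartAt 𝓘(ℝ, E) (1 : G)).symm x ∈ (chartAt E (1 : G)).source := by
    rw [← extChartAt_source 𝓘(ℝ, E)]
    exact (extChartAt 𝓘(ℝ, E) (1 : G)).map_target hx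
  have h3 := (hasMFDerivAt_extChartAt (I := 𝓘(ℝ, E)) hsrc).mfderiv
  have h4 := mfderiv_chartAt_eq_tangentCoordChange (I := 𝓘(ℝ, E)) hsrc
  rw [VectorField.mpullback, ContinuousLinearMap.inverse_eq h2 h1, leftFrame_apply, h3, h4]
  rfl

/-- Brackets of vector fields commute with pullback by the chart, and the bracket of left-invariant
fields is left-invariant. Expanded in coordinates, this is the Maurer-Cartan equation of the frame.
-/
theorem lieBracket_leftFrame {x : E} (hx : x ∈ (extChartAt 𝓘(ℝ, E) (1 : G)).target) 
    (v w : E) :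
    VectorField.lieBracket ℝ (fun y => leftFrame G y v) (fun y => leftFrame G y w) x =
      leftFrame G x (lieEquiv E G ⁅(lieEquiv E G).symm v, (lieEquiv E G).symm w⁆) := by
  have hopen : (extChartAt 𝓘(ℝ, E) (1 : G)).target ∈ 𝓝 x :=
    (isOpen_extChartAt_target (1 : G)).mem_nhds hx
  have heq : ∀ v : E, (fun y => leftFrame G y v) =ᶠ[𝓝 x]
      VectorField.mpullback 𝓘(ℝ, E) 𝓘(ℝ, E) (extChartAt 𝓘(ℝ, E) (1 : G)).symm
        (mulInvariantVectorField (I := 𝓘(ℝ, E)) (G := G) v) := fun v => by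
    filter_upwards [hopen] with y hy
    exact leftFrame_eq_mpullback G hy v
  have h1 := VectorField.mpullback_mlieBracket (I := 𝓘(ℝ, E)) (I' := 𝓘(ℝ, E)) (n := minSmoothness ℝ 3)
    (f := (extChartAt 𝓘(ℝ, E) (1 : G)).symm) (x₀ := x)
    (V := mulInvariantVectorField (I := 𝓘(ℝ, E)) (G := G) v)
    (W := mulInvariantVectorField (I := 𝓘(ℝ, E)) (G := G) w)
    (mdifferentiableAt_mulInvariantVectorField _) (mdifferentiableAt_mulInvariantVectorField _)
    ((contMDiffOn_extChartAt_symm (1 : G)).contMDiffAt hopen)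
    (minSmoothness_monotone (by norm_cast))
  rw [(heq v).lieBracket_vectorField_eq (heq w), leftFrame_eq_mpullback G hx]
  have h2 := mulInvariantVector_mlieBracket (I := 𝓘(ℝ, E)) (G := G) v w
  erw [← h2] at h1
  have h3 : ∀ V W : (y : E) → TangentSpace 𝓘(ℝ, E) y,
      VectorField.mlieBracket 𝓘(ℝ, E) V W x = VectorField.lieBracket ℝ V W x := fun V W => by
    rw [← VectorField.mlieBracketWithin_univ, VectorField.mlieBracketWithin_eq_lieBracketWithin]
    exact congrFun (VectorField.lieBracketWithin_univ (V := V) (W := W)) x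
  exact (h1.trans (h3 _ _)).symm

/-- The exponential map, as a map on the model space. -/
def expModel (v : E) : G := lieExp ((lieEquiv E G).symm v)

/-- The exponential map in the chart at the identity. -/
def expChart (v : E) : E := extChartAt 𝓘(ℝ, E) (1 : G) (expModel G v)

variable [T2Space G]

theorem expModel_zero : expModel G (0 : E) = 1 := lieExp_zero

theorem isMIntegralCurve_expModel (v : E) :
    IsMIntegralCurve (I := 𝓘(ℝ, E)) (fun s : ℝ => expModel G (s • v))
      (mulInvariantVectorField (I := 𝓘(ℝ, E)) (G := G) v) :=
  isMIntegralCurve_lieExp (G := G) ((lieEquiv E G).symm v)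

theorem expChart_zero : expChart G (0 : E) = extChartAt 𝓘(ℝ, E) (1 : G) 1 := by
  rw [expChart, expModel_zero]

/-- The differential of the exponential map in the chart at the identity. -/
theorem exists_hasFDerivAt_expChart {B : E →L[ℝ] E →L[ℝ] E}
    (hB : ∀ v w, B v w = lieEquiv E G ⁅(lieEquiv E G).symm v, (lieEquiv E G).symm w⁆) :
    ∃ r > 0, ∀ v : E, ‖v‖ < r → expModel G v ∈ (extChartAt 𝓘(ℝ, E) (1 : G)).source ∧
      HasFDerivAt (expChart G) (leftFrame G (expChart G v) ∘L dexpFactor (B v)) v := by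
  set φ := extChartAt 𝓘(ℝ, E) (1 : G) with hφ
  set x₀ : E := φ 1 with hx₀
  have hC2 : ContDiffAt ℝ 2 (leftFrame G) x₀ := contDiffAt_leftFrame G
  have hC1 : ContDiffAt ℝ 1 (fderiv ℝ (leftFrame G)) x₀ := hC2.fderiv_right (by norm_num)
  obtain ⟨K, s, hs, hKs⟩ := hC1.exists_lipschitzOnWith
  have hbd : ∀ᶠ x in 𝓝 x₀, ‖fderiv ℝ (leftFrame G) x‖ < ‖fderiv ℝ (leftFrame G) x₀‖ + 1 :=
    hC1.continuousAt.norm.eventually_lt continuousAt_const (by simp)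
  have htarget : ∀ᶠ x in 𝓝 x₀, x ∈ φ.target := extChartAt_target_mem_nhds (I := 𝓘(ℝ, E)) (1 : G)
  obtain ⟨R, hR, hball⟩ := Metric.eventually_nhds_iff_ball.1
    ((hC2.eventually (by simp)).and (hbd.and (htarget.and hs)))
  obtain ⟨r, hr, hsol⟩ := exists_solution_mem_ball (hC2.of_le (by norm_num)) hR
  have hcurve : ∀ v : E, ‖v‖ < r → ∀ t ∈ Ioo (-2 : ℝ) 2, expModel G (t • v) ∈ φ.source ∧
      expChart G (t • v) ∈ Metric.ball x₀ R ∧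
      HasDerivAt (fun s : ℝ => expChart G (s • v)) (leftFrame G (expChart G (t • v)) v) t := by
    intro v hv
    obtain ⟨α, hα0, -, hα⟩ := hsol x₀ (Metric.mem_ball_self hr) v hv
    have hint := isMIntegralCurveOn_of_hasDerivAt (G := G) (v := v) (α := α) (s := Ioo (-2) 2)
      fun t ht => ⟨(hball _ (hα t ht).1).2.2.1, (hα t ht).2⟩
    -- Uniqueness of integral curves identifies the solution in the chart with s ↦ exp(sv), which
    -- confines the latter to the ball where the frame is controlled.
    have heq := eqOn_of_isMIntegralCurveOn
      ((isMIntegralCurve_expModel G v).isMIntegralCurveOn (Ioo (-2) 2)) hint (by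
        simp only [zero_smul]
        rw [expModel_zero, hα0, ← hφ, hx₀, φ.left_inv (mem_extChartAt_source (1 : G))])
    have heq' : ∀ t ∈ Ioo (-2 : ℝ) 2, expChart G (t • v) = α t := fun t ht => by
      have h1 : expModel G (t • v) = φ.symm (α t) := heq ht
      rw [expChart, h1, ← hφ, φ.right_inv (hball _ (hα t ht).1).2.2.1]
    intro t ht
    refine ⟨?_, ?_, ?_⟩
    · have h1 : expModel G (t • v) = φ.symm (α t) := heq ht
      rw [h1]
      exact φ.map_target (hball _ (hα t ht).1).2.2.1
    · rw [heq' t ht]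
      exact (hα t ht).1
    · rw [heq' t ht]
      refine (hα t ht).2.congr_of_eventuallyEq ?_
      filter_upwards [isOpen_Ioo.mem_nhds ht] with s hs using heq' s hs
  have hIcc : ∀ t ∈ Icc (0 : ℝ) 1, t ∈ Ioo (-2 : ℝ) 2 := fun t ht =>
    ⟨by linarith [ht.1], by linarith [ht.2]⟩
  refine ⟨r, hr, fun v hv => ⟨?_, ?_⟩⟩
  · simpa using (hcurve v hv 1 (by norm_num)).1
  · have hderiv : ∀ x ∈ Metric.ball x₀ R, HasFDerivAt (leftFrame G) (fderiv ℝ (leftFrame G) x) x :=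
      fun x hx => ((hball x hx).1.differentiableAt (by simp)).hasFDerivAt
    have hK1 : ‖fderiv ℝ (leftFrame G) x₀‖ + 1 ≤
        ((max K (‖fderiv ℝ (leftFrame G) x₀‖₊ + 1) : NNReal) : ℝ) := by
      rw [NNReal.coe_max]
      exact le_max_of_le_right (by simp)
    refine hasFDerivAt_of_maurerCartan (B := B) (L := leftFrame G)
      (K := max K (‖fderiv ℝ (leftFrame G) x₀‖₊ + 1)) Metric.isOpen_ball
      (convex_ball x₀ R) hderiv ?_ ?_ ?_ (V := Metric.ball 0 r) Metric.isOpen_ball ?_ ?_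
      (mem_ball_zero_iff.2 hv)
    · exact (hKs.mono fun x hx => (hball x hx).2.2.2).weaken (le_max_left _ _)
    · exact fun x hx => (hball x hx).2.1.le.trans hK1
    · intro x hx v w
      have h1 := lieBracket_leftFrame G (hball x hx).2.2.1 v w
      have h2 : ∀ w : E, fderiv ℝ (fun y => leftFrame G y w) x =
          (fderiv ℝ (leftFrame G) x).flip w := fun w => by
        have := ((hderiv x hx).clm_apply (hasFDerivAt_const w x)).fderiv
        rw [this]
        ext; simp
      rw [VectorField.lieBracket, h2, h2] at h1
      rw [hB]
      exact h1
    · exact fun v hv t ht => (hcurve v (mem_ball_zero_iff.1 hv) t (hIcc t ht)).2.2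
    · exact fun v hv t ht => (hcurve v (mem_ball_zero_iff.1 hv) t (hIcc t ht)).2.1

/-- The exponential map is a local homomorphism for the Baker-Campbell-Hausdorff product. -/
theorem exists_expModel_mul {B : E →L[ℝ] E →L[ℝ] E}
    (hB : ∀ v w, B v w = lieEquiv E G ⁅(lieEquiv E G).symm v, (lieEquiv E G).symm w⁆)
    (hrep : IsRep B B) :
    ∃ r > 0, ∀ x y : E, ‖x‖ < r → ‖y‖ < r →
      expModel G x * expModel G y = expModel G (bch B x y) := by
  obtain ⟨R, hR, hexp⟩ := exists_hasFDerivAt_expChart G hB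
  obtain ⟨r, hr, hcurve⟩ := exists_bch_curve hrep hR
  refine ⟨r, hr, fun x y hx hy => ?_⟩
  obtain ⟨w, hw0, hw1, hw⟩ := hcurve x y hx hy
  set φ := extChartAt 𝓘(ℝ, E) (1 : G) with hφ
  have hint := isMIntegralCurveOn_of_hasDerivAt (G := G) (v := y)
    (α := fun t => expChart G (w t)) (s := Ioo (-2) 2) fun t ht => by
      obtain ⟨hwt, w', hw', hw''⟩ := hw t ht
      refine ⟨φ.map_source (hexp _ hwt).1, ?_⟩
      refine ((hexp _ hwt).2.comp_hasDerivAt t hw').congr_deriv ?_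
      rw [ContinuousLinearMap.comp_apply, hw'']
  have hsymm : ∀ t ∈ Ioo (-2 : ℝ) 2, φ.symm (expChart G (w t)) = expModel G (w t) :=
    fun t ht => φ.left_inv (hexp _ (hw t ht).1).1
  -- Both exp(x) exp(ty) and exp(w(t)) are integral curves of the left-invariant field of y starting
  -- at exp(x).
  have h := eqOn_of_isMIntegralCurveOn
    (isMIntegralCurveOn_mul_left ((isMIntegralCurve_expModel G y).isMIntegralCurveOn (Ioo (-2) 2))
      (expModel G x)) hint (by
        have := hsymm 0 (by norm_num)
        simp only [zero_smul]
        rw [expModel_zero, mul_one, ← hφ, this, hw0])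
  have h1 := h (show (1 : ℝ) ∈ Ioo (-2 : ℝ) 2 by norm_num)
  have h2 := hsymm 1 (by norm_num)
  simp only [one_smul] at h1
  rw [h1, ← hφ, h2, hw1]

theorem continuous_dexpFactor {A : Type*} [NormedRing A] [NormedAlgebra ℝ A] [CompleteSpace A] :
    Continuous (dexpFactor : A → A) := by
  refine intervalIntegral.continuous_parametric_intervalIntegral_of_continuous' ?_ 0 1
  exact continuous_exp.comp (by fun_prop)

/-- The exponential map covers a neighbourhood of the identity. -/
theorem image_expModel_mem_nhds {B : E →L[ℝ] E →L[ℝ] E}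
    (hB : ∀ v w, B v w = lieEquiv E G ⁅(lieEquiv E G).symm v, (lieEquiv E G).symm w⁆)
    {S : Set E} (hS : S ∈ 𝓝 0) : expModel G '' S ∈ 𝓝 1 := by
  obtain ⟨r, hr, hexp⟩ := exists_hasFDerivAt_expChart G hB
  have hball : ∀ᶠ v : E in 𝓝 0, ‖v‖ < r := 
    continuous_norm.continuousAt.eventually_lt continuousAt_const (by rwa [norm_zero])
  have h0 := hexp 0 (by simpa using hr)
  have hd0 : dexpFactor (B 0) = 1 := by simp [dexpFactor]
  have hL0 : leftFrame G (expChart G 0) = ContinuousLinearMap.id ℝ E := by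
    ext v
    rw [expChart_zero, leftFrame_chart_one]
    rfl
  have hcont : ContinuousAt (fun v => leftFrame G (expChart G v) ∘L dexpFactor (B v)) 0 := by
    refine ContinuousAt.clm_comp ?_ (continuous_dexpFactor.comp B.continuous).continuousAt
    refine ContinuousAt.comp (f := expChart G) (g := leftFrame G) ?_ h0.2.continuousAt
    rw [expChart_zero]
    exact (contDiffAt_leftFrame G).continuousAt
  -- The derivative is continuous at 0 and is the identity there, so the exponential map is open at
  -- 0.
  have hstrict := hasStrictFDerivAt_of_hasFDerivAt_of_continuousAt
    (hball.mono fun v hv => (hexp v hv).2) hcont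
  have hmap := hstrict.map_nhds_eq_of_surj (by
    rw [hL0, hd0]
    exact LinearMap.range_eq_top.2 fun v => ⟨v, rfl⟩)
  have himg := image_mem_map (m := expChart G) (inter_mem hS hball)
  rw [hmap, expChart_zero] at himg
  have hpre := (continuousAt_extChartAt (I := 𝓘(ℝ, E)) (1 : G)).preimage_mem_nhds himg
  filter_upwards [hpre, extChartAt_source_mem_nhds (I := 𝓘(ℝ, E)) (1 : G)] with g hg hg'
  obtain ⟨v, ⟨hv, hv'⟩, hvg⟩ := hg
  exact ⟨v, hv, (extChartAt 𝓘(ℝ, E) (1 : G)).injOn (hexp v hv').1 hg' hvg⟩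

end MaurerCartan


/-! ### The bracket filtration and adapted decompositions. -/

section Filtration

variable {L : Type*} [LieRing L] [LieAlgebra ℝ L] {D : Submodule ℝ L}

theorem bracketFiltration_mono : Monotone (bracketFiltration D) := by
  refine monotone_nat_of_le_succ fun i => ?_
  cases i with
  | zero => exact bot_le
  | succ i => exact le_sup_left

theorem lie_mem_bracketFiltration_succ {i : ℕ} {x y : L} (hx : x ∈ D)
    (hy : y ∈ bracketFiltration D i) : ⁅x, y⁆ ∈ bracketFiltration D (i + 1) := by
  cases i with
  | zero =>
    rw [(Submodule.mem_bot ℝ).1 hy, lie_zero]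
    exact zero_mem _
  | succ i => exact Submodule.mem_sup_right (Submodule.subset_span ⟨x, hx, y, hy, rfl⟩)

/-- Induction on i: by the Jacobi identity, [[d, z], y] = [d, [z, y]] - [z, [d, y]], and in both
terms z has smaller degree. -/
theorem lie_mem_bracketFiltration_add (i : ℕ) {j : ℕ} {x y : L}
    (hx : x ∈ bracketFiltration D i) (hy : y ∈ bracketFiltration D j) :
    ⁅x, y⁆ ∈ bracketFiltration D (i + j) := by
  match i with
  | 0 =>
    rw [(Submodule.mem_bot ℝ).1 hx, zero_lie]
    exact zero_mem _
  | 1 =>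
    rw [add_comm]
    exact lie_mem_bracketFiltration_succ hx hy
  | i + 2 =>
    let T : Submodule ℝ L :=
      (bracketFiltration D (i + 2 + j)).comap (LieAlgebra.ad ℝ L y)
    have hT : ∀ z, z ∈ T ↔ ⁅z, y⁆ ∈ bracketFiltration D (i + 2 + j) := fun z => by
      rw [← lie_skew, neg_mem_iff]
      rfl
    suffices h : bracketFiltration D (i + 2) ≤ T from (hT x).1 (h hx)
    refine sup_le (fun z hz => ?_) (Submodule.span_le.2 ?_)
    · exact (hT z).2 (bracketFiltration_mono (by omega)
        (lie_mem_bracketFiltration_add (i + 1) hz hy))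
    · rintro _ ⟨d, hd, z, hz, rfl⟩
      rw [SetLike.mem_coe, hT, lie_lie]
      refine sub_mem ?_ ?_
      · have := lie_mem_bracketFiltration_succ hd (lie_mem_bracketFiltration_add (i + 1) hz hy)
        exact bracketFiltration_mono (by omega) this
      · have := lie_mem_bracketFiltration_add (i + 1) hz (lie_mem_bracketFiltration_succ hd hy)
        exact bracketFiltration_mono (by omega) this

variable {W : ℕ → Submodule ℝ L} [DirectSum.Decomposition W]

theorem gradedProj_mem (j : ℕ) (x : L) : gradedProj W j x ∈ W j :=
  (DirectSum.decompose W x j).2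

theorem gradedProj_of_mem {j : ℕ} {x : L} (hx : x ∈ W j) : gradedProj W j x = x :=
  DirectSum.decompose_of_mem_same W hx

theorem gradedProj_of_mem_of_ne {i j : ℕ} {x : L} (hx : x ∈ W i) (hij : i ≠ j) :
    gradedProj W j x = 0 :=
  DirectSum.decompose_of_mem_ne W hx hij

theorem le_bracketFiltration (hW : ∀ i : ℕ, (⨆ (j : ℕ) (_ : j ≤ i), W j) = bracketFiltration D i)
    (j : ℕ) : W j ≤ bracketFiltration D j := by
  rw [← hW]
  exact le_iSup₂_of_le j le_rfl le_rfl

theorem gradedProj_eq_zero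
    (hW : ∀ i : ℕ, (⨆ (j : ℕ) (_ : j ≤ i), W j) = bracketFiltration D i) {i j : ℕ}
    (hij : i < j) {x : L} (hx : x ∈ bracketFiltration D i) : gradedProj W j x = 0 := by
  rw [← hW] at hx
  have h : (⨆ (j : ℕ) (_ : j ≤ i), W j) ≤ LinearMap.ker (gradedProj W j) :=
    iSup₂_le fun k hk z hz => gradedProj_of_mem_of_ne hz (by omega)
  exact h hx

theorem sum_gradedProj
    (hW : ∀ i : ℕ, (⨆ (j : ℕ) (_ : j ≤ i), W j) = bracketFiltration D i) {m : ℕ}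
    (hm : bracketFiltration D m = ⊤) (x : L) :
    ∑ j ∈ Finset.range (m + 1), gradedProj W j x = x := by
  classical
  conv_rhs => rw [← DirectSum.sum_support_decompose W x]
  refine (Finset.sum_subset (fun j hj => ?_) fun j _ hj => ?_).symm
  · by_contra hj'
    rw [Finset.mem_range, not_lt] at hj'
    refine DFinsupp.mem_support_iff.1 hj (Subtype.ext ?_)
    exact gradedProj_eq_zero hW (Nat.lt_of_succ_le hj') (hm ▸ Submodule.mem_top)
  · rw [DFinsupp.notMem_support_iff] at hj
    exact congrArg Subtype.val hj

end Filtration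

/-! ### From the abstract Lie algebra to graded brackets on the model space. -/

section Transport

variable {E : Type*} [NormedAddCommGroup E] [NormedSpace ℝ E] [FiniteDimensional ℝ E]
  {L : Type*} [LieRing L] [LieAlgebra ℝ L] (ι : L ≃ₗ[ℝ] E)

/-- Transport of endomorphisms to bounded operators. -/
def transport : Module.End ℝ L ≃ₐ[ℝ] (E →L[ℝ] E) :=
  (ι.conjAlgEquiv ℝ).trans (Module.End.toContinuousLinearMap E)

theorem transport_apply (f : Module.End ℝ L) (x : E) : transport ι f x = ι (f (ι.symm x)) := rfl

/-- Transport of the Lie bracket. -/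
def transportBracket : E →L[ℝ] E →L[ℝ] E :=
  LinearMap.toContinuousLinearMap
    ((transport ι).toLinearMap ∘ₗ (LieAlgebra.ad ℝ L : L →ₗ[ℝ] Module.End ℝ L) ∘ₗ
      (ι.symm : E →ₗ[ℝ] L))

theorem transportBracket_apply (x y : E) :
    transportBracket ι x y = ι ⁅ι.symm x, ι.symm y⁆ := rfl

theorem isRep_transportBracket : IsRep (transportBracket ι) (transportBracket ι) := by
  intro x y
  ext z
  simp only [sub_apply, mul_apply_eq_comp, transportBracket_apply, LinearEquiv.symm_apply_apply,
    lie_lie, map_sub]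

variable {D : Submodule ℝ L} {m : ℕ} (hm : bracketFiltration D m = ⊤)
  {W : ℕ → Submodule ℝ L} [DirectSum.Decomposition W]
  (hW : ∀ i : ℕ, (⨆ (j : ℕ) (_ : j ≤ i), W j) = bracketFiltration D i)

/-- The graded bracket of a Lie algebra with an adapted decomposition. -/
def gradedBracket : GradedBracket E where
  step := m
  proj j := transport ι (gradedProj W j)
  bracket := transportBracket ι
  proj_proj_same i x := by
    simp only [transport_apply, LinearEquiv.symm_apply_apply]
    rw [gradedProj_of_mem (gradedProj_mem i _)]
  proj_proj_of_ne i j x hij := by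
    simp only [transport_apply, LinearEquiv.symm_apply_apply]
    rw [gradedProj_of_mem_of_ne (gradedProj_mem j _) hij.symm, map_zero]
  sum_proj x := by
    simp only [transport_apply]
    rw [← map_sum, sum_gradedProj hW hm, LinearEquiv.apply_symm_apply]
  proj_zero x := by
    have h := le_bracketFiltration hW 0 (gradedProj_mem 0 (ι.symm x))
    rw [transport_apply, (Submodule.mem_bot ℝ).1 h, map_zero]
  bracket_skew x y := by
    rw [transportBracket_apply, transportBracket_apply, ← lie_skew, map_neg]
  isRep_bracket := isRep_transportBracket ι
  proj_bracket i j k x y hi := by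
    simp only [transport_apply, transportBracket_apply, LinearEquiv.symm_apply_apply]
    rw [gradedProj_eq_zero hW hi, map_zero]
    exact lie_mem_bracketFiltration_add j (le_bracketFiltration hW j (gradedProj_mem _ _))
      (le_bracketFiltration hW k (gradedProj_mem _ _))

theorem gradedBracket_nil (x : E) :
    (gradedBracket ι hm hW).nil x = transport ι (nilAd W m (ι.symm x)) := by
  ext y
  rw [GradedBracket.nil_apply, transport_apply, nilAd]
  simp only [LinearMap.sum_apply, map_sum, LinearMap.comp_apply, gradedBracket, transport_apply,
    transportBracket_apply, LinearEquiv.symm_apply_apply, LieAlgebra.ad_apply]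

theorem gradedProj_one_of_mem
    (hW : ∀ i : ℕ, (⨆ (j : ℕ) (_ : j ≤ i), W j) = bracketFiltration D i) {x : L} (hx : x ∈ D) :
    gradedProj W 1 x = x := by
  have h : (⨆ (j : ℕ) (_ : j ≤ 1), W j) ≤ LinearMap.eqLocus (gradedProj W 1) LinearMap.id := by
    refine iSup₂_le fun k hk z hz => ?_
    rcases Nat.le_one_iff_eq_zero_or_eq_one.1 hk with rfl | rfl
    · have := le_bracketFiltration hW 0 hz
      rw [(Submodule.mem_bot ℝ).1 this]
      exact zero_mem _
    · exact gradedProj_of_mem hz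
  rw [hW] at h
  exact h hx

theorem nilAd_of_mem (hm : bracketFiltration D m = ⊤)
    (hW : ∀ i : ℕ, (⨆ (j : ℕ) (_ : j ≤ i), W j) = bracketFiltration D i) {j k : ℕ} {x y : L}
    (hx : x ∈ W j) (hy : y ∈ W k) : nilAd W m x y = gradedProj W (j + k) ⁅x, y⁆ := by
  have hzero : ∀ {i : ℕ} {z : L}, z ∈ W i → m < i → z = 0 := fun hz hi => by
    rw [← gradedProj_of_mem hz, gradedProj_eq_zero hW hi (hm ▸ Submodule.mem_top)]
  simp only [nilAd, LinearMap.sum_apply, LinearMap.comp_apply, LieAlgebra.ad_apply]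
  rw [Finset.sum_eq_single j, Finset.sum_eq_single k, gradedProj_of_mem hx, gradedProj_of_mem hy]
  · intro k' _ hk'
    rw [gradedProj_of_mem_of_ne hy hk'.symm, lie_zero, map_zero]
  · intro hk
    rw [Finset.mem_range, not_lt] at hk
    rw [hzero hy hk, map_zero, lie_zero, map_zero]
  · intro j' _ hj'
    refine Finset.sum_eq_zero fun k' _ => ?_
    rw [gradedProj_of_mem_of_ne hx hj'.symm, zero_lie, map_zero]
  · intro hj
    rw [Finset.mem_range, not_lt] at hj
    refine Finset.sum_eq_zero fun k' _ => ?_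
    rw [hzero hx hj, map_zero, zero_lie, map_zero]

/-- The first layer generates the nilpotentisation. -/
theorem eq_top_of_nilAd_mem (hm : bracketFiltration D m = ⊤)
    (hW : ∀ i : ℕ, (⨆ (j : ℕ) (_ : j ≤ i), W j) = bracketFiltration D i) {T : Submodule ℝ L}
    (hD : D ≤ T) (hT : ∀ x ∈ D, ∀ y ∈ T, nilAd W m x y ∈ T) : T = ⊤ := by
  have hlayer : ∀ i, W i ≤ T := by
    intro i
    induction i with
    | zero => exact (le_bracketFiltration hW 0).trans bot_le
    | succ i ih =>
      cases i with
      | zero => exact (le_bracketFiltration hW 1).trans hD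
      | succ i =>
        -- Only the top component of y contributes in degree i + 2, since the brackets of x with
        -- lower layers have degree at most i + 1. On the top component the projected bracket is the
        -- nilpotent one.
        have hlie : ∀ x ∈ D, ∀ y ∈ bracketFiltration D (i + 1),
            gradedProj W (i + 2) ⁅x, y⁆ ∈ T := by
          intro x hx y hy
          have h : (⨆ (j : ℕ) (_ : j ≤ i + 1), W j) ≤
              T.comap (gradedProj W (i + 2) ∘ₗ (LieAlgebra.ad ℝ L x : L →ₗ[ℝ] L)) := by
            refine iSup₂_le fun k hk z hz => ?_
            change gradedProj W (i + 2) ⁅x, z⁆ ∈ T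
            rcases hk.lt_or_eq with hk | rfl
            · rw [gradedProj_eq_zero hW (by omega : k + 1 < i + 2)
                (lie_mem_bracketFiltration_succ hx (le_bracketFiltration hW k hz))]
              exact zero_mem _
            · have hx1 : x ∈ W 1 := gradedProj_one_of_mem hW hx ▸ gradedProj_mem 1 x
              have := nilAd_of_mem hm hW hx1 hz
              rw [show 1 + (i + 1) = i + 2 by omega] at this
              rw [← this]
              exact hT x hx z (ih hz)
          rw [hW] at h
          exact h hy
        have hproj : bracketFiltration D (i + 2) ≤ T.comap (gradedProj W (i + 2)) := by
          refine sup_le (fun z hz => ?_) (Submodule.span_le.2 ?_)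
          · change gradedProj W (i + 2) z ∈ T
            rw [gradedProj_eq_zero hW (by omega) hz]
            exact zero_mem _
          · rintro _ ⟨x, hx, y, hy, rfl⟩
            exact hlie x hx y hy
        intro z hz
        have := hproj (le_bracketFiltration hW _ hz)
        rwa [Submodule.mem_comap, gradedProj_of_mem hz] at this
  refine eq_top_iff.2 fun z _ => ?_
  rw [← sum_gradedProj hW hm z]
  exact sum_mem fun j _ => hlayer j (gradedProj_mem j z)

theorem gradedBracket_generates {p : ℕ} (X : Module.Basis (Fin p) ℝ D) (T : Submodule ℝ E)
    (hX : ∀ i, ι (X i) ∈ T)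
    (hT : ∀ i, ∀ y ∈ T, (gradedBracket ι hm hW).nil (ι (X i)) y ∈ T) : T = ⊤ := by
  have hspan : ∀ S : Submodule ℝ L, (∀ i, (X i : L) ∈ S) → D ≤ S := by
    intro S hS
    have h1 : (⊤ : Submodule ℝ D) ≤ S.comap D.subtype := by
      rw [← X.span_eq, Submodule.span_le]
      rintro _ ⟨i, rfl⟩
      exact hS i
    exact fun x hx => h1 (Submodule.mem_top (x := (⟨x, hx⟩ : D)))
  have htop : T.comap (ι : L →ₗ[ℝ] E) = ⊤ := by
    refine eq_top_of_nilAd_mem hm hW (hspan _ hX) fun x hx y hy => ?_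
    let S : Submodule ℝ L := T.comap (((gradedBracket ι hm hW).nil.flip (ι y)) ∘ₗ (ι : L →ₗ[ℝ] E))
    have hxS : x ∈ S := hspan S (fun i => hT i _ hy) hx
    have hxS' : (gradedBracket ι hm hW).nil (ι x) (ι y) ∈ T := hxS
    rw [gradedBracket_nil, transport_apply, ι.symm_apply_apply, ι.symm_apply_apply] at hxS'
    exact hxS'
  refine eq_top_iff.2 fun x _ => ?_
  have : ι.symm x ∈ T.comap (ι : L →ₗ[ℝ] E) := htop ▸ Submodule.mem_top
  simpa using this

end Transport


/-! ### Nilpotency of the adjoint operators. -/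

namespace GradedBracket

variable {E : Type*} [NormedAddCommGroup E] [NormedSpace ℝ E] [FiniteDimensional ℝ E]
  [CompleteSpace E] (𝔤 : GradedBracket E)

/-- The operators that raise the degree by at least `k`. -/
def raising (k : ℕ) : Submodule ℝ (E →L[ℝ] E) where
  carrier := {u | ∀ i j x, i < j + k → 𝔤.proj i (u (𝔤.proj j x)) = 0}
  zero_mem' i j x _ := by simp
  add_mem' hu hv i j x h := by simp [hu i j x h, hv i j x h]
  smul_mem' c u hu i j x h := by simp [hu i j x h]

theorem one_mem_raising : (1 : E →L[ℝ] E) ∈ 𝔤.raising 0 := fun i j x h => by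
  simpa using 𝔤.proj_proj_of_ne i j x (by omega)

theorem mul_mem_raising {k l : ℕ} {u v : E →L[ℝ] E} (hu : u ∈ 𝔤.raising k)
    (hv : v ∈ 𝔤.raising l) : u * v ∈ 𝔤.raising (k + l) := fun i j x h => by
  rw [mul_apply_eq_comp, ← 𝔤.sum_proj (v (𝔤.proj j x)), map_sum, map_sum]
  refine Finset.sum_eq_zero fun n _ => ?_
  by_cases hn : n < j + l
  · rw [hv n j x hn, map_zero, map_zero]
  · exact hu i n _ (by omega)

theorem raising_anti {k l : ℕ} (h : k ≤ l) : 𝔤.raising l ≤ 𝔤.raising k :=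
  fun _ hu i j x hi => hu i j x (by omega)

theorem pow_mem_raising {u : E →L[ℝ] E} (hu : u ∈ 𝔤.raising 1) (n : ℕ) :
    u ^ n ∈ 𝔤.raising n := by
  induction n with
  | zero => exact 𝔤.one_mem_raising
  | succ n ih => exact 𝔤.mul_mem_raising ih hu

theorem eq_zero_of_mem_raising {k : ℕ} (hk : 𝔤.step < k) {u : E →L[ℝ] E}
    (hu : u ∈ 𝔤.raising k) : u = 0 := by
  ext x
  refine 𝔤.ext_proj fun i hi => ?_
  rw [← 𝔤.sum_proj x, map_sum, map_sum, zero_apply, map_zero]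
  exact Finset.sum_eq_zero fun j _ => hu i j x (by omega)

/-- Since x has no component of degree 0, bracketing with it raises degrees by at least 1. Hence
powers beyond the step vanish and the series for exp and log are finite sums. -/
theorem nil_mem_raising (x : E) : 𝔤.nil x ∈ 𝔤.raising 1 := fun i j y h => by
  rw [nil_apply, map_sum]
  refine Finset.sum_eq_zero fun k _ => ?_
  rw [map_sum]
  refine Finset.sum_eq_zero fun l _ => ?_
  by_cases hl : l = j
  · by_cases hk : k = 0
    · rw [hk, 𝔤.proj_zero, map_zero, zero_apply, map_zero, map_zero]
    · exact 𝔤.proj_proj_of_ne _ _ _ (by omega)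
  · rw [𝔤.proj_proj_of_ne _ _ _ hl, map_zero, map_zero, map_zero]

theorem pow_eq_zero_of_mem_raising {u : E →L[ℝ] E} (hu : u ∈ 𝔤.raising 1) {n : ℕ}
    (hn : n ∉ Finset.range (𝔤.step + 1)) : u ^ n = 0 :=
  𝔤.eq_zero_of_mem_raising (by rw [Finset.mem_range] at hn; omega) (𝔤.pow_mem_raising hu n)

theorem exp_eq_sum {u : E →L[ℝ] E} (hu : u ∈ 𝔤.raising 1) :
    exp u = ∑ j ∈ Finset.range (𝔤.step + 1), (j.factorial : ℝ)⁻¹ • u ^ j := by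
  rw [exp_eq_tsum ℝ]
  exact tsum_eq_sum fun n hn => by rw [𝔤.pow_eq_zero_of_mem_raising hu hn, smul_zero]

theorem logSeries_eq_sum {u : E →L[ℝ] E} (hu : u ∈ 𝔤.raising 1) :
    logSeries u = ∑ k ∈ Finset.range (𝔤.step + 1), ((-1) ^ k / ((k : ℝ) + 1)) • u ^ k :=
  tsum_eq_sum fun n hn => by rw [𝔤.pow_eq_zero_of_mem_raising hu hn, smul_zero]

theorem exp_sub_one_mem_raising {u : E →L[ℝ] E} (hu : u ∈ 𝔤.raising 1) :
    exp u - 1 ∈ 𝔤.raising 1 := by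
  rw [𝔤.exp_eq_sum hu, Finset.sum_range_succ']
  simp only [Nat.factorial_zero, Nat.cast_one, inv_one, pow_zero, one_smul, add_sub_cancel_right]
  exact sum_mem fun j _ => Submodule.smul_mem _ _
    (𝔤.raising_anti (by omega) (𝔤.pow_mem_raising hu (j + 1)))

theorem exp_mul_exp_sub_one_mem_raising {u v : E →L[ℝ] E} (hu : u ∈ 𝔤.raising 1)
    (hv : v ∈ 𝔤.raising 1) : exp u * exp v - 1 ∈ 𝔤.raising 1 := by
  have h1 := 𝔤.exp_sub_one_mem_raising hu
  have h2 := 𝔤.exp_sub_one_mem_raising hv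
  have h3 : exp u * exp v - 1 =
      (exp u - 1) * (exp v - 1) + ((exp u - 1) + (exp v - 1)) := by noncomm_ring
  rw [h3]
  exact add_mem (𝔤.raising_anti (by omega) (𝔤.mul_mem_raising h1 h2)) (add_mem h1 h2)

end GradedBracket

/-! ### The polynomial product of the nilpotentisation. -/

section NilBCH

variable {E : Type*} [NormedAddCommGroup E] [NormedSpace ℝ E] [FiniteDimensional ℝ E]
  [CompleteSpace E]
  {L : Type*} [LieRing L] [LieAlgebra ℝ L] (ι : L ≃ₗ[ℝ] E)

/-- Evaluation of polynomials with coefficients in `End L` at a real number. -/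
def polyEval (t : ℝ) : Polynomial (Module.End ℝ L) →+* (E →L[ℝ] E) :=
  Polynomial.eval₂RingHom' ((transport ι : Module.End ℝ L →ₐ[ℝ] (E →L[ℝ] E)) : _ →+* _)
    (algebraMap ℝ (E →L[ℝ] E) t) fun _ => (Algebra.commutes _ _).symm

theorem polyEval_C (t : ℝ) (a : Module.End ℝ L) :
    polyEval ι t (Polynomial.C a) = transport ι a :=
  Polynomial.eval₂_C _ _

theorem polyEval_monomial (t : ℝ) (n : ℕ) (a : Module.End ℝ L) :
    polyEval ι t (Polynomial.monomial n a) = t ^ n • transport ι a := by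
  refine (Polynomial.eval₂_monomial _ _).trans ?_
  rw [← map_pow, ← Algebra.commutes, ← Algebra.smul_def]
  rfl

theorem polyEval_smul (t c : ℝ) (P : Polynomial (Module.End ℝ L)) :
    polyEval ι t (c • P) = c • polyEval ι t P := by
  rw [Algebra.smul_def, map_mul, Polynomial.algebraMap_apply, polyEval_C, AlgEquiv.commutes,
    ← Algebra.smul_def]

theorem polyEval_mul_sum (t : ℝ) (P : Polynomial (Module.End ℝ L)) (s : Finset ℕ) (c : ℕ → ℝ) :
    polyEval ι t (P * ∑ k ∈ s, c k • (P - 1) ^ k) =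
      polyEval ι t P * ∑ k ∈ s, c k • (polyEval ι t P - 1) ^ k := by
  simp only [map_mul, map_sum, polyEval_smul, map_pow, map_sub, map_one]

theorem integral_polyEval (P : Polynomial (Module.End ℝ L)) (y : L) :
    ∫ t in (0 : ℝ)..1, polyEval ι t P (ι y) =
      ι (P.sum fun n a => ((n : ℝ) + 1)⁻¹ • a y) := by
  have h1 : ∀ t : ℝ, polyEval ι t P (ι y) =
      ∑ n ∈ P.support, t ^ n • ι (P.coeff n y) := by
    intro t
    conv_lhs => rw [P.as_sum_support]
    rw [map_sum, sum_apply]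
    refine Finset.sum_congr rfl fun n _ => ?_
    rw [polyEval_monomial, smul_apply, transport_apply, ι.symm_apply_apply]
  simp only [h1]
  rw [intervalIntegral.integral_finsetSum fun n _ =>
    (Continuous.intervalIntegrable (by fun_prop) _ _), Polynomial.sum_def, map_sum]
  refine Finset.sum_congr rfl fun n _ => ?_
  rw [intervalIntegral.integral_smul_const, integral_pow, map_smul]
  simp

variable {D : Submodule ℝ L} {m : ℕ} (hm : bracketFiltration D m = ⊤)
  {W : ℕ → Submodule ℝ L} [DirectSum.Decomposition W]
  (hW : ∀ i : ℕ, (⨆ (j : ℕ) (_ : j ≤ i), W j) = bracketFiltration D i)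

/-- By nilpotency the series in `bch` are the truncated ones of `nilBCH`, and the integral over [0,
1] is taken coefficient by coefficient. No smallness of x and y is required. -/
theorem bch_gradedBracket_nil (x y : L) :
    bch (gradedBracket ι hm hW).nil (ι x) (ι y) = ι (nilBCH W m x y) := by
  set 𝔤 := gradedBracket ι hm hW with h𝔤
  have hstep : 𝔤.step = m := rfl
  rw [bch, nilBCH, map_add]
  congr 1
  rw [← integral_polyEval]
  refine intervalIntegral.integral_congr fun t _ => ?_
  have hx := 𝔤.nil_mem_raising (ι x)
  have hy : t • 𝔤.nil (ι y) ∈ 𝔤.raising 1 := Submodule.smul_mem _ _ (𝔤.nil_mem_raising (ι y))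
  have hA : polyEval ι t (Polynomial.C (∑ j ∈ Finset.range (m + 1),
      (j.factorial : ℝ)⁻¹ • nilAd W m x ^ j) * ∑ j ∈ Finset.range (m + 1),
        Polynomial.monomial j ((j.factorial : ℝ)⁻¹ • nilAd W m y ^ j)) =
      exp (𝔤.nil (ι x)) * exp (t • 𝔤.nil (ι y)) := by
    rw [𝔤.exp_eq_sum hx, 𝔤.exp_eq_sum hy, hstep, h𝔤, gradedBracket_nil, gradedBracket_nil,
      ι.symm_apply_apply, ι.symm_apply_apply, map_mul, polyEval_C, map_sum, map_sum]
    congr 1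
    · exact Finset.sum_congr rfl fun j _ => by rw [map_smul, map_pow]
    · refine Finset.sum_congr rfl fun j _ => ?_
      rw [polyEval_monomial, map_smul, map_pow, smul_pow, smul_comm]
  have hlog := 𝔤.logSeries_eq_sum (𝔤.exp_mul_exp_sub_one_mem_raising hx hy)
  refine congrArg (fun u : E →L[ℝ] E => u (ι y)) ?_
  rw [bchPsi, hlog, ← hA, hstep, polyEval_mul_sum]

theorem wordProd_nilpotentisation {M : ℕ} (Y : Fin M → L) (t : Fin M → ℝ) :
    wordProd (Nilpotentisation.exp : L → Nilpotentisation W m) Y t =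
      Nilpotentisation.exp
        (ι.symm (wordFold (bch (gradedBracket ι hm hW).nil) (fun i => ι (Y i)) t)) := by
  induction M with
  | zero => simp [wordProd, wordFold]; rfl
  | succ M ih =>
    rw [wordProd_succ, wordFold_succ, ih (fun i => Y i.succ), ← map_smul]
    rw [← ι.apply_symm_apply (wordFold _ _ fun i => t i.succ), bch_gradedBracket_nil,
      ι.symm_apply_apply, ι.symm_apply_apply]
    rfl

end NilBCH

/-- An infimum lies strictly below ε exactly when some word has cost below ε, so boxes can be
handled through words without attaining the infimum. -/
theorem mem_box1 {L : Type*} [AddCommGroup L] [Module ℝ L] {H : Type*} [Mul H] [One H]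
    {e : L → H} {M : ℕ} {Y : Fin M → L} {ε : ℝ} (hε : 0 < ε) {x : H} :
    x ∈ box1 e Y ε ↔ ∃ t : Fin M → ℝ, x = wordProd e Y t ∧ ∑ i, |t i| < ε := by
  simp only [box1, Set.mem_ofPred_eq, delta1, iInf_lt_iff, exists_prop,
    ENNReal.ofReal_lt_ofReal_iff hε]

end

end BallBox

/-! ### The Ball-Box theorem. -/

open BallBox

theorem mainTheorem3 {E : Type*} [NormedAddCommGroup E] [NormedSpace ℝ E] [FiniteDimensional ℝ E]
    {G : Type*} [TopologicalSpace G] [ChartedSpace E G] [Group G] [LieGroup 𝓘(ℝ, E) ∞ G]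
    [T2Space G] [ConnectedSpace G]
    -- `D` generates the Lie algebra
    (D : Submodule ℝ (GroupLieAlgebra 𝓘(ℝ, E) G)) (m : ℕ) (hm : bracketFiltration D m = ⊤)
    -- a direct sum decomposition of the Lie algebra adapted to the filtration
    (W : ℕ → Submodule ℝ (GroupLieAlgebra 𝓘(ℝ, E) G)) [DirectSum.Decomposition W]
    (hW : ∀ i : ℕ, (⨆ (j : ℕ) (_ : j ≤ i), W j) = bracketFiltration D i)
    -- a basis of `D`
    {p : ℕ} (X : Module.Basis (Fin p) ℝ D) :
    ∃ (M : ℕ) (g : Fin M → Fin p), Function.Surjective g ∧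
      (∃ U : Set G, IsOpen U ∧ 1 ∈ U ∧
        ∀ x ∈ U, ∃ t : Fin M → ℝ,
          x = wordProd lieExp (fun i => (X (g i) : GroupLieAlgebra 𝓘(ℝ, E) G)) t) ∧
      (∃ V : Set (GroupLieAlgebra 𝓘(ℝ, E) G), IsOpen V ∧ 0 ∈ V ∧
        ∀ y ∈ V, ∃ τ : Fin M → ℝ,
          (Nilpotentisation.exp y : Nilpotentisation W m) =
            wordProd Nilpotentisation.exp
              (fun i => (X (g i) : GroupLieAlgebra 𝓘(ℝ, E) G)) τ) ∧
      ∃ C : ℝ, 1 < C ∧ ∃ ε₀ : ℝ, 0 < ε₀ ∧ ∀ ε : ℝ, 0 < ε → ε < ε₀ →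
        (fun y : Nilpotentisation W m => (lieExp y.log : G)) ''
            box1 Nilpotentisation.exp (fun i => (X (g i) : GroupLieAlgebra 𝓘(ℝ, E) G)) ε ⊆
          box1 lieExp (fun i => (X (g i) : GroupLieAlgebra 𝓘(ℝ, E) G)) (C * ε) ∧
        box1 lieExp (fun i => (X (g i) : GroupLieAlgebra 𝓘(ℝ, E) G)) (C * ε) ⊆
          (fun y : Nilpotentisation W m => (lieExp y.log : G)) ''
            box1 Nilpotentisation.exp (fun i => (X (g i) : GroupLieAlgebra 𝓘(ℝ, E) G))
              (C ^ 2 * ε) := by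
  have : CompleteSpace E := FiniteDimensional.complete ℝ E
  let ι : GroupLieAlgebra 𝓘(ℝ, E) G ≃ₗ[ℝ] E := (lieEquiv E G).toLinearEquiv
  set 𝔤 := gradedBracket ι hm hW with h𝔤
  have hB : ∀ v w, 𝔤.bracket v w =
      lieEquiv E G ⁅(lieEquiv E G).symm v, (lieEquiv E G).symm w⁆ := fun v w => rfl
  obtain ⟨r, hr, hlaw⟩ := exists_expModel_mul G hB 𝔤.isRep_bracket
  have hX : ∀ i, 𝔤.proj 1 (ι (X i)) = ι (X i) := fun i => by
    rw [h𝔤, gradedBracket]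
    simp only [transport_apply, LinearEquiv.symm_apply_apply]
    rw [gradedProj_one_of_mem hW (X i).2]
  obtain ⟨M, g, hg, hU, hV, C, hC, ε₀, hε₀, hbox⟩ := 𝔤.exists_comparison (fun i => ι (X i)) hX
    (gradedBracket_generates ι hm hW X) (expModel_zero G) hr hlaw
  have hG : ∀ t : Fin M → ℝ,
      wordProd lieExp (fun i => (X (g i) : GroupLieAlgebra 𝓘(ℝ, E) G)) t =
        wordProd (expModel G) (fun i => ι (X (g i))) t := fun t => rfl
  have hN := fun t : Fin M → ℝ => wordProd_nilpotentisation ι hm hW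
    (fun i => (X (g i) : GroupLieAlgebra 𝓘(ℝ, E) G)) t
  refine ⟨M, g, hg, ?_, ?_, C, hC, ε₀, hε₀, fun ε hε hε' => ?_⟩
  -- The representation by words holds for vectors near 0; openness of the exponential map at 0
  -- transfers it to a neighbourhood of the identity in G.
  · obtain ⟨U, hU', hUo, hU1⟩ := mem_nhds_iff.1 (image_expModel_mem_nhds G hB hU)
    refine ⟨U, hUo, hU1, fun x hx => ?_⟩
    obtain ⟨v, ⟨t, ht⟩, rfl⟩ := hU' hx
    exact ⟨t, ht.trans (hG t).symm⟩
  · obtain ⟨V, hV', hVo, hV0⟩ := mem_nhds_iff.1 hV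
    refine ⟨lieEquiv E G ⁻¹' V, hVo.preimage (lieEquiv E G).continuous, hV0, fun y hy => ?_⟩
    obtain ⟨t, ht⟩ := hV' hy
    refine ⟨t, ?_⟩
    rw [hN, ← ht]
    exact congrArg _ (ι.symm_apply_apply y).symm
  · have hCε : 0 < C * ε := by positivity
    have hCε' : 0 < C ^ 2 * ε := by positivity
    obtain ⟨h1, h2⟩ := hbox ε hε hε'
    constructor
    · rintro _ ⟨y, hy, rfl⟩
      obtain ⟨t, rfl, ht⟩ := (mem_box1 hε).1 hy
      obtain ⟨s, hs, hs'⟩ := h1 t ht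
      refine (mem_box1 hCε).2 ⟨s, ?_, hs⟩
      rw [hG, ← hs', hN]
      rfl
    · intro x hx
      obtain ⟨t, rfl, ht⟩ := (mem_box1 hCε).1 hx
      obtain ⟨s, hs, hs'⟩ := h2 t ht
      refine ⟨_, (mem_box1 hCε').2 ⟨s, rfl, hs⟩, ?_⟩
      rw [hG, hs', hN]
      rfl
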